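/- **Theorem.** There are a program of the word RAM (unit-cost random access machine) and constants $d$ and $C$ such that the following holds for all integers $n,\sigma$ with $2\le\sigma\le n$, every indeterminate string $T$ of length $n$ over an alphabet $\Sigma$ of size $\sigma$, and every word size $w$ with $2^w\ge(n+\sigma k)^d$ (so $w=O(\log(n+\sigma k))$ bits suffice), where $k$ denotes the number of non-solid symbols of $T$. Given $T$, the program computes a shortest cover of $T$, together with its length, in at most $$C\cdot n\,\sigma^{k/2}\,\max(k,1)$$ steps; that is, the running time is $O(n\sigma^{k/2}k)$ for $k\ge1$ and $O(n)$ for $k=0$. Here an indeterminate string of length $n$ over $\Sigma$ is a sequence $T[1]\dots T[n]$ of nonempty subsets of $\Sigma$; the symbol $T[i]$ is solid if $|T[i]|=1$ and non-solid otherwise, and a string all of whose symbols are solid is a solid string. A solid string $S$ of length $m$ occurs in $T$ at position $j$, where $1\le j\le n-m+1$, if $S[i]\cap T[j+i-1]\neq\emptyset$ for all $i=1,\dots,m$. It is a cover of $T$ if for each position $i\in\{1,\dots,n\}$ it occurs in $T$ at some position $j$ with $i-m+1\le j\le i$. The letters are the integers $0,\dots,\sigma-1$, and $T$ is given by $n$,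 $\sigma$, one word for each symbol (the letter itself, or a reference to a bit vector if the symbol is non-solid), and one bit vector of size $\sigma$ for each non-solid symbol, one word per entry, so that the input size is $O(n+\sigma k)$ words. -/

import Mathlib

/-- An indeterminate string (i-string) of length `n` over the alphabet `α`: a sequence of `n`
nonempty subsets of the alphabet. Positions are numbered `0, …, n - 1`. -/
structure IString (α : Type*) (n : ℕ) where
  /-- the symbol at a given position -/
  sym : Fin n → Finset α
  /-- no symbol is the empty set -/
  sym_nonempty : ∀ i, (sym i).Nonempty

namespace IString

/-- The symbol at position `i` is solid: it represents a single letter. -/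
def SolidAt {α : Type*} {n : ℕ} (T : IString α n) (i : Fin n) : Prop :=
  (T.sym i).card = 1

instance {α : Type*} {n : ℕ} (T : IString α n) : DecidablePred T.SolidAt :=
  fun i => inferInstanceAs (Decidable ((T.sym i).card = 1))

/-- A solid string: all symbols are solid. -/
def IsSolid {α : Type*} {n : ℕ} (T : IString α n) : Prop :=
  ∀ i, T.SolidAt i

/-- The list of the non-solid positions of `T`, in increasing order. -/
def nonSolidPositions {α : Type*} {n : ℕ} (T : IString α n) : List (Fin n) :=
  (List.finRange n).filter fun i => ¬ T.SolidAt i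

/-- The number `k` of non-solid symbols of `T`. -/
def numNonSolid {α : Type*} {n : ℕ} (T : IString α n) : ℕ :=
  T.nonSolidPositions.length

/-- Two i-strings of the same length match if their symbols at each position intersect. -/
def Matches {α : Type*} {n : ℕ} (U V : IString α n) : Prop :=
  ∀ i, ∃ c, c ∈ U.sym i ∧ c ∈ V.sym i

/-- The factor of `T` of length `m` that starts at position `j`. -/
def factor {α : Type*} {n : ℕ} (T : IString α n) (j m : ℕ) (h : j + m ≤ n) : IString α m where
  sym i := T.sym ⟨j + i, by omega⟩
  sym_nonempty i := T.sym_nonempty ⟨j + i, by omega⟩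

/-- The set of the positions at which `S` occurs in `T`. -/
def Occ {α : Type*} {m n : ℕ} (S : IString α m) (T : IString α n) : Set ℕ :=
  {j | ∃ h : j + m ≤ n, S.Matches (T.factor j m h)}

/-- `S` is a (solid) cover of `T`: `S` is a solid string, and every position of `T` lies within
an occurrence of `S` in `T`. -/
def IsCover {α : Type*} {m n : ℕ} (S : IString α m) (T : IString α n) : Prop :=
  S.IsSolid ∧ ∀ i, i < n → ∃ j ∈ Occ S T, j ≤ i ∧ i < j + m

/-- `S` is a cover of `T` of the smallest possible length. -/
def IsShortestCover {α : Type*} {m n : ℕ} (S : IString α m) (T : IString α n) : Prop :=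
  S.IsCover T ∧ ∀ (m' : ℕ) (S' : IString α m'), S'.IsCover T → m ≤ m'

/-- The machine word that stands for the symbol at position `i`: a solid symbol is given by its
letter, a number below `σ`; a non-solid symbol by `σ + r`, if it is the `r`-th
non-solid symbol of `T` (counted from `0`). -/
def symCode {σ n : ℕ} (T : IString (Fin σ) n) (i : Fin n) : ℕ :=
  if T.SolidAt i then ((T.sym i).min' (T.sym_nonempty i) : Fin σ)
  else σ + (T.nonSolidPositions.filter fun j => j < i).length

/-- The subset of the alphabet at position `i`, as a bit vector of size `σ`. -/
def bitVector {σ n : ℕ} (T : IString (Fin σ) n) (i : Fin n) : List ℕ :=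
  List.ofFn fun c : Fin σ => if c ∈ T.sym i then 1 else 0

/-- The input representation of `T`: the `n` words for its symbols, followed by the bit vectors
of the non-solid symbols from left to right. There are `n + σ * k` words in total. -/
def encode {σ n : ℕ} (T : IString (Fin σ) n) : List ℕ :=
  List.ofFn T.symCode ++ T.nonSolidPositions.flatMap T.bitVector

end IString

/-! ## Programs of a word RAM, with their running time -/

namespace WordRAM

/-- A memory state: finitely many registers are used by any one program; the main memory is
addressed by words. -/
structure State where
  /-- contents of the registers -/
  reg : ℕ → ℕ
  /-- contents of the main memory -/
  mem : ℕ → ℕ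

/-- Arithmetic expressions over literals, registers and memory cells. -/
inductive Expr where
  | lit (c : ℕ)
  | reg (x : ℕ)
  | mem (address : Expr)
  | add (e₁ e₂ : Expr)
  | sub (e₁ e₂ : Expr)
  | mul (e₁ e₂ : Expr)

/-- The value of an expression on a machine with `w`-bit words. Addition and multiplication are
modulo `2 ^ w`, subtraction is truncated at `0`. -/
def Expr.eval (w : ℕ) (s : State) : Expr → ℕ
  | .lit c => c % 2 ^ w
  | .reg x => s.reg x
  | .mem a => s.mem (a.eval w s)
  | .add e₁ e₂ => (e₁.eval w s + e₂.eval w s) % 2 ^ w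
  | .sub e₁ e₂ => e₁.eval w s - e₂.eval w s
  | .mul e₁ e₂ => (e₁.eval w s * e₂.eval w s) % 2 ^ w

/-- Every literal, register access, memory access and arithmetic operation takes one step. -/
def Expr.cost : Expr → ℕ
  | .lit _ => 1
  | .reg _ => 1
  | .mem a => a.cost + 1
  | .add e₁ e₂ => e₁.cost + e₂.cost + 1
  | .sub e₁ e₂ => e₁.cost + e₂.cost + 1
  | .mul e₁ e₂ => e₁.cost + e₂.cost + 1

/-- Tests. -/
inductive Test where
  | lt (e₁ e₂ : Expr)
  | eq (e₁ e₂ : Expr)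
  | not (b : Test)
  | and (b₁ b₂ : Test)

/-- The truth value of a test. -/
def Test.eval (w : ℕ) (s : State) : Test → Prop
  | .lt e₁ e₂ => e₁.eval w s < e₂.eval w s
  | .eq e₁ e₂ => e₁.eval w s = e₂.eval w s
  | .not b => ¬ b.eval w s
  | .and b₁ b₂ => b₁.eval w s ∧ b₂.eval w s

/-- The number of steps taken by a test. -/
def Test.cost : Test → ℕ
  | .lt e₁ e₂ => e₁.cost + e₂.cost + 1
  | .eq e₁ e₂ => e₁.cost + e₂.cost + 1
  | .not b => b.cost + 1
  | .and b₁ b₂ => b₁.cost + b₂.cost + 1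

/-- Programs. -/
inductive Program where
  /-- do nothing -/
  | skip
  /-- write the value of `e` to the register `x` -/
  | assign (x : ℕ) (e : Expr)
  /-- write the value of `e` to the memory cell with the given address -/
  | store (address e : Expr)
  /-- sequential composition -/
  | seq (p q : Program)
  /-- if `b` then `p` else `q` -/
  | branch (b : Test) (p q : Program)
  /-- while `b` do `p` -/
  | loop (b : Test) (p : Program)

/-- `Exec w p s s' t`: on a machine with `w`-bit words, the program `p` started in the state `s`
halts in the state `s'` after `t` steps. -/
inductive Exec (w : ℕ) : Program → State → State → ℕ → Prop where
  | skip (s : State) : Exec w .skip s s 1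
  | assign (x : ℕ) (e : Expr) (s : State) :
      Exec w (.assign x e) s ⟨Function.update s.reg x (e.eval w s), s.mem⟩ (e.cost + 1)
  | store (a e : Expr) (s : State) :
      Exec w (.store a e) s ⟨s.reg, Function.update s.mem (a.eval w s) (e.eval w s)⟩
        (a.cost + e.cost + 1)
  | seq {p q : Program} {s s' s'' : State} {t t' : ℕ} :
      Exec w p s s' t → Exec w q s' s'' t' → Exec w (.seq p q) s s'' (t + t')
  | branch_true {b : Test} {p q : Program} {s s' : State} {t : ℕ} :
      b.eval w s → Exec w p s s' t → Exec w (.branch b p q) s s' (b.cost + 1 + t)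
  | branch_false {b : Test} {p q : Program} {s s' : State} {t : ℕ} :
      ¬ b.eval w s → Exec w q s s' t → Exec w (.branch b p q) s s' (b.cost + 1 + t)
  | loop_true {b : Test} {p : Program} {s s' s'' : State} {t t' : ℕ} :
      b.eval w s → Exec w p s s' t → Exec w (.loop b p) s' s'' t' →
        Exec w (.loop b p) s s'' (b.cost + 1 + t + t')
  | loop_false {b : Test} {p : Program} {s : State} :
      ¬ b.eval w s → Exec w (.loop b p) s s (b.cost + 1)

/-- The initial state for the input `T`: the length `n` is in register `0`, the alphabet size `σ`
in register `1`, the representation of `T` in the memory from address `0` on; everything else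
is `0`. -/
def initState {σ n : ℕ} (T : IString (Fin σ) n) : State where
  reg x := if x = 0 then n else if x = 1 then σ else 0
  mem a := T.encode.getD a 0

/-- The state `s` holds the solid string `S` of length `m` as output: `m` is in register `0`, and
the letters of `S` are in consecutive memory cells whose first address is in register `1`. -/
def Outputs {σ m : ℕ} (s : State) (S : IString (Fin σ) m) : Prop :=
  s.reg 0 = m ∧ ∀ i : Fin m, ∃ c : Fin σ, S.sym i = {c} ∧ s.mem (s.reg 1 + i) = c

end WordRAM

/-! Why it is true. Positions are counted from 0. A cover of length m occurs both at the start and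
at the end of T. If 2m ≥ n, these two occurrences alone cover T. Hence a cover of length m exists
exactly when T matches its own shift by n - m, and any choice of common letters in the overlap gives
one; the shortest long cover comes from the largest such shift up to n/2 (`run_longPhase`). If 2m <
n, the prefix and the suffix of T of length m are disjoint, so one of them has at most k/2 non-solid
symbols; since reversing T exchanges them (`nonSolid_reverse`), it suffices to treat prefixes of T
and of its reversal.

Let ell be the length of the longest prefix of T with at most k/2 non-solid symbols. A cover occurs
at position 0, so it copies T at the solid positions and is determined by its letters at the others.
Every cover of length at most ell is therefore a prefix of one of at most σ^⌊k/2⌋ solid candidates U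
of length ell (`exists_letters`), which are run through like a counter in base σ. For each U, the
shortest prefix of U that covers T has to be found in time O(n · max(k, 1)).

Mismatch table. Put W = UT and compute, for each shift p, the first mismatch of W with its shift by
p; for p = ell + j this tells which prefixes of U occur in T at j (`le_prf_iff`). Matching is not
transitive, so the Z-algorithm cannot be run on it. It is run on equality of symbol codes instead
(`window_reuse`), against the suffix at a = 0 and at a = q + 1 for each non-solid position q. This
suffices (`isPref_of_rec`): a mismatch involving a non-solid symbol is found by comparing that
symbol with all others; from a mismatch of two solid symbols one walks back through solid pairs
until the start of W or a non-solid symbol, and the common extension computed from there ends at a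
mismatch of solid symbols that is not later. The cost is linear for each non-solid symbol, plus O(σ)
for each comparison of two non-solid symbols. The latter are not needed for UT, as U is solid; in
the long phase they cost O(k²σ), which is within the bound (`coverCost_le`).

Checking all prefixes of U at once. Let P j be the length of the longest prefix of U occurring at j.
The prefix of length m covers T iff m ≤ P 0 and consecutive positions with P ≥ m, including the
sentinel n, are at distance at most m. The relevant distances are recorded under the largest value
strictly between the two ends, found with a stack of previous greater values in linear time
(`coversBy_iff_gap`, `run_climb`).

Machine model. The algorithm is written in a small language with named variables and arrays, whose
translation to the word RAM costs a constant factor (`HExec.exec_compile`). Correctness, absence of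
overflow and running time are proved together, in a logic where the assertions also speak of the
remaining time credits. -/

set_option linter.constructorNameAsVariable false
set_option linter.unusedSimpArgs false

namespace WordRAM

/-! ## A structured language with named variables and arrays -/

/-- The variables of the language; each is kept in a register. -/
inductive Var
  | n | sigma | base | k | i | len | lim | q | a | y | rend | l | r | e | lo | hi | u | v | c
  | shift | p | cnt | ell | go | j | t | g | m | blen
  deriving DecidableEq

/-- The arrays of the language; each is kept in a block of the main memory. -/
inductive Arr
  | txt | wrd | pre | ext | prf | gap | par | best | rev
  deriving DecidableEq

/-- The register of a variable. -/
def Var.idx : Var → ℕ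
  | .n => 0 | .sigma => 1 | .base => 2 | .k => 3 | .i => 4 | .len => 5 | .lim => 6 | .q => 7
  | .a => 8 | .y => 9 | .rend => 10 | .l => 11 | .r => 12 | .e => 13 | .lo => 14 | .hi => 15
  | .u => 16 | .v => 17 | .c => 18 | .shift => 19 | .p => 20 | .cnt => 21 | .ell => 22 | .go => 23
  | .j => 24 | .t => 25 | .g => 26 | .m => 27 | .blen => 28

/-- The number of the block of an array. -/
def Arr.idx : Arr → ℕ
  | .txt => 0 | .wrd => 1 | .pre => 2 | .ext => 3 | .prf => 4 | .gap => 5 | .par => 6 | .best => 7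
  | .rev => 8

theorem Var.idx_injective : Function.Injective Var.idx := by
  intro x y h
  cases x <;> cases y <;> first | rfl | cases h

theorem Arr.idx_injective : Function.Injective Arr.idx := by
  intro x y h
  cases x <;> cases y <;> first | rfl | cases h

theorem Arr.idx_le (A : Arr) : A.idx ≤ 8 := by
  cases A <;> decide

/-- What is fixed during a computation: the size `D` which determines the memory blocks, the
number `M` of machine words, and the input. -/
structure Env where
  D : ℕ
  M : ℕ
  inp : ℕ → ℕ

/-- A state: values of the variables and contents of the arrays. -/
structure Store where
  r : Var → ℕ
  a : Arr → ℕ → ℕ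

/-- Assign to a variable. -/
def Store.set (st : Store) (x : Var) (v : ℕ) : Store := ⟨Function.update st.r x v, st.a⟩

/-- Assign to an array cell. -/
def Store.put (st : Store) (A : Arr) (i v : ℕ) : Store :=
  ⟨st.r, Function.update st.a A (Function.update (st.a A) i v)⟩

@[simp] theorem Store.set_r (st : Store) (x y : Var) (v : ℕ) :
    (st.set x v).r y = if y = x then v else st.r y := by
  simp [Store.set, Function.update_apply]

@[simp] theorem Store.set_a (st : Store) (x : Var) (v : ℕ) : (st.set x v).a = st.a := rfl

@[simp] theorem Store.put_r (st : Store) (A : Arr) (i v : ℕ) : (st.put A i v).r = st.r := rfl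

@[simp] theorem Store.put_a (st : Store) (A B : Arr) (i v : ℕ) :
    (st.put A i v).a B = if B = A then Function.update (st.a A) i v else st.a B := by
  by_cases h : B = A
  · subst h; simp [Store.put]
  · simp [Store.put, h]

/-- Arithmetic expressions. -/
inductive AExp
  | lit (c : ℕ)
  | var (x : Var)
  | arr (A : Arr) (e : AExp)
  | inp (e : AExp)
  | add (e₁ e₂ : AExp)
  | sub (e₁ e₂ : AExp)
  | mul (e₁ e₂ : AExp)

prefix:max "♯" => AExp.var

instance : Add AExp := ⟨AExp.add⟩
instance : Sub AExp := ⟨AExp.sub⟩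
instance : Mul AExp := ⟨AExp.mul⟩
instance (c : ℕ) : OfNat AExp c := ⟨AExp.lit c⟩

namespace AExp

/-- The value of an expression, in natural numbers. -/
def val (E : Env) (st : Store) : AExp → ℕ
  | lit c => c
  | var x => st.r x
  | arr A e => st.a A (e.val E st)
  | inp e => E.inp (e.val E st)
  | add e₁ e₂ => e₁.val E st + e₂.val E st
  | sub e₁ e₂ => e₁.val E st - e₂.val E st
  | mul e₁ e₂ => e₁.val E st * e₂.val E st

/-- No overflow and no access outside the arrays happens in the evaluation. -/
def ok (E : Env) (st : Store) : AExp → Prop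
  | lit c => c < E.M
  | var _ => True
  | arr _ e => e.ok E st ∧ st.r .base = E.D ∧ e.val E st < 4 * E.D
  | inp e => e.ok E st ∧ e.val E st < E.D
  | add e₁ e₂ => e₁.ok E st ∧ e₂.ok E st ∧ e₁.val E st + e₂.val E st < E.M
  | sub e₁ e₂ => e₁.ok E st ∧ e₂.ok E st
  | mul e₁ e₂ => e₁.ok E st ∧ e₂.ok E st ∧ e₁.val E st * e₂.val E st < E.M

/-- The address of the cells of an array. -/
def blockAddr (A : Arr) (e : Expr) : Expr :=
  .add (.mul (.lit (4 * A.idx + 1)) (.reg Var.base.idx)) e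

/-- Translation to the word RAM. -/
def compile : AExp → Expr
  | lit c => .lit c
  | var x => .reg x.idx
  | arr A e => .mem (blockAddr A e.compile)
  | inp e => .mem e.compile
  | add e₁ e₂ => .add e₁.compile e₂.compile
  | sub e₁ e₂ => .sub e₁.compile e₂.compile
  | mul e₁ e₂ => .mul e₁.compile e₂.compile

section
variable (E : Env) (st : Store) (e₁ e₂ : AExp)

@[simp] theorem val_zero : (0 : AExp).val E st = 0 := rfl
@[simp] theorem val_one : (1 : AExp).val E st = 1 := rfl
@[simp] theorem val_var (x : Var) : (var x).val E st = st.r x := rfl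
@[simp] theorem val_arr (A : Arr) (e : AExp) : (arr A e).val E st = st.a A (e.val E st) := rfl
@[simp] theorem val_inp (e : AExp) : (inp e).val E st = E.inp (e.val E st) := rfl
@[simp] theorem val_add : (e₁ + e₂).val E st = e₁.val E st + e₂.val E st := rfl
@[simp] theorem val_sub : (e₁ - e₂).val E st = e₁.val E st - e₂.val E st := rfl
@[simp] theorem val_mul : (e₁ * e₂).val E st = e₁.val E st * e₂.val E st := rfl
@[simp] theorem ok_zero : (0 : AExp).ok E st ↔ 0 < E.M := Iff.rfl
@[simp] theorem ok_one : (1 : AExp).ok E st ↔ 1 < E.M := Iff.rfl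
@[simp] theorem ok_var (x : Var) : (var x).ok E st ↔ True := Iff.rfl
@[simp] theorem ok_arr (A : Arr) (e : AExp) : (arr A e).ok E st ↔
    e.ok E st ∧ st.r .base = E.D ∧ e.val E st < 4 * E.D := Iff.rfl
@[simp] theorem ok_inp (e : AExp) : (inp e).ok E st ↔ e.ok E st ∧ e.val E st < E.D := Iff.rfl
@[simp] theorem ok_add : (e₁ + e₂).ok E st ↔
    e₁.ok E st ∧ e₂.ok E st ∧ e₁.val E st + e₂.val E st < E.M := Iff.rfl
@[simp] theorem ok_sub : (e₁ - e₂).ok E st ↔ e₁.ok E st ∧ e₂.ok E st := Iff.rfl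
@[simp] theorem ok_mul : (e₁ * e₂).ok E st ↔
    e₁.ok E st ∧ e₂.ok E st ∧ e₁.val E st * e₂.val E st < E.M := Iff.rfl
end

end AExp

/-- Tests. -/
inductive BExp
  | lt (e₁ e₂ : AExp)
  | eq (e₁ e₂ : AExp)
  | not (b : BExp)
  | and (b₁ b₂ : BExp)

namespace BExp

/-- The truth value of a test. -/
def val (E : Env) (st : Store) : BExp → Prop
  | lt e₁ e₂ => e₁.val E st < e₂.val E st
  | eq e₁ e₂ => e₁.val E st = e₂.val E st
  | not b => ¬ b.val E st
  | and b₁ b₂ => b₁.val E st ∧ b₂.val E st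

/-- All expressions in the test can be evaluated. -/
def ok (E : Env) (st : Store) : BExp → Prop
  | lt e₁ e₂ => e₁.ok E st ∧ e₂.ok E st
  | eq e₁ e₂ => e₁.ok E st ∧ e₂.ok E st
  | not b => b.ok E st
  | and b₁ b₂ => b₁.ok E st ∧ b₂.ok E st

/-- Translation to the word RAM. -/
def compile : BExp → Test
  | lt e₁ e₂ => .lt e₁.compile e₂.compile
  | eq e₁ e₂ => .eq e₁.compile e₂.compile
  | not b => .not b.compile
  | and b₁ b₂ => .and b₁.compile b₂.compile

section
variable (E : Env) (st : Store) (e₁ e₂ : AExp) (b₁ b₂ : BExp)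

@[simp] theorem val_lt : (lt e₁ e₂).val E st ↔ e₁.val E st < e₂.val E st := Iff.rfl
@[simp] theorem val_eq : (eq e₁ e₂).val E st ↔ e₁.val E st = e₂.val E st := Iff.rfl
@[simp] theorem val_not : (not b₁).val E st ↔ ¬ b₁.val E st := Iff.rfl
@[simp] theorem val_and : (and b₁ b₂).val E st ↔ b₁.val E st ∧ b₂.val E st := Iff.rfl
@[simp] theorem ok_lt : (lt e₁ e₂).ok E st ↔ e₁.ok E st ∧ e₂.ok E st := Iff.rfl
@[simp] theorem ok_eq : (eq e₁ e₂).ok E st ↔ e₁.ok E st ∧ e₂.ok E st := Iff.rfl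
@[simp] theorem ok_not : (not b₁).ok E st ↔ b₁.ok E st := Iff.rfl
@[simp] theorem ok_and : (and b₁ b₂).ok E st ↔ b₁.ok E st ∧ b₂.ok E st := Iff.rfl
end

end BExp

/-- Commands. -/
inductive Cmd
  | skip
  | assign (x : Var) (e : AExp)
  | store (A : Arr) (e₁ e₂ : AExp)
  | seq (p q : Cmd)
  | branch (b : BExp) (p q : Cmd)
  | loop (b : BExp) (p : Cmd)

infixr:60 " ;; " => Cmd.seq

namespace Cmd

/-- The variables that a command may change. -/
def vars : Cmd → List Var
  | skip => []
  | assign x _ => [x]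
  | store _ _ _ => []
  | seq p q => p.vars ++ q.vars
  | branch _ p q => p.vars ++ q.vars
  | loop _ p => p.vars

/-- The arrays that a command may change. -/
def arrs : Cmd → List Arr
  | skip => []
  | assign _ _ => []
  | store A _ _ => [A]
  | seq p q => p.arrs ++ q.arrs
  | branch _ p q => p.arrs ++ q.arrs
  | loop _ p => p.arrs

/-- Translation to the word RAM. -/
def compile : Cmd → Program
  | skip => .skip
  | assign x e => .assign x.idx e.compile
  | store A e₁ e₂ => .store (AExp.blockAddr A e₁.compile) e₂.compile
  | seq p q => .seq p.compile q.compile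
  | branch b p q => .branch b.compile p.compile q.compile
  | loop b p => .loop b.compile p.compile

/-- A bound for the number of machine steps of a basic step of the command. -/
def weight : Cmd → ℕ
  | skip => 1
  | assign _ e => e.compile.cost + 1
  | store A e₁ e₂ => (AExp.blockAddr A e₁.compile).cost + e₂.compile.cost + 1
  | seq p q => max p.weight q.weight
  | branch b p q => max (b.compile.cost + 1) (max p.weight q.weight)
  | loop b p => max (b.compile.cost + 1) p.weight

end Cmd

/-- Execution of a command, with the number of basic steps. -/
inductive HExec (E : Env) : Cmd → Store → Store → ℕ → Prop where
  | skip (st : Store) : HExec E .skip st st 1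
  | assign (x : Var) (e : AExp) (st : Store) (h : e.ok E st) :
      HExec E (.assign x e) st (st.set x (e.val E st)) 1
  | store (A : Arr) (e₁ e₂ : AExp) (st : Store) (h₁ : e₁.ok E st) (h₂ : e₂.ok E st)
      (hb : st.r .base = E.D) (h : e₁.val E st < 4 * E.D) :
      HExec E (.store A e₁ e₂) st (st.put A (e₁.val E st) (e₂.val E st)) 1
  | seq {p q : Cmd} {st st' st'' : Store} {t t' : ℕ} :
      HExec E p st st' t → HExec E q st' st'' t' → HExec E (.seq p q) st st'' (t + t')
  | branch_true {b : BExp} {p q : Cmd} {st st' : Store} {t : ℕ} :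
      b.ok E st → b.val E st → HExec E p st st' t → HExec E (.branch b p q) st st' (1 + t)
  | branch_false {b : BExp} {p q : Cmd} {st st' : Store} {t : ℕ} :
      b.ok E st → ¬ b.val E st → HExec E q st st' t → HExec E (.branch b p q) st st' (1 + t)
  | loop_true {b : BExp} {p : Cmd} {st st' st'' : Store} {t t' : ℕ} :
      b.ok E st → b.val E st → HExec E p st st' t → HExec E (.loop b p) st' st'' t' →
        HExec E (.loop b p) st st'' (1 + t + t')
  | loop_false {b : BExp} {p : Cmd} {st : Store} :
      b.ok E st → ¬ b.val E st → HExec E (.loop b p) st st 1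

/-- The two states differ at most in the variables and arrays that `p` may change. -/
def Same (p : Cmd) (st st' : Store) : Prop :=
  (∀ x, x ∉ p.vars → st'.r x = st.r x) ∧ ∀ A, A ∉ p.arrs → st'.a A = st.a A

theorem HExec.same {E : Env} {p : Cmd} {st st' : Store} {t : ℕ} (h : HExec E p st st' t) :
    Same p st st' := by
  unfold Same
  induction h <;> simp_all [Cmd.vars, Cmd.arrs]

/-! ### Correctness of the translation -/

/-- The machine state `s` represents the state `st`. -/
structure Rep (E : Env) (s : State) (st : Store) : Prop where
  reg : ∀ x : Var, s.reg x.idx = st.r x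
  mem : ∀ A : Arr, ∀ i, i < 4 * E.D → s.mem ((4 * A.idx + 1) * E.D + i) = st.a A i
  inp : ∀ i, i < E.D → s.mem i = E.inp i

section
variable {E : Env} {w : ℕ} (hM : E.M = 2 ^ w) (hD : 200 * E.D ≤ E.M) {s : State} {st : Store}
include hM hD

/-- There are nine blocks of 4D cells, the last starting at 33D. All addresses stay below 37D, so
the arithmetic modulo the number of machine words never wraps. -/
theorem eval_blockAddr (hs : Rep E s st) (A : Arr) (e : Expr) (hb : st.r .base = E.D)
    (he : e.eval w s < 4 * E.D) :
    (AExp.blockAddr A e).eval w s = (4 * A.idx + 1) * E.D + e.eval w s := by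
  have h1 := A.idx_le
  have h2 : (4 * A.idx + 1) * E.D ≤ 33 * E.D := Nat.mul_le_mul_right _ (by omega)
  simp only [AExp.blockAddr, Expr.eval, hs.reg, hb, ← hM]
  rw [Nat.mod_eq_of_lt (show 4 * A.idx + 1 < E.M by omega),
    Nat.mod_eq_of_lt (show (4 * A.idx + 1) * E.D < E.M by omega),
    Nat.mod_eq_of_lt (by omega)]

theorem AExp.eval_compile (hs : Rep E s st) (e : AExp) (he : e.ok E st) :
    e.compile.eval w s = e.val E st := by
  induction e with
  | lit c => exact Nat.mod_eq_of_lt (hM ▸ he)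
  | var x => exact hs.reg x
  | arr A e ih =>
    obtain ⟨h1, h2, h3⟩ := he
    have := ih h1
    simp only [compile, Expr.eval]
    rw [eval_blockAddr hM hD hs A _ h2 (by omega), this]
    exact hs.mem A _ h3
  | inp e ih =>
    obtain ⟨h1, h2⟩ := he
    simp only [compile, Expr.eval, ih h1]
    exact hs.inp _ h2
  | add e₁ e₂ ih₁ ih₂ =>
    obtain ⟨h1, h2, h3⟩ := he
    simp only [compile, Expr.eval, ih₁ h1, ih₂ h2, ← hM]
    exact Nat.mod_eq_of_lt h3
  | sub e₁ e₂ ih₁ ih₂ =>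
    obtain ⟨h1, h2⟩ := he
    simp only [compile, Expr.eval, ih₁ h1, ih₂ h2, val]
  | mul e₁ e₂ ih₁ ih₂ =>
    obtain ⟨h1, h2, h3⟩ := he
    simp only [compile, Expr.eval, ih₁ h1, ih₂ h2, ← hM]
    exact Nat.mod_eq_of_lt h3

theorem BExp.eval_compile (hs : Rep E s st) (b : BExp) (hb : b.ok E st) :
    b.compile.eval w s ↔ b.val E st := by
  induction b with
  | lt e₁ e₂ =>
    simp only [compile, Test.eval, val, AExp.eval_compile hM hD hs _ hb.1,
      AExp.eval_compile hM hD hs _ hb.2]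
  | eq e₁ e₂ =>
    simp only [compile, Test.eval, val, AExp.eval_compile hM hD hs _ hb.1,
      AExp.eval_compile hM hD hs _ hb.2]
  | not b ih => simp only [compile, Test.eval, val, ih hb]
  | and b₁ b₂ ih₁ ih₂ => simp only [compile, Test.eval, val, ih₁ hb.1, ih₂ hb.2]

omit hM hD in
theorem Rep.set (hs : Rep E s st) (x : Var) (v : ℕ) :
    Rep E ⟨Function.update s.reg x.idx v, s.mem⟩ (st.set x v) where
  reg y := by
    by_cases h : y = x
    · subst h; simp
    · simp [h, Var.idx_injective.ne h, hs.reg]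
  mem := hs.mem
  inp := hs.inp

-- Writing to one array disturbs nothing else: the starts of different blocks are at least 4D apart,
-- and the input lies below D, where the first block begins.
omit hM hD in
theorem Rep.put (hs : Rep E s st) (A : Arr) (i v : ℕ) (hi : i < 4 * E.D) :
    Rep E ⟨s.reg, Function.update s.mem ((4 * A.idx + 1) * E.D + i) v⟩ (st.put A i v) where
  reg := hs.reg
  mem B j hj := by
    by_cases h : B = A
    · subst h
      by_cases hij : j = i
      · subst hij; simp
      · simp [hij, hs.mem B j hj]
    · have hne : (4 * B.idx + 1) * E.D + j ≠ (4 * A.idx + 1) * E.D + i := by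
        intro heq
        rcases lt_or_gt_of_ne (Arr.idx_injective.ne h) with h' | h'
        · have := Nat.mul_le_mul_right E.D (show 4 * B.idx + 1 + 4 ≤ 4 * A.idx + 1 by omega)
          rw [add_mul _ 4] at this; omega
        · have := Nat.mul_le_mul_right E.D (show 4 * A.idx + 1 + 4 ≤ 4 * B.idx + 1 by omega)
          rw [add_mul _ 4] at this; omega
      simp [h, hne, hs.mem B j hj]
  inp j hj := by
    have : E.D ≤ (4 * A.idx + 1) * E.D := Nat.le_mul_of_pos_left _ (by omega)
    simp only [Function.update_apply, if_neg (show j ≠ (4 * A.idx + 1) * E.D + i by omega)]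
    exact hs.inp j hj

/-- A command is executed by its translation, within `weight` machine steps for each basic
step. -/
theorem HExec.exec_compile {p : Cmd} {st' : Store} {t : ℕ} (h : HExec E p st st' t)
    (hs : Rep E s st) :
    ∃ s' t', Exec w p.compile s s' t' ∧ Rep E s' st' ∧ t' ≤ p.weight * t := by
  induction h generalizing s with
  | skip st => exact ⟨s, 1, .skip s, hs, le_rfl⟩
  | assign x e st h =>
    refine ⟨_, _, .assign _ _ s, ?_, by simp [Cmd.weight]⟩
    rw [AExp.eval_compile hM hD hs e h]
    exact hs.set x _
  | store A e₁ e₂ st h₁ h₂ hb h =>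
    refine ⟨_, _, .store _ _ s, ?_, by simp [Cmd.weight]⟩
    have he := AExp.eval_compile hM hD hs e₁ h₁
    rw [eval_blockAddr hM hD hs A _ hb (by omega), he, AExp.eval_compile hM hD hs e₂ h₂]
    exact hs.put A _ _ h
  | @seq p q st st' st'' t t' _ _ ih₁ ih₂ =>
    obtain ⟨s', u, h1, h2, h3⟩ := ih₁ hs
    obtain ⟨s'', u', h4, h5, h6⟩ := ih₂ h2
    refine ⟨s'', u + u', .seq h1 h4, h5, ?_⟩
    have h7 := Nat.mul_le_mul_right t (le_max_left p.weight q.weight)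
    have h8 := Nat.mul_le_mul_right t' (le_max_right p.weight q.weight)
    simp only [Cmd.weight, mul_add]; omega
  | @branch_true b p q st st' t hb hv _ ih =>
    obtain ⟨s', u, h1, h2, h3⟩ := ih hs
    refine ⟨s', _, .branch_true ((BExp.eval_compile hM hD hs b hb).2 hv) h1, h2, ?_⟩
    have h7 := Nat.mul_le_mul_right t (show p.weight ≤ (Cmd.branch b p q).weight by
      simp [Cmd.weight])
    have h8 : b.compile.cost + 1 ≤ (Cmd.branch b p q).weight := by simp [Cmd.weight]
    rw [mul_add]; omega
  | @branch_false b p q st st' t hb hv _ ih =>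
    obtain ⟨s', u, h1, h2, h3⟩ := ih hs
    refine ⟨s', _, .branch_false (mt (BExp.eval_compile hM hD hs b hb).1 hv) h1, h2, ?_⟩
    have h7 := Nat.mul_le_mul_right t (show q.weight ≤ (Cmd.branch b p q).weight by
      simp [Cmd.weight])
    have h8 : b.compile.cost + 1 ≤ (Cmd.branch b p q).weight := by simp [Cmd.weight]
    rw [mul_add]; omega
  | @loop_true b p st st' st'' t t' hb hv _ _ ih₁ ih₂ =>
    obtain ⟨s', u, h1, h2, h3⟩ := ih₁ hs
    obtain ⟨s'', u', h4, h5, h6⟩ := ih₂ h2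
    refine ⟨s'', _, .loop_true ((BExp.eval_compile hM hD hs b hb).2 hv) h1 h4, h5, ?_⟩
    have h7 := Nat.mul_le_mul_right t (show p.weight ≤ (Cmd.loop b p).weight by
      simp [Cmd.weight])
    have h8 : b.compile.cost + 1 ≤ (Cmd.loop b p).weight := by simp [Cmd.weight]
    rw [mul_add, mul_add]; omega
  | @loop_false b p st hb hv =>
    refine ⟨s, _, .loop_false (mt (BExp.eval_compile hM hD hs b hb).1 hv), hs, ?_⟩
    simp [Cmd.weight]

end

/-! ### Program logic with time credits -/

/-- Started in `st` with `c` time credits, the command `p` halts with the credits not exhausted,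
and the final state and the remaining credits satisfy `Q`. -/
def Run (E : Env) (p : Cmd) (st : Store) (c : ℕ) (Q : Store → ℕ → Prop) : Prop :=
  ∃ st' t, HExec E p st st' t ∧ t ≤ c ∧ Q st' (c - t)

section
variable {E : Env} {p q : Cmd} {st : Store} {c : ℕ} {Q Q' : Store → ℕ → Prop}

-- This and the following equivalences let `simp` compute the weakest precondition of loop-free
-- code. What remains are mostly inequalities about values and credits, suited to `omega`.
@[simp] theorem run_skip : Run E .skip st c Q ↔ 1 ≤ c ∧ Q st (c - 1) := by
  constructor
  · rintro ⟨st', t, h, h1, h2⟩; cases h; exact ⟨h1, h2⟩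
  · rintro ⟨h1, h2⟩; exact ⟨_, _, .skip st, h1, h2⟩

@[simp] theorem run_assign {x : Var} {e : AExp} : Run E (.assign x e) st c Q ↔
    e.ok E st ∧ 1 ≤ c ∧ Q (st.set x (e.val E st)) (c - 1) := by
  constructor
  · rintro ⟨st', t, h, h1, h2⟩; cases h; exact ⟨‹_›, h1, h2⟩
  · rintro ⟨h0, h1, h2⟩; exact ⟨_, _, .assign x e st h0, h1, h2⟩

@[simp] theorem run_store {A : Arr} {e₁ e₂ : AExp} : Run E (.store A e₁ e₂) st c Q ↔
    (e₁.ok E st ∧ e₂.ok E st ∧ st.r .base = E.D ∧ e₁.val E st < 4 * E.D) ∧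
      1 ≤ c ∧ Q (st.put A (e₁.val E st) (e₂.val E st)) (c - 1) := by
  constructor
  · rintro ⟨st', t, h, h1, h2⟩; cases h; exact ⟨⟨‹_›, ‹_›, ‹_›, ‹_›⟩, h1, h2⟩
  · rintro ⟨⟨h3, h4, h5, h6⟩, h1, h2⟩; exact ⟨_, _, .store A e₁ e₂ st h3 h4 h5 h6, h1, h2⟩

@[simp] theorem run_seq :
    Run E (.seq p q) st c Q ↔ Run E p st c fun st' c' => Run E q st' c' Q := by
  constructor
  · rintro ⟨st', t, h, h1, h2⟩
    cases h with
    | seq h3 h4 =>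
      exact ⟨_, _, h3, by omega, _, _, h4, by omega, by rwa [Nat.sub_sub]⟩
  · rintro ⟨st', t, h, h1, st'', t', h', h1', h2⟩
    exact ⟨_, _, .seq h h', by omega, by rwa [← Nat.sub_sub]⟩

@[simp] theorem run_branch {b : BExp} : Run E (.branch b p q) st c Q ↔
    b.ok E st ∧ 1 ≤ c ∧ (b.val E st → Run E p st (c - 1) Q) ∧
      (¬ b.val E st → Run E q st (c - 1) Q) := by
  constructor
  · rintro ⟨st', t, h, h1, h2⟩
    cases h with
    | branch_true h3 h4 h5 =>
      exact ⟨h3, by omega, fun _ => ⟨_, _, h5, by omega, by rwa [Nat.sub_sub]⟩,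
        fun h => absurd h4 h⟩
    | branch_false h3 h4 h5 =>
      exact ⟨h3, by omega, fun h => absurd h h4, fun _ => ⟨_, _, h5, by omega,
        by rwa [Nat.sub_sub]⟩⟩
  · rintro ⟨h1, h2, h3, h4⟩
    by_cases h : b.val E st
    · obtain ⟨st', t, h5, h6, h7⟩ := h3 h
      exact ⟨st', _, .branch_true h1 h h5, by omega, by rwa [← Nat.sub_sub]⟩
    · obtain ⟨st', t, h5, h6, h7⟩ := h4 h
      exact ⟨st', _, .branch_false h1 h h5, by omega, by rwa [← Nat.sub_sub]⟩

/-- The frame information `Same` comes for free from the syntax, so the specification of a command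
only has to mention what the command changes. -/
theorem Run.mono (h : Run E p st c Q)
    (hQ : ∀ st' c', Q st' c' → Same p st st' → Q' st' c') : Run E p st c Q' := by
  obtain ⟨st', t, h1, h2, h3⟩ := h
  exact ⟨st', t, h1, h2, hQ _ _ h3 h1.same⟩

theorem Same.trans_loop {b : BExp} {st' st'' : Store} (h : Same (.loop b p) st st')
    (h' : Same p st' st'') : Same (.loop b p) st st'' :=
  ⟨fun x hx => (h'.1 x hx).trans (h.1 x hx), fun A hA => (h'.2 A hA).trans (h.2 A hA)⟩

/-- The loop rule: the invariant speaks about the state and the remaining credits. -/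
theorem Run.loop {b : BExp} (I : Store → ℕ → Prop) (h0 : I st c)
    (hstep : ∀ st' c', I st' c' → Same (.loop b p) st st' → b.ok E st' ∧ 1 ≤ c' ∧
      (b.val E st' → Run E p st' (c' - 1) I) ∧ (¬ b.val E st' → Q st' (c' - 1))) :
    Run E (.loop b p) st c Q := by
  suffices H : ∀ c' st', I st' c' → Same (.loop b p) st st' → Run E (.loop b p) st' c' Q from
    H c st h0 ⟨fun _ _ => rfl, fun _ _ => rfl⟩
  -- Induction on the credits: each iteration spends at least one on its test, so termination and
  -- the time bound are proved at once.
  intro c'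
  induction c' using Nat.strong_induction_on with
  | _ c' ih =>
    intro st' hI hs
    obtain ⟨hok, hc, ht, hf⟩ := hstep st' c' hI hs
    by_cases hb : b.val E st'
    · obtain ⟨st'', t, h1, h2, h3⟩ := ht hb
      obtain ⟨st₃, t', h4, h5, h6⟩ := ih (c' - 1 - t) (by omega) st'' h3 (hs.trans_loop h1.same)
      refine ⟨st₃, _, .loop_true hok hb h1 h4, by omega, ?_⟩
      rwa [← Nat.sub_sub, ← Nat.sub_sub]
    · exact ⟨st', 1, .loop_false hok hb, hc, hf hb⟩

end

/-! ## Letters and codes of symbols -/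

/-- The letter `c` belongs to the symbol with code `u`. -/
def Has (E : Env) (n σ u c : ℕ) : Prop :=
  c < σ ∧ if u < σ then u = c else E.inp (n + σ * (u - σ) + c) = 1

/-- The symbols with codes `u` and `v` have a common letter. -/
def Mt (E : Env) (n σ u v : ℕ) : Prop :=
  ∃ c, Has E n σ u c ∧ Has E n σ v c

theorem Mt.symm {E : Env} {n σ u v : ℕ} (h : Mt E n σ u v) : Mt E n σ v u :=
  let ⟨c, h1, h2⟩ := h
  ⟨c, h2, h1⟩

theorem has_solid {E : Env} {n σ u c : ℕ} (hu : u < σ) : Has E n σ u c ↔ u = c := by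
  simp only [Has, if_pos hu]; omega

theorem mt_solid {E : Env} {n σ u v : ℕ} (hu : u < σ) : Mt E n σ u v ↔ Has E n σ v u := by
  constructor
  · rintro ⟨c, h1, h2⟩
    rw [has_solid hu] at h1
    exact h1 ▸ h2
  · exact fun h => ⟨u, (has_solid hu).2 rfl, h⟩

/-- The parameters of the problem fit the fixed data of the machine. -/
structure Fits (E : Env) (n σ k : ℕ) : Prop where
  hD : E.D = n + σ * k + 1
  hM : 200 * E.D ≤ E.M
  two_le : 2 ≤ σ
  le_n : σ ≤ n
  k_le : k ≤ n

/-- The parameters are in their variables. -/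
structure Base (E : Env) (n σ k : ℕ) (st : Store) : Prop where
  n : st.r .n = n
  sigma : st.r .sigma = σ
  k : st.r .k = k
  base : st.r .base = E.D

theorem Base.same {E : Env} {n σ k : ℕ} {p : Cmd} {st st' : Store} (h : Base E n σ k st)
    (hs : Same p st st') (hx : ∀ x ∈ [Var.n, .sigma, .k, .base], x ∉ p.vars := by decide) :
    Base E n σ k st' where
  n := (hs.1 _ (hx _ (by simp))).trans h.n
  sigma := (hs.1 _ (hx _ (by simp))).trans h.sigma
  k := (hs.1 _ (hx _ (by simp))).trans h.k
  base := (hs.1 _ (hx _ (by simp))).trans h.base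

theorem Fits.index_lt {E : Env} {n σ k : ℕ} (h : Fits E n σ k) {u : ℕ} (hu : u < σ + k)
    (hu' : σ ≤ u) : n + σ * (u - σ) + σ < E.D := by
  have h1 : σ * (u - σ) + σ ≤ σ * k := by
    rw [← Nat.mul_succ]
    exact Nat.mul_le_mul_left _ (by omega)
  have := h.hD
  omega

theorem Fits.mul_le {E : Env} {n σ k : ℕ} (h : Fits E n σ k) {u : ℕ} (hu : u < σ + k) :
    n + σ * (u - σ) < E.D := by
  have h1 : σ * (u - σ) ≤ σ * k := Nat.mul_le_mul_left _ (by omega)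
  have := h.hD
  omega

/-! ### A common letter of two symbols -/

/-- The entry at `x` of the bit vector of the symbol with code `u`. -/
def bitAt (u x : Var) : AExp := .inp (♯.n + ♯.sigma * (♯u - ♯.sigma) + ♯x)

/-- Search for a common letter of two non-solid symbols. -/
def scanLetters : Cmd :=
  .loop (.and (.lt ♯.c ♯.sigma) (.not (.and (.eq (bitAt .u .c) 1) (.eq (bitAt .v .c) 1))))
    (.assign .c (♯.c + 1))

/-- Set `c` to a common letter of the symbols with codes `u` and `v`, or to `σ`. -/
def common : Cmd :=
  .branch (.lt ♯.u ♯.sigma)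
    (.branch (.lt ♯.v ♯.sigma)
      (.branch (.eq ♯.u ♯.v) (.assign .c ♯.u) (.assign .c ♯.sigma))
      (.branch (.eq (bitAt .v .u) 1) (.assign .c ♯.u) (.assign .c ♯.sigma)))
    (.branch (.lt ♯.v ♯.sigma)
      (.branch (.eq (bitAt .u .v) 1) (.assign .c ♯.v) (.assign .c ♯.sigma))
      (.assign .c 0 ;; scanLetters))

/-- `c` is a common letter of `u` and `v`, or `σ` if there is none. -/
def IsCommon (E : Env) (n σ u v c : ℕ) : Prop :=
  (c < σ ∧ Has E n σ u c ∧ Has E n σ v c) ∨ (c = σ ∧ ¬ Mt E n σ u v)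

section
variable {E : Env} {n σ k : ℕ} {st : Store} {c : ℕ}

theorem run_scanLetters (hE : Fits E n σ k) (hB : Base E n σ k st) {u v : ℕ} (hu : st.r .u = u)
    (hv : st.r .v = v) (hu1 : u < σ + k) (hv1 : v < σ + k) (hu2 : σ ≤ u) (hv2 : σ ≤ v)
    (hc0 : st.r .c = 0) {K : ℕ} (hc : 2 * σ + 1 + K ≤ c) :
    Run E scanLetters st c fun st' c' => IsCommon E n σ u v (st'.r .c) ∧ K ≤ c' := by
  have h1 := hE.index_lt hu1 hu2
  have h2 := hE.index_lt hv1 hv2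
  have hM := hE.hM
  apply Run.loop fun st' c' => st'.r .c ≤ σ ∧ (∀ x < st'.r .c, ¬ (Has E n σ u x ∧ Has E n σ v x)) ∧
    2 * (σ - st'.r .c) + 1 + K ≤ c'
  · rw [hc0]; simp; omega
  · rintro st' c' ⟨h3, h4, h5⟩ hs
    have hB' := hB.same hs
    have hu' := (hs.1 .u (by decide)).trans hu
    have hv' := (hs.1 .v (by decide)).trans hv
    simp [bitAt, hB'.n, hB'.sigma, hu', hv']
    refine ⟨by omega, by omega, ?_, ?_⟩
    · intro h6 h7
      refine ⟨by omega, by omega, by omega, ?_, by omega⟩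
      intro x hx
      by_cases hxc : x = st'.r .c
      · subst hxc
        simp only [Has, if_neg (show ¬ u < σ by omega), if_neg (show ¬ v < σ by omega)]
        tauto
      · have := h4 x (by omega)
        tauto
    · intro h6
      refine ⟨?_, by omega⟩
      rcases h3.lt_or_eq with h7 | h7
      · left
        simp only [Has, if_neg (show ¬ u < σ by omega), if_neg (show ¬ v < σ by omega)]
        tauto
      · right
        refine ⟨h7, ?_⟩
        rintro ⟨x, hx⟩
        exact h4 x (by have := hx.1.1; omega) hx

/-- Only for two non-solid symbols is a scan of the bit vectors needed; otherwise two letters are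
compared or a single bit is read. The conditional term of the budget keeps track of this, so that
the factor `σ` is paid for pairs of non-solid symbols only. -/
theorem run_common (hE : Fits E n σ k) (hB : Base E n σ k st) {u v : ℕ} (hu : st.r .u = u)
    (hv : st.r .v = v) (hu1 : u < σ + k) (hv1 : v < σ + k) {K : ℕ}
    (hc : 5 + (if σ ≤ u ∧ σ ≤ v then 2 * σ else 0) + K ≤ c) :
    Run E common st c fun st' c' => IsCommon E n σ u v (st'.r .c) ∧ K ≤ c' := by
  have h1 := hE.mul_le hu1
  have h2 := hE.mul_le hv1
  have hM := hE.hM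
  have hD := hE.hD
  have h2σ := hE.two_le
  have hle := hE.le_n
  simp only [common, bitAt, run_branch, run_assign, run_seq, BExp.ok_lt, BExp.ok_eq, BExp.val_lt,
    BExp.val_eq, AExp.val_add, AExp.val_mul, AExp.val_sub, AExp.val_inp, AExp.val_var, AExp.ok_var,
    AExp.ok_inp, AExp.ok_add, AExp.ok_mul, AExp.ok_sub, AExp.val_zero, AExp.ok_zero, AExp.val_one, AExp.ok_one, hu, hv,
    hB.n, hB.sigma, Store.set_r, true_and, and_true, if_true]
  refine ⟨by omega, fun hu2 => ⟨by omega, fun hv2 => ⟨by omega, fun h3 => ?_, fun h3 => ?_⟩,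
      fun hv2 => ?_⟩,
    fun hu2 => ⟨by omega, fun hv2 => ?_, fun hv2 => ⟨by omega, by omega, ?_⟩⟩⟩
  · refine ⟨by omega, Or.inl ⟨hu2, ?_⟩, by omega⟩
    rw [has_solid hu2, has_solid hv2]; exact ⟨rfl, h3.symm⟩
  · refine ⟨by omega, Or.inr ⟨rfl, ?_⟩, by omega⟩
    rw [mt_solid hu2, has_solid hv2]; exact fun h => h3 h.symm
  · have h6 := hE.index_lt hv1 (by omega)
    refine ⟨by omega, by omega, fun h3 => ⟨by omega, Or.inl ⟨hu2, ?_⟩, by omega⟩,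
      fun h3 => ⟨by omega, Or.inr ⟨rfl, ?_⟩, by omega⟩⟩
    · rw [has_solid hu2, Has, if_neg hv2]; exact ⟨rfl, hu2, h3⟩
    · rw [mt_solid hu2, Has, if_neg hv2]; exact fun h => h3 h.2
  · have h6 := hE.index_lt hu1 (by omega)
    refine ⟨by omega, by omega, fun h3 => ⟨by omega, Or.inl ⟨hv2, ?_⟩, by omega⟩,
      fun h3 => ⟨by omega, Or.inr ⟨rfl, ?_⟩, by omega⟩⟩
    · rw [has_solid hv2, Has, if_neg hu2]; exact ⟨⟨hv2, h3⟩, rfl⟩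
    · intro h; have h := h.symm; rw [mt_solid hv2, Has, if_neg hu2] at h; exact h3 h.2
  · rw [if_pos ⟨by omega, by omega⟩] at hc
    exact run_scanLetters hE ⟨by simp [hB.n], by simp [hB.sigma], by simp [hB.k], by simp [hB.base]⟩
      (by simp [hu]) (by simp [hv]) hu1 hv1 (by omega) (by omega) (by simp) (by omega)

end
/-! ## Longest common extensions -/

/-- The factors of length `e` of `W` (of length `L`) that start at `a` and `y` are equal. -/
def Agree (W : ℕ → ℕ) (L a y e : ℕ) : Prop :=
  ∀ i < e, a + i < L ∧ y + i < L ∧ W (a + i) = W (y + i)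

/-- `e` is the length of the longest common prefix of the suffixes of `W` at `a` and `y`. -/
def IsLce (W : ℕ → ℕ) (L a y e : ℕ) : Prop :=
  Agree W L a y e ∧ ¬ (a + e < L ∧ y + e < L ∧ W (a + e) = W (y + e))

theorem Agree.le {W : ℕ → ℕ} {L a y e : ℕ} (h : Agree W L a y e) (ha : a ≤ L) (hy : y ≤ L) :
    a + e ≤ L ∧ y + e ≤ L := by
  rcases Nat.eq_zero_or_pos e with rfl | he
  · exact ⟨ha, hy⟩
  · have := h (e - 1) (by omega)
    omega

theorem Agree.succ {W : ℕ → ℕ} {L a y e : ℕ} (h : Agree W L a y e)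
    (he : a + e < L ∧ y + e < L ∧ W (a + e) = W (y + e)) : Agree W L a y (e + 1) := by
  intro i hi
  rcases (Nat.lt_succ_iff.1 hi).lt_or_eq with h' | rfl
  · exact h i h'
  · exact he

/-- The reuse of a known extension inside a window `[l, r)` that agrees with a prefix at `a`. -/
theorem window_reuse {W : ℕ → ℕ} {L a y l r x : ℕ} (hw : ∀ i, l + i < r → W (l + i) = W (a + i))
    (hr : a + (r - l) ≤ L) (hrL : r ≤ L) (hy : y < r) (hl : l < y)
    (hx : IsLce W L a (a + (y - l)) x) :
    Agree W L a y (min x (r - y)) ∧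
      (IsLce W L a y (min x (r - y)) ∨ r ≤ y + min x (r - y)) := by
  have key : ∀ i, y + i < r → W (y + i) = W (a + (y - l) + i) := by
    intro i hi
    have := hw (y - l + i) (by omega)
    rwa [show l + (y - l + i) = y + i by omega, ← add_assoc] at this
  have hag : Agree W L a y (min x (r - y)) := by
    intro i hi
    obtain ⟨h1, h2, h3⟩ := hx.1 i (by omega)
    exact ⟨h1, by omega, by rw [h3, key i (by omega)]⟩
  refine ⟨hag, ?_⟩
  rcases le_or_gt (r - y) x with h | h
  · right; omega
  · left
    refine ⟨hag, ?_⟩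
    rw [min_eq_left h.le]
    -- The known extension ends before the window does, so the difference that ends it is inside the
    -- window and is also seen from `y`.
    rintro ⟨h1, h2, h3⟩
    exact hx.2 ⟨h1, by omega, by rw [h3, key x (by omega)]⟩

/-- Extend the match of `a` and `y`, of length `e`, as far as possible. -/
def extendMatch : Cmd :=
  .loop (.and (.and (.lt (♯.y + ♯.e) ♯.len) (.lt (♯.a + ♯.e) ♯.len))
      (.eq (.arr .wrd (♯.a + ♯.e)) (.arr .wrd (♯.y + ♯.e))))
    (.assign .e (♯.e + 1))

/-- Compute the extension at `y`, given the window `[l, r)`. -/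
def zStep : Cmd :=
  .branch (.lt ♯.y ♯.r)
    (.assign .e (.arr .ext (♯.a + (♯.y - ♯.l))) ;;
      .branch (.lt (♯.r - ♯.y) ♯.e) (.assign .e (♯.r - ♯.y)) .skip)
    (.assign .e 0) ;;
  extendMatch ;;
  .store .ext ♯.y ♯.e ;;
  .branch (.lt ♯.r (♯.y + ♯.e)) (.assign .l ♯.y ;; .assign .r (♯.y + ♯.e)) .skip ;;
  .assign .y (♯.y + 1)

/-- Compute the extensions from `y` to `rend`. -/
def zPass : Cmd :=
  .assign .l ♯.y ;; .assign .r ♯.y ;; .loop (.lt ♯.y ♯.rend) zStep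

section
variable {E : Env} {n σ k : ℕ} {st : Store} {c : ℕ}

/-- The credits are paid by the growth of `max r (y + e)`. The loop body is entered only if `r ≤ y +
e`: otherwise `e` is already the exact extension. Thus each iteration moves the right end forward by
one, which makes a whole pass linear. -/
theorem run_extendMatch (hE : Fits E n σ k) (hB : Base E n σ k st) {W : ℕ → ℕ} {L a y r : ℕ}
    (hW : st.a .wrd = W) (hL : st.r .len = L) (hLn : L ≤ 2 * n) (ha : st.r .a = a)
    (hy : st.r .y = y) (haL : a ≤ L) (hyL : y ≤ L) (hag : Agree W L a y (st.r .e))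
    (hr : IsLce W L a y (st.r .e) ∨ r ≤ y + st.r .e) {K : ℕ}
    (hc : 1 + 2 * (L - max r (y + st.r .e)) + K ≤ c) :
    Run E extendMatch st c fun st' c' => IsLce W L a y (st'.r .e) ∧ y + st'.r .e ≤ L ∧
      2 * (L - max r (y + st'.r .e)) + K ≤ c' := by
  have hM := hE.hM
  have hD := hE.hD
  apply Run.loop fun st' c' => Agree W L a y (st'.r .e) ∧
    (IsLce W L a y (st'.r .e) ∨ r ≤ y + st'.r .e) ∧
    1 + 2 * (L - max r (y + st'.r .e)) + K ≤ c'
  · exact ⟨hag, hr, hc⟩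
  · rintro st' c' ⟨h1, h2, h3⟩ hs
    have hB' := hB.same hs
    have ha' := (hs.1 .a (by decide)).trans ha
    have hy' := (hs.1 .y (by decide)).trans hy
    have hL' := (hs.1 .len (by decide)).trans hL
    have hW' := (hs.2 .wrd (by decide)).trans hW
    have hle := h1.le haL hyL
    simp [ha', hy', hL', hW', hB'.base]
    refine ⟨by omega, by omega, ?_, ?_⟩
    · intro h4 h5 h6
      have h7 : r ≤ y + st'.r .e := h2.resolve_left fun h => h.2 ⟨h5, h4, h6⟩
      exact ⟨by omega, by omega, h1.succ ⟨h5, h4, h6⟩, Or.inr (by omega), by omega⟩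
    · intro h4
      refine ⟨⟨h1, fun h => h4 h.2.1 h.1 h.2.2⟩, by omega, by omega⟩

/-- The value reused for `y` belongs to the position `a + (y - l)`, which lies beyond `a`. If the
pass starts at `a + 1`, then `a < l`, so this position is before `y` and was handled in the same
pass. If the pass stays below `a`, the values beyond `a` must be available from an earlier pass. The
alternatives of `hpass` express this. -/
theorem run_zPass (hE : Fits E n σ k) (hB : Base E n σ k st) {W : ℕ → ℕ} {L a y₀ y₁ : ℕ}
    (hW : st.a .wrd = W) (hL : st.r .len = L) (hLn : L ≤ 2 * n) (ha : st.r .a = a)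
    (hy₀ : st.r .y = y₀) (hy₁ : st.r .rend = y₁) (haL : a ≤ L) (hyL : y₁ ≤ L)
    (hpass : y₁ ≤ a ∧ (∀ z, a < z → z < L → IsLce W L a z (st.a .ext z)) ∨ y₀ = a + 1) {K : ℕ}
    (hc : 12 * (y₁ - y₀) + 2 * L + 3 + K ≤ c) :
    Run E zPass st c fun st' c' => (∀ z, y₀ ≤ z → z < y₁ → IsLce W L a z (st'.a .ext z)) ∧
      (∀ z, ¬ (y₀ ≤ z ∧ z < y₁) → st'.a .ext z = st.a .ext z) ∧ K ≤ c' := by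
  have hM := hE.hM
  have hD := hE.hD
  simp only [zPass, run_seq, run_assign, AExp.ok_var, AExp.val_var, Store.set_r, true_and]
  refine ⟨by omega, by omega, ?_⟩
  -- The alternative `r = y` admits the empty initial window, which starts at `L + 1` if `a = L`.
  apply Run.loop fun st' c' => y₀ ≤ st'.r .y ∧ y₀ ≤ st'.r .l ∧ (st'.r .r ≤ L ∨ st'.r .r = st'.r .y) ∧
    (∀ i, st'.r .l + i < st'.r .r → W (st'.r .l + i) = W (a + i)) ∧
    a + (st'.r .r - st'.r .l) ≤ L ∧ (st'.r .y < st'.r .r → st'.r .l < st'.r .y) ∧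
    (∀ z, y₀ ≤ z → z < st'.r .y → IsLce W L a z (st'.a .ext z)) ∧
    (∀ z, ¬ (y₀ ≤ z ∧ z < y₁) → st'.a .ext z = st.a .ext z) ∧
    12 * (y₁ - st'.r .y) + 2 * (L - st'.r .r) + 1 + K ≤ c'
  · simp [hy₀, haL]
    exact ⟨fun z h1 h2 => absurd h2 (by omega), by omega⟩
  · rintro st' c' ⟨h1, h2, h3, h4, h5, h6, h7, h8, h9⟩ hs
    have hB' : Base E n σ k st' :=
      Base.same (st := st.set .l (st.r .y) |>.set .r _) ⟨hB.n, hB.sigma, hB.k, hB.base⟩ hs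
    have ha' : st'.r .a = a := (hs.1 .a (by decide)).trans ha
    have hL' : st'.r .len = L := (hs.1 .len (by decide)).trans hL
    have hy₁' : st'.r .rend = y₁ := (hs.1 .rend (by decide)).trans hy₁
    have hW' : st'.a .wrd = W := (hs.2 .wrd (by decide)).trans hW
    simp only [BExp.ok_lt, AExp.ok_var, BExp.val_lt, AExp.val_var, hy₁', true_and]
    refine ⟨by omega, fun h10 => ?_, fun h10 => ?_⟩
    swap
    · exact ⟨fun z hz hz' => h7 z hz (by omega), h8, by omega⟩
    · rw [zStep, run_seq]
      have pre : Run E (.branch (.lt ♯.y ♯.r)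
          (.assign .e (.arr .ext (♯.a + (♯.y - ♯.l))) ;;
            .branch (.lt (♯.r - ♯.y) ♯.e) (.assign .e (♯.r - ♯.y)) .skip)
          (.assign .e 0)) st' (c' - 1) fun s d => Agree W L a (st'.r .y) (s.r .e) ∧
            (IsLce W L a (st'.r .y) (s.r .e) ∨ st'.r .r ≤ st'.r .y + s.r .e) ∧ c' ≤ d + 5 := by
        simp [ha', hB'.base]
        refine ⟨by omega, fun h => ?_, fun h => ⟨by omega, by omega, ?_, ?_, by omega⟩⟩
        · have hx : IsLce W L a (a + (st'.r .y - st'.r .l))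
              (st'.a .ext (a + (st'.r .y - st'.r .l))) := by
            have := h6 h
            rcases hpass with ⟨hp, hp'⟩ | hp
            · rw [h8 _ (by omega)]
              exact hp' _ (by omega) (by omega)
            · exact h7 _ (by omega) (by omega)
          obtain ⟨hm1, hm2⟩ := window_reuse h4 h5 (by omega) h (h6 h) hx
          refine ⟨⟨by omega, by omega⟩, by omega, by omega, fun h' => ⟨by omega, ?_⟩,
            fun h' => ⟨by omega, ?_⟩⟩
          · rw [min_eq_right h'.le] at hm1 hm2
            exact ⟨hm1, hm2, by omega⟩
          · rw [min_eq_left h'] at hm1 hm2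
            exact ⟨hm1, hm2, by omega⟩
        · intro i hi; omega
        · right; omega
      apply pre.mono
      rintro s d ⟨p1, p2, p3⟩ hs'
      have hBs := hB'.same hs'
      have hys := hs'.1 .y (by decide)
      have hrs := hs'.1 .r (by decide)
      have hls := hs'.1 .l (by decide)
      have hes := hs'.2 .ext (by decide)
      rw [run_seq]
      have hle := p1.le haL (show st'.r .y ≤ L by omega)
      apply (run_extendMatch hE hBs (K := 12 * (y₁ - st'.r .y - 1) + 6 + K)
        ((hs'.2 .wrd (by decide)).trans hW')
        ((hs'.1 .len (by decide)).trans hL') hLn ((hs'.1 .a (by decide)).trans ha') hys haL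
        (by omega) p1 p2 (by omega)).mono
      rintro s2 d2 ⟨q1, q2, q3⟩ hs2
      have hBs2 := hBs.same hs2
      have hys2 := (hs2.1 .y (by decide)).trans hys
      have hrs2 := (hs2.1 .r (by decide)).trans hrs
      have hls2 := (hs2.1 .l (by decide)).trans hls
      have hes2 := (hs2.2 .ext (by decide)).trans hes
      have e7 : ∀ z, y₀ ≤ z → z < st'.r .y + 1 → IsLce W L a z
          (Function.update (st'.a .ext) (st'.r .y) (s2.r .e) z) := by
        intro z hz hz'
        rw [Function.update_apply]
        split_ifs with h
        · rwa [h]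
        · exact h7 z hz (by omega)
      have e8 : ∀ z, ¬ (y₀ ≤ z ∧ z < y₁) →
          Function.update (st'.a .ext) (st'.r .y) (s2.r .e) z = st.a .ext z := by
        intro z hz
        rw [Function.update_apply, if_neg (by omega)]
        exact h8 z hz
      simp only [run_seq, run_store, run_branch, run_assign, run_skip, AExp.ok_var, AExp.val_var,
        AExp.ok_add, AExp.val_add, AExp.ok_one, AExp.val_one, BExp.ok_lt, BExp.val_lt, Store.put_r,
        Store.set_r, Store.put_a, Store.set_a, hys2, hrs2, hls2, hes2, hBs2.base, true_and,
        and_true, if_true, reduceCtorEq, if_false]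
      refine ⟨by omega, by omega, by omega, by omega, fun h => ⟨by omega, by omega,
        by omega, by omega, by omega, by omega, by omega, by omega, ?_, ?_, fun _ => by omega, e7, e8,
        by omega⟩, fun h => ⟨by omega, by omega, by omega, by omega, by omega, by omega, h4, h5, ?_, e7, e8,
          by omega⟩⟩
      · intro i hi
        exact ((q1.1 i (by omega)).2.2).symm
      · have := q1.1.le haL (by omega); omega
      · intro h'; have := h6 (by omega); omega

end
/-! ## Mismatches of a word with its own shifts -/

/-- The memory holds the word `W` of length `L`. -/
structure HasWord (E : Env) (n σ k : ℕ) (W : ℕ → ℕ) (L : ℕ) (st : Store) : Prop where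
  base : Base E n σ k st
  wrd : st.a .wrd = W
  len : st.r .len = L
  le : L ≤ 2 * n
  code : ∀ i < L, W i < σ + k

theorem HasWord.same {E : Env} {n σ k L : ℕ} {W : ℕ → ℕ} {p : Cmd} {st st' : Store}
    (h : HasWord E n σ k W L st) (hs : Same p st st')
    (hx : ∀ x ∈ [Var.n, .sigma, .k, .base], x ∉ p.vars := by decide)
    (hl : Var.len ∉ p.vars := by decide) (hw : Arr.wrd ∉ p.arrs := by decide) :
    HasWord E n σ k W L st' :=
  ⟨h.base.same hs hx, (hs.2 _ hw).trans h.wrd, (hs.1 _ hl).trans h.len, h.le, h.code⟩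

/-- Every entry `f p` is the position of a mismatch of `W` and its shift by `p`, or
the length of their overlap. -/
def Sound (E : Env) (n σ : ℕ) (W : ℕ → ℕ) (L : ℕ) (f : ℕ → ℕ) : Prop :=
  ∀ p < L, f p + p ≤ L ∧ (f p + p = L ∨ ¬ Mt E n σ (W (f p)) (W (f p + p)))

/-- The mismatches of solid symbols that end a common extension with position `a` are recorded
in `f`, for the positions below `b`. -/
def SolidRec (σ : ℕ) (W : ℕ → ℕ) (L a b : ℕ) (f : ℕ → ℕ) : Prop :=
  ∀ y < b, y ≠ a → ∀ e, IsLce W L a y e → max a y + e < L → W (a + e) < σ → W (y + e) < σ →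
    f (max a y - min a y) ≤ min a y + e

/-- The mismatches of the symbol at position `a` are recorded in `f`, for the positions
below `b`. -/
def SymbolRec (E : Env) (n σ : ℕ) (W : ℕ → ℕ) (lim a b : ℕ) (f : ℕ → ℕ) : Prop :=
  ∀ y < b, y ≠ a → min a y < lim → ¬ Mt E n σ (W a) (W y) → f (max a y - min a y) ≤ min a y

theorem SolidRec.mono {σ L a b : ℕ} {W f g : ℕ → ℕ} (h : SolidRec σ W L a b f)
    (hg : ∀ p, g p ≤ f p) : SolidRec σ W L a b g :=
  fun y hy hne e he h1 h2 h3 => (hg _).trans (h y hy hne e he h1 h2 h3)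

theorem SymbolRec.mono {E : Env} {n σ lim a b : ℕ} {W f g : ℕ → ℕ}
    (h : SymbolRec E n σ W lim a b f) (hg : ∀ p, g p ≤ f p) : SymbolRec E n σ W lim a b g :=
  fun y hy hne h1 h2 => (hg _).trans (h y hy hne h1 h2)

/-- Put the positions `y` and `a` in order. -/
def order : Cmd :=
  .branch (.lt ♯.y ♯.a) (.assign .lo ♯.y ;; .assign .hi ♯.a) (.assign .lo ♯.a ;; .assign .hi ♯.y)

/-- Record a mismatch at `x` of the word and its shift by `hi - lo`. -/
def record (x : AExp) : Cmd :=
  .branch (.lt x (.arr .pre (♯.hi - ♯.lo))) (.store .pre (♯.hi - ♯.lo) x) .skip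

/-- Record the mismatch at the end of the extension of `a` and `y`. -/
def solidCheck : Cmd :=
  .branch (.eq ♯.y ♯.a) .skip
    (order ;; .assign .e (.arr .ext ♯.y) ;;
      .branch (.and (.lt (♯.hi + ♯.e) ♯.len)
          (.and (.lt (.arr .wrd (♯.a + ♯.e)) ♯.sigma) (.lt (.arr .wrd (♯.y + ♯.e)) ♯.sigma)))
        (record (♯.lo + ♯.e)) .skip)

/-- Record the mismatches at the ends of the extensions of `a`. -/
def solidLoop : Cmd :=
  .assign .y 0 ;; .loop (.lt ♯.y ♯.len) (solidCheck ;; .assign .y (♯.y + 1))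

/-- Compute the extensions of `a`, and record the mismatches at their ends. -/
def extendAt : Cmd :=
  .assign .y (♯.a + 1) ;; .assign .rend ♯.len ;; zPass ;;
  .assign .y 0 ;; .assign .rend ♯.a ;; zPass ;; solidLoop

/-- Record the mismatch of the symbols at `a` and `y`. -/
def symbolCheck : Cmd :=
  .branch (.eq ♯.y ♯.a) .skip
    (order ;; .branch (.lt ♯.lo ♯.lim)
      (.assign .u (.arr .wrd ♯.a) ;; .assign .v (.arr .wrd ♯.y) ;; common ;;
        .branch (.lt ♯.c ♯.sigma) .skip (record ♯.lo)) .skip)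

/-- Record the mismatches of the symbol at `a`. -/
def symbolLoop : Cmd :=
  .assign .y 0 ;; .loop (.lt ♯.y ♯.len) (symbolCheck ;; .assign .y (♯.y + 1))

section
variable {E : Env} {n σ k : ℕ} {st : Store} {c : ℕ}

theorem run_order {K : ℕ} (hc : 3 + K ≤ c) :
    Run E order st c fun st' c' => st'.r .lo = min (st.r .a) (st.r .y) ∧
      st'.r .hi = max (st.r .a) (st.r .y) ∧ K ≤ c' := by
  simp [order]
  omega

theorem run_record (hE : Fits E n σ k) {W : ℕ → ℕ} {L : ℕ} (hw : HasWord E n σ k W L st)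
    {lo hi x : ℕ} (hlo : st.r .lo = lo) (hhi : st.r .hi = hi) (hhL : hi < L)
    {X : AExp} (hX : X.ok E st) (hx : X.val E st = x)
    (hf : Sound E n σ W L (st.a .pre)) (hxL : x + (hi - lo) < L)
    (hmis : ¬ Mt E n σ (W x) (W (x + (hi - lo)))) {K : ℕ} (hc : 2 + K ≤ c) :
    Run E (record X) st c fun st' c' => Sound E n σ W L (st'.a .pre) ∧
      (∀ p, st'.a .pre p ≤ st.a .pre p) ∧ st'.a .pre (hi - lo) ≤ x ∧ K ≤ c' := by
  have hM := hE.hM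
  have hD := hE.hD
  have hle := hw.le
  simp only [record, run_branch, run_store, run_skip, BExp.ok_lt, BExp.val_lt, AExp.ok_arr,
    AExp.ok_sub, AExp.ok_var, AExp.val_arr, AExp.val_sub, AExp.val_var, hX, hx, hlo, hhi,
    hw.base.base, true_and, Store.put_a, if_true]
  refine ⟨by omega, by omega, fun h => ⟨by omega, by omega, ?_, ?_, ?_, by omega⟩,
    fun h => ⟨by omega, hf, fun _ => le_rfl, by omega, by omega⟩⟩
  · intro p hp
    rw [Function.update_apply]
    split_ifs with hpe
    · subst hpe; exact ⟨by omega, Or.inr hmis⟩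
    · exact hf p hp
  · intro p
    rw [Function.update_apply]
    split_ifs with hpe
    · subst hpe; omega
    · exact le_rfl
  · simp

theorem IsLce.unique {W : ℕ → ℕ} {L a y e e' : ℕ} (h : IsLce W L a y e)
    (h' : IsLce W L a y e') : e = e' := by
  by_contra hne
  rcases lt_or_gt_of_ne hne with h1 | h1
  · exact h.2 (h'.1 e h1)
  · exact h'.2 (h.1 _ h1)

theorem run_solidCheck (hE : Fits E n σ k) {W : ℕ → ℕ} {L a y : ℕ} (hw : HasWord E n σ k W L st)
    (ha : st.r .a = a) (haL : a ≤ L) (hy : st.r .y = y) (hyL : y < L)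
    (hext : y ≠ a → IsLce W L a y (st.a .ext y)) (hf : Sound E n σ W L (st.a .pre))
    {K : ℕ} (hc : 8 + K ≤ c) :
    Run E solidCheck st c fun st' c' => Sound E n σ W L (st'.a .pre) ∧
      (∀ p, st'.a .pre p ≤ st.a .pre p) ∧
      (y ≠ a → ∀ e, IsLce W L a y e → max a y + e < L → W (a + e) < σ → W (y + e) < σ →
        st'.a .pre (max a y - min a y) ≤ min a y + e) ∧ K ≤ c' := by
  have hM := hE.hM
  have hD := hE.hD
  have hle := hw.le
  simp only [solidCheck, run_seq, run_branch, run_skip, BExp.ok_eq, BExp.val_eq, AExp.ok_var,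
    AExp.val_var, ha, hy, true_and]
  refine ⟨by omega, fun hya => ⟨by omega, hf, fun _ => le_rfl, fun h => absurd hya h, by omega⟩,
    fun hya => ?_⟩
  apply (run_order (K := 4 + K) (by omega)).mono
  rintro s d ⟨p1, p2, p3⟩ hs'
  rw [ha, hy] at p1 p2
  have hws := hw.same hs'
  have hps := hs'.2 .pre (by decide)
  have hys := (hs'.1 .y (by decide)).trans hy
  have has := (hs'.1 .a (by decide)).trans ha
  have hes := hs'.2 .ext (by decide)
  have hlce : IsLce W L a y (st.a .ext y) := hext hya
  have hll := hlce.1.le haL hyL.le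
  simp only [run_assign, run_branch, run_skip, BExp.ok_and, BExp.ok_lt, BExp.val_lt,
    BExp.val_and, AExp.ok_arr, AExp.val_arr, AExp.ok_var, AExp.val_var, AExp.ok_add,
    AExp.val_add, Store.set_r, Store.set_a, hys, hes, has, p1, p2, reduceCtorEq, if_true,
    if_false, hws.base.base, hws.base.sigma, hws.wrd, hws.len, true_and, and_true]
  refine ⟨by omega, by omega, by omega, by omega, fun hm => ?_, fun hm => ⟨by omega, ?_⟩⟩
  · have hsum : min a y + st.a .ext y + (max a y - min a y) = max a y + st.a .ext y := by omega
    refine (run_record (x := min a y + st.a .ext y) (K := K)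
      (lo := min a y) (hi := max a y) hE (st := s.set .e (st.a .ext y))
      ⟨⟨hws.base.n, hws.base.sigma, hws.base.k, hws.base.base⟩, hws.wrd, hws.len, hws.le,
        hws.code⟩ (by simpa using p1) (by simpa using p2) (by omega) (by simp [p1]; omega)
        (by simp [p1]) (by simpa [hps] using hf) (by omega) ?_ (by omega)).mono ?_
    · rw [hsum]
      -- The codes at the end of a maximal extension differ; as both are letters, the symbols do not
      -- match.
      have hne : W (a + st.a .ext y) ≠ W (y + st.a .ext y) :=
        fun h => hlce.2 ⟨by omega, by omega, h⟩
      rcases le_total a y with h | h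
      · rw [min_eq_left h, max_eq_right h, mt_solid hm.2.1, has_solid hm.2.2]; exact hne.symm
      · rw [min_eq_right h, max_eq_left h, mt_solid hm.2.2, has_solid hm.2.1]; exact hne
    · rintro s2 d2 ⟨r1, r2, r3, r4⟩ hs2
      refine ⟨r1, fun p => by simpa [hps] using r2 p, fun _ e he _ _ _ => ?_, r4⟩
      rw [he.unique hlce]; exact r3
  · refine ⟨by simpa [hps] using hf, fun p => by simp [hps], fun _ e he g1 g2 g3 => ?_, by omega⟩
    rw [he.unique hlce] at g1 g2 g3
    exact absurd ⟨g1, g2, g3⟩ hm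

theorem run_solidLoop (hE : Fits E n σ k) {W : ℕ → ℕ} {L a : ℕ} (hw : HasWord E n σ k W L st)
    (ha : st.r .a = a) (haL : a ≤ L)
    (hext : ∀ y < L, y ≠ a → IsLce W L a y (st.a .ext y)) (hf : Sound E n σ W L (st.a .pre))
    {K : ℕ} (hc : 10 * L + 2 + K ≤ c) :
    Run E solidLoop st c fun st' c' => Sound E n σ W L (st'.a .pre) ∧
      (∀ p, st'.a .pre p ≤ st.a .pre p) ∧ SolidRec σ W L a L (st'.a .pre) ∧ K ≤ c' := by
  have hM := hE.hM
  have hD := hE.hD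
  have hle := hw.le
  simp only [solidLoop, run_seq, run_assign, AExp.ok_zero, AExp.val_zero]
  refine ⟨by omega, by omega, ?_⟩
  apply Run.loop fun st' c' => st'.r .y ≤ L ∧ Sound E n σ W L (st'.a .pre) ∧
    (∀ p, st'.a .pre p ≤ st.a .pre p) ∧ SolidRec σ W L a (st'.r .y) (st'.a .pre) ∧
    10 * (L - st'.r .y) + 1 + K ≤ c'
  · simp [hf, SolidRec]; omega
  · rintro st' c' ⟨h1, h2, h3, h4, h5⟩ hs
    have hw' : HasWord E n σ k W L st' := HasWord.same (st := st.set .y 0)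
      ⟨⟨hw.base.n, hw.base.sigma, hw.base.k, hw.base.base⟩, hw.wrd, hw.len, hw.le, hw.code⟩ hs
    have ha' : st'.r .a = a := (hs.1 .a (by decide)).trans ha
    have hext' : st'.a .ext = st.a .ext := hs.2 .ext (by decide)
    simp only [BExp.ok_lt, BExp.val_lt, AExp.ok_var, AExp.val_var, hw'.len, true_and]
    refine ⟨by omega, fun hy => ?_, fun hy => ?_⟩
    swap
    · rw [show st'.r .y = L by omega] at h4
      exact ⟨h2, h3, h4, by omega⟩
    rw [run_seq]
    refine (run_solidCheck hE hw' ha' haL rfl hy (hext' ▸ hext _ hy) h2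
      (K := 10 * (L - (st'.r .y + 1)) + 2 + K) (by omega)).mono ?_
    rintro s d ⟨g1, g2, g3, g4⟩ hs2
    have hys : s.r .y = st'.r .y := hs2.1 .y (by decide)
    simp only [run_assign, AExp.ok_add, AExp.ok_var, AExp.ok_one, AExp.val_add, AExp.val_var,
      AExp.val_one, Store.set_r, if_true, hys, Store.set_a]
    refine ⟨⟨trivial, by omega, by omega⟩, by omega, by omega, g1, fun p => (g2 p).trans (h3 p),
      ?_, by omega⟩
    intro y hy' hne
    rcases (Nat.lt_succ_iff.1 hy').lt_or_eq with h' | rfl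
    · exact h4.mono g2 y h' hne
    · exact g3 hne

theorem run_extendAt (hE : Fits E n σ k) {W : ℕ → ℕ} {L a : ℕ} (hw : HasWord E n σ k W L st)
    (ha : st.r .a = a) (haL : a ≤ L) (hf : Sound E n σ W L (st.a .pre))
    {K : ℕ} (hc : 26 * L + 12 + K ≤ c) :
    Run E extendAt st c fun st' c' => Sound E n σ W L (st'.a .pre) ∧
      (∀ p, st'.a .pre p ≤ st.a .pre p) ∧ SolidRec σ W L a L (st'.a .pre) ∧ K ≤ c' := by
  have hM := hE.hM
  have hD := hE.hD
  have hle := hw.le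
  simp only [extendAt, run_seq, run_assign, AExp.ok_add, AExp.ok_var, AExp.ok_one, AExp.val_add,
    AExp.val_var, AExp.val_one, Store.set_r, reduceCtorEq, if_false, ha, hw.len, true_and]
  refine ⟨by omega, by omega, by omega, ?_⟩
  refine (run_zPass (y₀ := a + 1) (y₁ := L) (K := 12 * a + 12 * L + 7 + K) hE
    (st := (st.set .y (a + 1)).set .rend L) (c := c - 1 - 1)
    ⟨hw.base.n, hw.base.sigma, hw.base.k, hw.base.base⟩ hw.wrd hw.len hle ha (by simp) (by simp)
    haL le_rfl (Or.inr rfl) (by omega)).mono ?_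
  rintro s d ⟨p1, p2, p3⟩ hs
  -- The two assignments and the pass are treated as one command for the frame argument. Only the
  -- names of the changed variables matter, so the assigned expressions are replaced by `0`.
  have hs0 : Same (.assign .y 0 ;; .assign .rend 0 ;; zPass) st s :=
    ⟨fun x hx => (hs.1 x (by revert hx; cases x <;> decide)).trans (by revert hx; cases x <;> simp [Cmd.vars]),
      fun A hA => hs.2 A (by revert hA; cases A <;> decide)⟩
  have hw1 := hw.same hs0
  have ha1 := (hs0.1 .a (by decide)).trans ha
  have hp1 := hs0.2 .pre (by decide)
  simp only [AExp.ok_zero, AExp.val_zero, Store.set_r, reduceCtorEq, if_false, ha1]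
  refine ⟨by omega, by omega, by omega, ?_⟩
  refine (run_zPass (y₀ := 0) (y₁ := a) (K := 10 * L + 2 + K) hE
    (st := (s.set .y 0).set .rend a) (c := d - 1 - 1)
    ⟨hw1.base.n, hw1.base.sigma, hw1.base.k, hw1.base.base⟩ hw1.wrd hw1.len hle ha1 (by simp)
    (by simp) haL haL (Or.inl ⟨le_rfl, fun z hz hz' => p1 z hz hz'⟩) (by omega)).mono ?_
  rintro s2 d2 ⟨q1, q2, q3⟩ hs2
  have hp2 : s2.a .pre = st.a .pre := (hs2.2 .pre (by decide)).trans hp1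
  have hw2 : HasWord E n σ k W L s2 := HasWord.same (st := (s.set .y 0).set .rend a)
    ⟨⟨hw1.base.n, hw1.base.sigma, hw1.base.k, hw1.base.base⟩, hw1.wrd, hw1.len, hle, hw.code⟩ hs2
  rw [← hp2]
  refine run_solidLoop hE hw2 ((hs2.1 .a (by decide)).trans ha1) haL ?_ (hp2 ▸ hf) (by omega)
  intro y hy hya
  rcases lt_or_gt_of_ne hya with h | h
  · exact q1 y (by omega) h
  · rw [q2 y (by omega)]
    exact p1 y (by omega) hy

/-- `Z` is the allowance for scanning bit vectors, charged only if `y` is non-solid. It has to reach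
`2 * σ` only if a scan can really happen, that is, for two non-solid symbols the first of which is
below `lim`. This lets the same code be used with `Z = 0` when all positions below `lim` hold
letters. -/
theorem run_symbolCheck (hE : Fits E n σ k) {W : ℕ → ℕ} {L a y lim : ℕ}
    (hw : HasWord E n σ k W L st) (ha : st.r .a = a) (haL : a < L) (hy : st.r .y = y) (hyL : y < L)
    (hlim : st.r .lim = lim) (hf : Sound E n σ W L (st.a .pre)) {Z : ℕ}
    (hZ : y ≠ a → min a y < lim → σ ≤ W a → σ ≤ W y → 2 * σ ≤ Z)
    {K : ℕ} (hc : 15 + (if σ ≤ W y then Z else 0) + K ≤ c) :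
    Run E symbolCheck st c fun st' c' => Sound E n σ W L (st'.a .pre) ∧
      (∀ p, st'.a .pre p ≤ st.a .pre p) ∧
      (y ≠ a → min a y < lim → ¬ Mt E n σ (W a) (W y) →
        st'.a .pre (max a y - min a y) ≤ min a y) ∧ K ≤ c' := by
  have hM := hE.hM
  have hD := hE.hD
  have hle := hw.le
  simp only [symbolCheck, run_seq, run_branch, run_skip, BExp.ok_eq, BExp.val_eq, AExp.ok_var,
    AExp.val_var, ha, hy, true_and]
  refine ⟨by omega, fun hya => ⟨by omega, hf, fun _ => le_rfl, fun h => absurd hya h, by omega⟩,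
    fun hya => ?_⟩
  apply (run_order (K := 11 + (if σ ≤ W y then Z else 0) + K) (by omega)).mono
  rintro s d ⟨p1, p2, p3⟩ hs
  rw [ha, hy] at p1 p2
  have hws := hw.same hs
  have hps := hs.2 .pre (by decide)
  have hys := (hs.1 .y (by decide)).trans hy
  have has := (hs.1 .a (by decide)).trans ha
  have hls := (hs.1 .lim (by decide)).trans hlim
  simp only [run_assign, BExp.ok_lt, BExp.val_lt, AExp.ok_arr, AExp.val_arr, AExp.ok_var,
    AExp.val_var, Store.set_r, Store.set_a, hys, hls, has, p1, reduceCtorEq, if_false,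
    hws.base.base, hws.wrd, true_and]
  refine ⟨by omega, fun hm => ⟨by omega, by omega, by omega, by omega, ?_⟩,
    fun hm => ⟨by omega, hps ▸ hf, fun p => by rw [hps], fun _ h => absurd h hm, by omega⟩⟩
  refine (run_common (u := W a) (v := W y) (K := 3 + K) hE
    (st := (s.set .u (W a)).set .v (W y))
    ⟨hws.base.n, hws.base.sigma, hws.base.k, hws.base.base⟩ (by simp) (by simp)
    (hw.code a haL) (hw.code y hyL) ?_).mono ?_
  · by_cases h : σ ≤ W a ∧ σ ≤ W y
    · have := hZ hya hm h.1 h.2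
      rw [if_pos h.2] at p3
      rw [if_pos h]
      omega
    · rw [if_neg h]
      omega
  · rintro s2 d2 ⟨q1, q2⟩ hs2
    have hw2 : HasWord E n σ k W L s2 := HasWord.same (st := (s.set .u (W a)).set .v (W y))
      ⟨⟨hws.base.n, hws.base.sigma, hws.base.k, hws.base.base⟩, hws.wrd, hws.len, hle, hw.code⟩ hs2
    have hp2 : s2.a .pre = st.a .pre := (hs2.2 .pre (by decide)).trans hps
    have hlo : s2.r .lo = min a y := (hs2.1 .lo (by decide)).trans p1
    have hhi : s2.r .hi = max a y := (hs2.1 .hi (by decide)).trans p2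
    simp only [hw2.base.sigma]
    refine ⟨by omega, fun h => ⟨by omega, hp2 ▸ hf, fun p => by rw [hp2], fun _ _ hno => ?_,
      by omega⟩, fun h => ?_⟩
    · rcases q1 with ⟨_, h1, h2⟩ | ⟨h1, _⟩
      · exact absurd ⟨_, h1, h2⟩ hno
      · omega
    · have hno : ¬ Mt E n σ (W a) (W y) := by
        rcases q1 with ⟨h1, _⟩ | ⟨_, h1⟩
        · exact absurd h1 h
        · exact h1
      refine (run_record (X := ♯.lo) (x := min a y) (K := K) hE hw2 hlo hhi (by omega) trivial hlo
        (hp2 ▸ hf) (by omega) ?_ (by omega)).mono ?_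
      · rw [show min a y + (max a y - min a y) = max a y by omega]
        rcases le_total a y with h' | h'
        · rwa [min_eq_left h', max_eq_right h']
        · rw [min_eq_right h', max_eq_left h']
          exact fun h => hno h.symm
      · rintro s3 d3 ⟨r1, r2, r3, r4⟩ _
        exact ⟨r1, fun p => hp2 ▸ r2 p, fun _ _ _ => r3, r4⟩

/-- The number of non-solid symbols among the first `L`. -/
def nonSolid (σ : ℕ) (W : ℕ → ℕ) (L : ℕ) : ℕ :=
  ∑ y ∈ Finset.range L, if σ ≤ W y then 1 else 0

/-- Extra cost that is incurred at non-solid positions only enters the total with the factor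
`nonSolid σ W L` instead of `L`. -/
theorem sum_weights {σ : ℕ} {W : ℕ → ℕ} {L A B : ℕ} :
    ∑ y ∈ Finset.Ico 0 L, (A + if σ ≤ W y then B else 0) = L * A + nonSolid σ W L * B := by
  rw [Finset.sum_add_distrib, nonSolid, Finset.sum_mul]
  simp [ite_mul]

theorem run_symbolLoop (hE : Fits E n σ k) {W : ℕ → ℕ} {L a lim : ℕ}
    (hw : HasWord E n σ k W L st) (ha : st.r .a = a) (haL : a < L)
    (hlim : st.r .lim = lim) (hf : Sound E n σ W L (st.a .pre)) {Z : ℕ}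
    (hZ : ∀ y < L, y ≠ a → min a y < lim → σ ≤ W a → σ ≤ W y → 2 * σ ≤ Z)
    {K : ℕ} (hc : L * 17 + nonSolid σ W L * Z + 2 + K ≤ c) :
    Run E symbolLoop st c fun st' c' => Sound E n σ W L (st'.a .pre) ∧
      (∀ p, st'.a .pre p ≤ st.a .pre p) ∧ SymbolRec E n σ W lim a L (st'.a .pre) ∧ K ≤ c' := by
  have hM := hE.hM
  have hD := hE.hD
  have hle := hw.le
  simp only [symbolLoop, run_seq, run_assign, AExp.ok_zero, AExp.val_zero]
  refine ⟨by omega, by omega, ?_⟩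
  apply Run.loop fun st' c' => st'.r .y ≤ L ∧ Sound E n σ W L (st'.a .pre) ∧
    (∀ p, st'.a .pre p ≤ st.a .pre p) ∧ SymbolRec E n σ W lim a (st'.r .y) (st'.a .pre) ∧
    ∑ y ∈ Finset.Ico (st'.r .y) L, (17 + if σ ≤ W y then Z else 0) + 1 + K ≤ c'
  · have : (st.set .y 0).r .y = 0 := by simp
    rw [this, sum_weights]
    simp [hf, SymbolRec]; omega
  · rintro st' c' ⟨h1, h2, h3, h4, h5⟩ hs
    have hw' : HasWord E n σ k W L st' := HasWord.same (st := st.set .y 0)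
      ⟨⟨hw.base.n, hw.base.sigma, hw.base.k, hw.base.base⟩, hw.wrd, hw.len, hw.le, hw.code⟩ hs
    have ha' : st'.r .a = a := (hs.1 .a (by decide)).trans ha
    have hlim' : st'.r .lim = lim := (hs.1 .lim (by decide)).trans hlim
    simp only [BExp.ok_lt, BExp.val_lt, AExp.ok_var, AExp.val_var, hw'.len, true_and]
    refine ⟨by omega, fun hy => ?_, fun hy => ?_⟩
    swap
    · rw [show st'.r .y = L by omega] at h4
      exact ⟨h2, h3, h4, by omega⟩
    rw [run_seq]
    rw [Finset.sum_eq_sum_Ico_succ_bot hy] at h5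
    refine (run_symbolCheck hE hw' ha' haL rfl hy hlim' h2 (hZ _ hy) (K := c' -
      (16 + (if σ ≤ W (st'.r .y) then Z else 0))) (by omega)).mono ?_
    rintro s d ⟨g1, g2, g3, g4⟩ hs2
    have hys : s.r .y = st'.r .y := hs2.1 .y (by decide)
    simp only [run_assign, AExp.ok_add, AExp.ok_var, AExp.ok_one, AExp.val_add, AExp.val_var,
      AExp.val_one, Store.set_r, if_true, hys, Store.set_a]
    refine ⟨⟨trivial, by omega, by omega⟩, by omega, by omega, g1, fun p => (g2 p).trans (h3 p),
      ?_, by omega⟩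
    intro y hy' hne
    rcases (Nat.lt_succ_iff.1 hy').lt_or_eq with h' | rfl
    · exact h4.mono g2 y h' hne
    · exact g3 hne

end
-- The first mismatch of a word with each of its shifts
/-- Set `pre[p]` to the length of the overlap of the word and its shift by `p`. -/
def initPre : Cmd :=
  .assign .p 0 ;; .loop (.lt ♯.p ♯.len) (.store .pre ♯.p (♯.len - ♯.p) ;; .assign .p (♯.p + 1))

/-- Record the mismatches next to, and at, a non-solid symbol at position `q`. -/
def selfPrefStep : Cmd :=
  .branch (.lt (.arr .wrd ♯.q) ♯.sigma) .skip
    (.assign .a ♯.q ;; symbolLoop ;; .assign .a (♯.q + 1) ;; extendAt)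

/-- Compute, for each `p`, the first mismatch below `lim` of the word and its shift by `p`. -/
def selfPref : Cmd :=
  initPre ;; .assign .a 0 ;; extendAt ;; .assign .q 0 ;;
    .loop (.lt ♯.q ♯.len) (selfPrefStep ;; .assign .q (♯.q + 1))

/-- `f p` is the first mismatch of `W` and its shift by `p`, if that is below `lim`. -/
structure IsPref (E : Env) (n σ : ℕ) (W : ℕ → ℕ) (L lim : ℕ) (f : ℕ → ℕ) : Prop where
  sound : Sound E n σ W L f
  first : ∀ p i, 0 < p → i + p < L → i < lim → ¬ Mt E n σ (W i) (W (i + p)) → f p ≤ i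

/-- Every mismatch is next to the start of the word or to a non-solid symbol, up to a common
extension. -/
theorem isPref_of_rec {E : Env} {n σ L lim : ℕ} {W f : ℕ → ℕ} (hf : Sound E n σ W L f)
    (h0 : SolidRec σ W L 0 L f)
    (hq : ∀ q < L, σ ≤ W q → SymbolRec E n σ W lim q L f ∧ SolidRec σ W L (q + 1) L f) :
    IsPref E n σ W L lim f where
  sound := hf
  first := by
    intro p i hp hi hlim hmis
    by_cases h1 : σ ≤ W i
    · have := (hq i (by omega) h1).1 (i + p) hi (by omega) (by omega) hmis
      rwa [max_eq_right (by omega), min_eq_left (by omega), Nat.add_sub_cancel_left] at this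
    by_cases h2 : σ ≤ W (i + p)
    · have := (hq (i + p) hi h2).1 i (by omega) (by omega) (by omega) fun h => hmis h.symm
      rwa [max_eq_left (by omega), min_eq_right (by omega), Nat.add_sub_cancel_left] at this
    -- the start of the run of solid pairs
    have hstart : ∃ i₀ ≤ i, (∀ x, i₀ ≤ x → x ≤ i → W x < σ ∧ W (x + p) < σ) ∧
        (i₀ = 0 ∨ σ ≤ W (i₀ - 1) ∨ σ ≤ W (i₀ - 1 + p)) := by
      have : ∀ d ≤ i, (∀ x, i - d ≤ x → x ≤ i → W x < σ ∧ W (x + p) < σ) ∨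
          ∃ i₀ ≤ i, (∀ x, i₀ ≤ x → x ≤ i → W x < σ ∧ W (x + p) < σ) ∧
            (i₀ = 0 ∨ σ ≤ W (i₀ - 1) ∨ σ ≤ W (i₀ - 1 + p)) := by
        intro d
        induction d with
        | zero =>
          intro _
          left
          intro x hx hx'
          obtain rfl : x = i := by omega
          exact ⟨by omega, by omega⟩
        | succ d ih =>
          intro hd
          rcases ih (by omega) with h | h
          · by_cases h3 : W (i - (d + 1)) < σ ∧ W (i - (d + 1) + p) < σ
            · left
              intro x hx hx'
              rcases hx.lt_or_eq with h4 | rfl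
              · exact h x (by omega) hx'
              · exact h3
            · right
              refine ⟨i - d, by omega, h, Or.inr ?_⟩
              rw [show i - d - 1 = i - (d + 1) by omega]
              omega
          · exact Or.inr h
      rcases this i le_rfl with h | h
      · exact ⟨0, by omega, fun x _ hx => h x (by omega) hx, Or.inl rfl⟩
      · exact h
    obtain ⟨i₀, hi₀, hsol, hs⟩ := hstart
    have hne : W i ≠ W (i + p) := by
      intro h
      apply hmis
      rw [mt_solid (by omega), has_solid (by omega)]
      exact h.symm
    -- the common extension from there
    have hlce : ∃ e, i₀ + e ≤ i ∧ IsLce W L i₀ (i₀ + p) e := by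
      have hex : ∃ e, ¬ (i₀ + e < L ∧ i₀ + p + e < L ∧ W (i₀ + e) = W (i₀ + p + e)) :=
        ⟨i - i₀, by
          rw [show i₀ + (i - i₀) = i by omega, show i₀ + p + (i - i₀) = i + p by omega]
          tauto⟩
      classical
      refine ⟨Nat.find hex, ?_, fun x hx => not_not.1 (Nat.find_min hex hx), Nat.find_spec hex⟩
      have : Nat.find hex ≤ i - i₀ := Nat.find_min' hex (by
        rw [show i₀ + (i - i₀) = i by omega, show i₀ + p + (i - i₀) = i + p by omega]
        tauto)
      omega
    obtain ⟨e, hei, he⟩ := hlce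
    obtain ⟨g1, g2⟩ := hsol (i₀ + e) (by omega) hei
    rw [show i₀ + e + p = i₀ + p + e by omega] at g2
    -- The extension from `i₀` ends at a solid mismatch at `i₀ + e ≤ i`, which is recorded for the
    -- shift `p`.
    have left : SolidRec σ W L i₀ L f → f p ≤ i := by
      intro h
      have := h (i₀ + p) (by omega) (by omega) e he (by omega) g1 g2
      rw [max_eq_right (by omega), min_eq_left (by omega), Nat.add_sub_cancel_left] at this
      omega
    rcases Nat.eq_zero_or_pos i₀ with rfl | hpos
    · exact left h0
    rcases hs with hs | hs | hs
    · omega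
    · have := (hq (i₀ - 1) (by omega) hs).2
      rw [Nat.sub_add_cancel hpos] at this
      exact left this
    · have := (hq (i₀ - 1 + p) (by omega) hs).2
      rw [show i₀ - 1 + p + 1 = i₀ + p by omega] at this
      -- The non-solid symbol is on the shifted side here, so the extensions were computed from `a =
      -- i₀ + p` and the two positions exchange roles.
      have he' : IsLce W L (i₀ + p) i₀ e :=
        ⟨fun x hx => by obtain ⟨a, b, c⟩ := he.1 x hx; exact ⟨b, a, c.symm⟩,
          fun ⟨a, b, c⟩ => he.2 ⟨b, a, c.symm⟩⟩
      have := this i₀ (by omega) (by omega) e he' (by omega) g2 g1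
      rw [max_eq_left (by omega), min_eq_right (by omega), Nat.add_sub_cancel_left] at this
      omega

section
variable {E : Env} {n σ k : ℕ} {st : Store} {c : ℕ}

theorem run_initPre (hE : Fits E n σ k) {W : ℕ → ℕ} {L : ℕ} (hw : HasWord E n σ k W L st)
    {K : ℕ} (hc : 3 * L + 2 + K ≤ c) :
    Run E initPre st c fun st' c' => Sound E n σ W L (st'.a .pre) ∧ K ≤ c' := by
  have hM := hE.hM
  have hD := hE.hD
  have hle := hw.le
  simp only [initPre, run_seq, run_assign, AExp.ok_zero, AExp.val_zero]
  refine ⟨by omega, by omega, ?_⟩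
  apply Run.loop fun st' c' => st'.r .p ≤ L ∧ (∀ p < st'.r .p, st'.a .pre p = L - p) ∧
    3 * (L - st'.r .p) + 1 + K ≤ c'
  · simp; omega
  · rintro st' c' ⟨h1, h2, h3⟩ hs
    have hw' : HasWord E n σ k W L st' := HasWord.same (st := st.set .p 0)
      ⟨⟨hw.base.n, hw.base.sigma, hw.base.k, hw.base.base⟩, hw.wrd, hw.len, hw.le, hw.code⟩ hs
    simp [hw'.len, hw'.base.base]
    refine ⟨by omega, fun hp => ⟨by omega, by omega, by omega, by omega, by omega, ?_, by omega⟩,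
      fun hp => ⟨fun p hp' => ?_, by omega⟩⟩
    · intro p hp'
      rw [Function.update_apply]
      split_ifs with h
      · rw [h]
      · exact h2 p (by omega)
    · have := h2 p (by omega)
      exact ⟨by omega, Or.inl (by omega)⟩

theorem run_selfPrefStep (hE : Fits E n σ k) {W : ℕ → ℕ} {L q lim : ℕ}
    (hw : HasWord E n σ k W L st) (hq : st.r .q = q) (hqL : q < L)
    (hlim : st.r .lim = lim) (hf : Sound E n σ W L (st.a .pre)) {Z : ℕ}
    (hZ : ∀ y < L, y ≠ q → min q y < lim → σ ≤ W q → σ ≤ W y → 2 * σ ≤ Z)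
    {K : ℕ} (hc : 2 + (if σ ≤ W q then 43 * L + nonSolid σ W L * Z + 16 else 0) + K ≤ c) :
    Run E selfPrefStep st c fun st' c' => Sound E n σ W L (st'.a .pre) ∧
      (∀ p, st'.a .pre p ≤ st.a .pre p) ∧
      (σ ≤ W q → SymbolRec E n σ W lim q L (st'.a .pre) ∧
        SolidRec σ W L (q + 1) L (st'.a .pre)) ∧ K ≤ c' := by
  have hM := hE.hM
  have hD := hE.hD
  have hle := hw.le
  simp only [selfPrefStep, run_seq, run_branch, run_skip, run_assign, BExp.ok_lt, BExp.val_lt,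
    AExp.ok_var, AExp.val_var, AExp.ok_arr, AExp.val_arr, hq, hw.wrd, hw.base.sigma, hw.base.base,
    true_and, and_true, AExp.ok_add, AExp.ok_one, AExp.val_add, AExp.val_one]
  refine ⟨by omega, by omega, fun h => ⟨by omega, hf, fun _ => le_rfl, fun h' => by omega,
    by omega⟩, fun h => ⟨by omega, ?_⟩⟩
  rw [if_pos (by omega)] at hc
  refine (run_symbolLoop (a := q) (K := 26 * L + 14 + K) hE (st := st.set .a q) (c := c - 1 - 1)
    ⟨⟨hw.base.n, hw.base.sigma, hw.base.k, hw.base.base⟩, hw.wrd, hw.len, hw.le, hw.code⟩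
    (by simp) hqL (by simpa using hlim) hf hZ (by omega)).mono ?_
  rintro s d ⟨p1, p2, p3, p4⟩ hs
  have hw' : HasWord E n σ k W L s := HasWord.same (st := st.set .a q)
      ⟨⟨hw.base.n, hw.base.sigma, hw.base.k, hw.base.base⟩, hw.wrd, hw.len, hw.le, hw.code⟩ hs
  have hq' : s.r .q = q := (hs.1 .q (by decide)).trans hq
  rw [hq']
  refine ⟨by omega, by omega, ?_⟩
  refine (run_extendAt (a := q + 1) (K := K) hE (st := s.set .a (q + 1)) (c := d - 1)
    ⟨⟨hw'.base.n, hw'.base.sigma, hw'.base.k, hw'.base.base⟩, hw'.wrd, hw'.len, hw'.le, hw'.code⟩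
    (by simp) hqL p1 (by omega)).mono ?_
  rintro s2 d2 ⟨r1, r2, r3, r4⟩ _
  exact ⟨r1, fun p => (r2 p).trans (p2 p), fun _ => ⟨p3.mono r2, r3⟩, r4⟩

/-- The number of basic steps of `selfPref`. -/
def selfPrefCost (L N Z : ℕ) : ℕ := 33 * L + 17 + N * (43 * L + N * Z + 16)

theorem run_selfPref (hE : Fits E n σ k) {W : ℕ → ℕ} {L lim : ℕ}
    (hw : HasWord E n σ k W L st) (hlim : st.r .lim = lim) {Z : ℕ}
    (hZ : ∀ q < L, ∀ y < L, y ≠ q → min q y < lim → σ ≤ W q → σ ≤ W y → 2 * σ ≤ Z)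
    {K : ℕ} (hc : selfPrefCost L (nonSolid σ W L) Z + K ≤ c) :
    Run E selfPref st c fun st' c' => IsPref E n σ W L lim (st'.a .pre) ∧ K ≤ c' := by
  have hM := hE.hM
  have hD := hE.hD
  have hle := hw.le
  rw [selfPrefCost] at hc
  simp only [selfPref, run_seq]
  refine (run_initPre hE hw (K := c - (3 * L + 2)) (by omega)).mono ?_
  rintro s1 c1 ⟨p1, p2⟩ hs1
  have hw1 := hw.same hs1
  have hlim1 := (hs1.1 .lim (by decide)).trans hlim
  simp only [run_assign, AExp.ok_zero, AExp.val_zero]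
  refine ⟨by omega, by omega, ?_⟩
  refine (run_extendAt (a := 0) (K := c - (29 * L + 15)) hE (st := s1.set .a 0) (c := c1 - 1)
    ⟨⟨hw1.base.n, hw1.base.sigma, hw1.base.k, hw1.base.base⟩, hw1.wrd, hw1.len, hw1.le, hw1.code⟩
    (by simp) (by omega) p1 (by omega)).mono ?_
  rintro s2 c2 ⟨q1, -, q3, q4⟩ hs2
  have hw2 : HasWord E n σ k W L s2 := HasWord.same (st := s1.set .a 0)
      ⟨⟨hw1.base.n, hw1.base.sigma, hw1.base.k, hw1.base.base⟩, hw1.wrd, hw1.len, hw1.le,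
        hw1.code⟩ hs2
  have hlim2 : s2.r .lim = lim := (hs2.1 .lim (by decide)).trans hlim1
  refine ⟨by omega, by omega, ?_⟩
  apply Run.loop fun st' c' => st'.r .q ≤ L ∧ Sound E n σ W L (st'.a .pre) ∧
    SolidRec σ W L 0 L (st'.a .pre) ∧
    (∀ q < st'.r .q, σ ≤ W q → SymbolRec E n σ W lim q L (st'.a .pre) ∧
        SolidRec σ W L (q + 1) L (st'.a .pre)) ∧
    ∑ y ∈ Finset.Ico (st'.r .q) L,
      (4 + if σ ≤ W y then 43 * L + nonSolid σ W L * Z + 16 else 0) + 1 + K ≤ c'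
  · have : (s2.set .q 0).r .q = 0 := by simp
    rw [this, sum_weights]
    simp [q1, q3]; omega
  · rintro st' c' ⟨h1, h2, h3, h4, h5⟩ hs
    have hw' : HasWord E n σ k W L st' := HasWord.same (st := s2.set .q 0)
      ⟨⟨hw2.base.n, hw2.base.sigma, hw2.base.k, hw2.base.base⟩, hw2.wrd, hw2.len, hw2.le,
        hw2.code⟩ hs
    have hlim' : st'.r .lim = lim := (hs.1 .lim (by decide)).trans hlim2
    simp only [BExp.ok_lt, BExp.val_lt, AExp.ok_var, AExp.val_var, hw'.len, true_and]
    refine ⟨by omega, fun hq => ?_, fun hq => ?_⟩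
    swap
    · rw [show st'.r .q = L by omega] at h4
      exact ⟨isPref_of_rec h2 h3 h4, by omega⟩
    rw [Finset.sum_eq_sum_Ico_succ_bot hq] at h5
    rw [run_seq]
    refine (run_selfPrefStep hE hw' rfl hq hlim' h2 (hZ _ hq) (c := c' - 1) (K := c' - 1 - (2 +
      (if σ ≤ W (st'.r .q) then 43 * L + nonSolid σ W L * Z + 16 else 0))) (by omega)).mono ?_
    rintro s d ⟨g1, g2, g3, g4⟩ hs2
    have hqs : s.r .q = st'.r .q := hs2.1 .q (by decide)
    simp only [run_assign, AExp.ok_add, AExp.ok_var, AExp.ok_one, AExp.val_add, AExp.val_var,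
      AExp.val_one, Store.set_r, if_true, hqs, Store.set_a]
    refine ⟨⟨trivial, by omega, by omega⟩, by omega, by omega, g1, h3.mono g2, ?_, by omega⟩
    intro q hq' hs
    rcases (Nat.lt_succ_iff.1 hq').lt_or_eq with h' | rfl
    · exact ⟨(h4 q h' hs).1.mono g2, (h4 q h' hs).2.mono g2⟩
    · exact g3 hs

end
/-! ## The shortest prefix that is a cover, from the lengths of the occurrences -/

/-- The occurrences of length at least `m`, among those of the lengths `P j`, cover
the positions below `n`. -/
def CoversBy (P : ℕ → ℕ) (n m : ℕ) : Prop :=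
  ∀ i < n, ∃ j ≤ i, i < j + m ∧ m ≤ P j

/-- `f t` is the position of the previous greater value before `t`, or `0`. -/
def IsPrevGreater (P : ℕ → ℕ) (t p : ℕ) : Prop :=
  p < t ∧ (∀ i, p < i → i < t → P i ≤ P t) ∧ (0 < p → P t < P p)

theorem IsPrevGreater.unique {P : ℕ → ℕ} {t p p' : ℕ} (h : IsPrevGreater P t p)
    (h' : IsPrevGreater P t p') : p = p' := by
  by_contra hne
  rcases lt_or_gt_of_ne hne with h1 | h1
  · have h2 := h.2.1 p' h1 h'.1
    have h3 := h'.2.2 (by omega)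
    omega
  · have h2 := h'.2.1 p h1 h.1
    have h3 := h.2.2 (by omega)
    omega

/-- Every positive entry `G v` is the distance of two positions such that the values in
between are at most `v`. -/
def GapSound (P : ℕ → ℕ) (n ell : ℕ) (G : ℕ → ℕ) : Prop :=
  ∀ v ≤ ell, G v = 0 ∨ ∃ p q, p < q ∧ q ≤ n ∧ G v = q - p ∧ ∀ i, p < i → i < q → P i ≤ v

/-- The gap from the previous greater position of `t` to `q` is recorded, if `t` is a strict
maximum of the values from `t` on to `q`, and the value at `q` is not smaller. -/
def GapRec (P : ℕ → ℕ) (G : ℕ → ℕ) (q t : ℕ) : Prop :=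
  (∀ i, t < i → i < q → P i < P t) → P t ≤ P q → ∀ p, IsPrevGreater P t p → q - p ≤ G (P t)

theorem GapRec.mono {P G G' : ℕ → ℕ} {q t : ℕ} (h : GapRec P G q t) (hG : ∀ v, G v ≤ G' v) :
    GapRec P G' q t :=
  fun h1 h2 p hp => (h h1 h2 p hp).trans (hG _)

/-- Taking the last maximum gives weak inequalities before it and strict ones after it. These are
what `IsPrevGreater` and `GapRec` ask for, and ties are counted only once. -/
theorem exists_last_max (P : ℕ → ℕ) (p : ℕ) : ∀ q, p + 1 < q → ∃ t, p < t ∧ t < q ∧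
    (∀ i, p < i → i < t → P i ≤ P t) ∧ ∀ i, t < i → i < q → P i < P t := by
  intro q hq
  induction q, hq using Nat.le_induction with
  | base => exact ⟨p + 1, by omega, by omega, fun i _ _ => by omega, fun i _ _ => by omega⟩
  | succ q hq ih =>
    obtain ⟨t, h1, h2, h3, h4⟩ := ih
    rcases le_or_gt (P t) (P q) with h | h
    · refine ⟨q, by omega, by omega, fun i hi hi' => ?_, fun i _ _ => by omega⟩
      rcases lt_trichotomy i t with h5 | rfl | h5
      · exact (h3 i hi h5).trans h
      · exact h
      · exact (h4 i h5 hi').le.trans h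
    · refine ⟨t, h1, by omega, h3, fun i hi hi' => ?_⟩
      rcases (Nat.lt_succ_iff.1 hi').lt_or_eq with h5 | rfl
      · exact h4 i hi h5
      · exact h

/-- If a position is not covered by occurrences of length at least `m`, take the last position `p`
before it and the first position `q` after it with value at least `m`; then `q - p > m`. The largest
value strictly between them is some `v < m`, and the gap is recorded under `v`, so `G v > m`.
Conversely, a gap recorded under `v < m` contains no occurrence of length `m` inside, so the
position `q - 1` can be covered from `p` or earlier only if `q - p ≤ m`. Position `n`, with the
maximal value `ell`, serves as a sentinel on the right, and position `0` on the left, by `m ≤ P 0`.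
-/
theorem coversBy_iff_gap {P G : ℕ → ℕ} {n ell m : ℕ} (hP : ∀ i ≤ n, P i ≤ ell) (hn : P n = ell)
    (hs : GapSound P n ell G) (hr : ∀ q, 1 ≤ q → q ≤ n → ∀ t, 0 < t → t < q → GapRec P G q t)
    (hm : 1 ≤ m) (hm0 : m ≤ P 0) : (∀ v < m, G v ≤ m) ↔ CoversBy P n m := by
  have hell : m ≤ ell := hm0.trans (hP 0 (Nat.zero_le _))
  constructor
  · intro h i hi
    by_contra hno
    push Not at hno
    -- the occurrence before position `i`
    have hp : ∃ p ≤ i, m ≤ P p ∧ ∀ x, p < x → x ≤ i → P x < m := by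
      classical
      have hne : ∃ d, d ≤ i ∧ m ≤ P (i - d) := ⟨i, le_rfl, by simpa using hm0⟩
      refine ⟨i - Nat.find hne, by omega, (Nat.find_spec hne).2, fun x hx hx' => ?_⟩
      have := Nat.find_min hne (m := i - x) (by omega)
      rw [show i - (i - x) = x by omega] at this
      by_contra h'
      exact this ⟨by omega, by omega⟩
    have hq : ∃ q, i < q ∧ q ≤ n ∧ m ≤ P q ∧ ∀ x, i < x → x < q → P x < m := by
      classical
      have hne : ∃ q, i < q ∧ m ≤ P q := ⟨n, hi, by omega⟩
      refine ⟨Nat.find hne, (Nat.find_spec hne).1, Nat.find_min' hne ⟨hi, by omega⟩,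
        (Nat.find_spec hne).2, fun x hx hx' => ?_⟩
      have := Nat.find_min hne hx'
      by_contra h'
      exact this ⟨hx, by omega⟩
    obtain ⟨p, hpi, hpm, hp⟩ := hp
    obtain ⟨q, hiq, hqn, hqm, hq⟩ := hq
    have hpm' : p + m ≤ i := by
      by_contra h'
      have := hno p hpi (by omega)
      omega
    -- The previous greater position of this `t` is `p`, since `P t < m ≤ P p`.
    obtain ⟨t, h1, h2, h3, h4⟩ := exists_last_max P p q (by omega)
    have htm : P t < m := by
      rcases le_or_gt t i with h' | h'
      · exact hp t h1 h'
      · exact hq t h' h2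
    have h5 := hr q (by omega) hqn t (by omega) h2 h4 (by omega) p ⟨h1, h3, fun _ => by omega⟩
    have h6 := h _ htm
    omega
  · intro h v hv
    rcases hs v (by omega) with h0 | ⟨p, q, h1, h2, h3, h4⟩
    · omega
    · by_contra h'
      -- An occurrence covering `q - 1` has value at least `m > v`, hence starts at `p` or before.
      obtain ⟨j, h5, h6, h7⟩ := h (q - 1) (by omega)
      have := h4 j (by omega) (by omega)
      omega

/-- Set `prf[j]` to the length of the occurrence at `j` of a prefix of the candidate, that is,
of the first `ell` letters of the word. -/
def initPrf : Cmd :=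
  .assign .j 0 ;;
  .loop (.lt ♯.j ♯.n)
    (.branch (.lt ♯.ell (.arr .pre (♯.ell + ♯.j))) (.store .prf ♯.j ♯.ell)
        (.store .prf ♯.j (.arr .pre (♯.ell + ♯.j))) ;;
      .assign .j (♯.j + 1)) ;;
  .store .prf ♯.n ♯.ell

/-- Clear the array `gap`. -/
def initGap : Cmd :=
  .assign .i 0 ;; .loop (.lt ♯.i (♯.ell + 1)) (.store .gap ♯.i 0 ;; .assign .i (♯.i + 1))

/-- Follow the chain of previous greater positions from `t` to a value greater than that at `j`,
and record the gaps that end at `j`. -/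
def climb : Cmd :=
  .loop (.and (.lt 0 ♯.t) (.not (.lt (.arr .prf ♯.j) (.arr .prf ♯.t))))
    (.assign .g (♯.j - .arr .par ♯.t) ;;
      .branch (.lt (.arr .gap (.arr .prf ♯.t)) ♯.g) (.store .gap (.arr .prf ♯.t) ♯.g) .skip ;;
      .assign .t (.arr .par ♯.t))

/-- Compute the gaps. -/
def gaps : Cmd :=
  .assign .j 1 ;;
  .loop (.lt ♯.j (♯.n + 1))
    (.assign .t (♯.j - 1) ;; climb ;; .store .par ♯.j ♯.t ;; .assign .j (♯.j + 1))

section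
variable {E : Env} {n σ k : ℕ} {st : Store} {c : ℕ}

theorem run_initPrf (hE : Fits E n σ k) (hB : Base E n σ k st) {ell : ℕ} (hell : st.r .ell = ell)
    (hle : ell ≤ n) {K : ℕ} (hc : 4 * n + 3 + K ≤ c) :
    Run E initPrf st c fun st' c' => (∀ j < n, st'.a .prf j = min ell (st.a .pre (ell + j))) ∧
      st'.a .prf n = ell ∧ K ≤ c' := by
  have hM := hE.hM
  have hD := hE.hD
  simp only [initPrf, run_seq, run_assign, AExp.ok_zero, AExp.val_zero]
  refine ⟨by omega, by omega, ?_⟩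
  apply Run.loop fun st' c' => st'.r .j ≤ n ∧
    (∀ j < st'.r .j, st'.a .prf j = min ell (st.a .pre (ell + j))) ∧
    4 * (n - st'.r .j) + 2 + K ≤ c'
  · simp; omega
  · rintro st' c' ⟨h1, h2, h3⟩ hs
    have hB' : Base E n σ k st' := Base.same (st := st.set .j 0)
      ⟨hB.n, hB.sigma, hB.k, hB.base⟩ hs
    have hell' : st'.r .ell = ell := (hs.1 .ell (by decide)).trans hell
    have hp' : st'.a .pre = st.a .pre := hs.2 .pre (by decide)
    have key : ∀ x, x = min ell (st.a .pre (ell + st'.r .j)) → ∀ j ≤ st'.r .j,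
        Function.update (st'.a .prf) (st'.r .j) x j = min ell (st.a .pre (ell + j)) := by
      intro x hx j hj
      rw [Function.update_apply]
      split_ifs with h
      · rw [hx, h]
      · exact h2 j (by omega)
    simp [hB'.n, hell', hB'.base, hp']
    refine ⟨by omega, fun hj => ⟨by omega, by omega, fun h => ⟨by omega, by omega, by omega,
      by omega, by omega, key ell (by omega), by omega⟩, fun h => ⟨by omega, by omega, by omega,
      by omega, by omega, key (st.a .pre (ell + st'.r .j)) (by omega), by omega⟩⟩, fun hj => ⟨by omega, by omega, ?_,
      by omega⟩⟩
    intro j hj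
    rw [Function.update_apply, if_neg (by omega)]
    exact h2 j (by omega)

theorem run_initGap (hE : Fits E n σ k) (hB : Base E n σ k st) {ell : ℕ} (hell : st.r .ell = ell)
    (hle : ell ≤ n) {K : ℕ} (hc : 3 * n + 5 + K ≤ c) :
    Run E initGap st c fun st' c' => (∀ v ≤ ell, st'.a .gap v = 0) ∧ K ≤ c' := by
  have hM := hE.hM
  have hD := hE.hD
  simp only [initGap, run_seq, run_assign, AExp.ok_zero, AExp.val_zero]
  refine ⟨by omega, by omega, ?_⟩
  apply Run.loop fun st' c' => st'.r .i ≤ ell + 1 ∧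
    (∀ v < st'.r .i, st'.a .gap v = 0) ∧ 3 * (ell + 1 - st'.r .i) + 1 + K ≤ c'
  · simp; omega
  · rintro st' c' ⟨h1, h2, h3⟩ hs
    have hB' : Base E n σ k st' := Base.same (st := st.set .i 0)
      ⟨hB.n, hB.sigma, hB.k, hB.base⟩ hs
    have hell' : st'.r .ell = ell := (hs.1 .ell (by decide)).trans hell
    simp [hell', hB'.base]
    refine ⟨by omega, by omega, fun hj => ⟨by omega, by omega, by omega, by omega, by omega, ?_,
      by omega⟩, fun hj => ⟨fun v hv => h2 v (by omega), by omega⟩⟩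
    intro v hv
    rw [Function.update_apply]
    split_ifs with h
    · rfl
    · exact h2 v (by omega)

/-- The chain of previous greater positions from `j - 1` consists, apart from its end `0`, of the
positions that exceed everything between them and `j`. Those with value at most `P j` are the ones
whose gap to `j` has to be recorded, and they come first in the chain, so the walk can stop at the
first greater value. The depth `dep` in the chain is the potential that pays for the walk. -/
theorem run_climb (hE : Fits E n σ k) (hB : Base E n σ k st) {P : ℕ → ℕ} {ell j : ℕ}
    (hP : ∀ i ≤ n, P i ≤ ell) (hle : ell ≤ n) (hprf : st.a .prf = P) (hj : st.r .j = j)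
    (hjn : j ≤ n) (ht : st.r .t + 1 = j)
    (hpar : ∀ t, 0 < t → t < j → IsPrevGreater P t (st.a .par t))
    (hs : GapSound P n ell (st.a .gap)) {dep : ℕ → ℕ}
    (hdep : ∀ t, 0 < t → t < j → dep t = dep (st.a .par t) + 1) {K : ℕ}
    (hc : 5 * dep (st.r .t) + 1 + K ≤ c) :
    Run E climb st c fun st' c' => IsPrevGreater P j (st'.r .t) ∧
      GapSound P n ell (st'.a .gap) ∧ (∀ v, st.a .gap v ≤ st'.a .gap v) ∧
      (∀ t, 0 < t → t < j → GapRec P (st'.a .gap) j t) ∧ 5 * dep (st'.r .t) + K ≤ c' := by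
  have hM := hE.hM
  have hD := hE.hD
  apply Run.loop fun st' c' => st'.r .t < j ∧
    (0 < st'.r .t → ∀ i, st'.r .t < i → i < j → P i < P (st'.r .t)) ∧
    (∀ i, st'.r .t < i → i < j → P i ≤ P j) ∧
    GapSound P n ell (st'.a .gap) ∧ (∀ v, st.a .gap v ≤ st'.a .gap v) ∧
    (∀ t, st'.r .t < t → t < j → GapRec P (st'.a .gap) j t) ∧ 5 * dep (st'.r .t) + 1 + K ≤ c'
  · exact ⟨by omega, fun _ i _ _ => by omega, fun i _ _ => by omega, hs, fun _ => le_rfl,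
      fun t _ _ => by omega, hc⟩
  · rintro st' c' ⟨h1, h2, h3, h4, h5, h6, h7⟩ hsame
    have hB' := hB.same hsame
    have hj' := (hsame.1 .j (by decide)).trans hj
    have hprf' := (hsame.2 .prf (by decide)).trans hprf
    have hpar' := hsame.2 .par (by decide)
    simp only [BExp.ok_and, BExp.ok_lt, BExp.ok_not, BExp.val_and, BExp.val_lt, BExp.val_not,
      AExp.ok_zero, AExp.val_zero, AExp.ok_var, AExp.val_var, AExp.ok_arr, AExp.val_arr, hj',
      hprf', hpar', hB'.base, true_and, and_true, run_seq, run_assign, run_branch, run_store, run_skip,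
      AExp.ok_sub, AExp.val_sub, Store.set_r, Store.set_a, Store.put_r, Store.put_a, if_true,
      reduceCtorEq, if_false]
    refine ⟨by omega, by omega, ?_, ?_⟩
    · rintro ⟨ht0, htj⟩
      have hpt := hpar _ ht0 h1
      have hdt := hdep _ ht0 h1
      have hPt := hP (st'.r .t) (by omega)
      have next : ∀ G : ℕ → ℕ, GapSound P n ell G → (∀ v, st'.a .gap v ≤ G v) →
          j - st.a .par (st'.r .t) ≤ G (P (st'.r .t)) → ∀ d, c' ≤ d + 5 →
          st.a .par (st'.r .t) < j ∧ (0 < st.a .par (st'.r .t) → ∀ i, st.a .par (st'.r .t) < i →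
            i < j → P i < P (st.a .par (st'.r .t))) ∧
          (∀ i, st.a .par (st'.r .t) < i → i < j → P i ≤ P j) ∧ GapSound P n ell G ∧
          (∀ v, st.a .gap v ≤ G v) ∧ (∀ t, st.a .par (st'.r .t) < t → t < j → GapRec P G j t) ∧
          5 * dep (st.a .par (st'.r .t)) + 1 + K ≤ d := by
        intro G g1 g2 g3 d hd
        refine ⟨by have := hpt.1; omega, fun h i hi hi' => ?_, fun i hi hi' => ?_, g1,
          fun v => (h5 v).trans (g2 v), fun t htt ht' => ?_, by omega⟩
        · have := hpt.2.2 h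
          rcases lt_trichotomy i (st'.r .t) with h' | rfl | h'
          · have := hpt.2.1 i hi h'; omega
          · exact this
          · have := h2 ht0 i h' hi'; omega
        · rcases lt_trichotomy i (st'.r .t) with h' | rfl | h'
          · have := hpt.2.1 i hi h'; omega
          · omega
          · exact h3 i h' hi'
        · rcases lt_trichotomy t (st'.r .t) with h' | rfl | h'
          · intro hmax
            have := hmax _ h' h1
            have := hpt.2.1 t htt h'
            omega
          · intro _ _ p hp
            rwa [hp.unique hpt]
          · exact (h6 t h' ht').mono g2
      have hbelow : ∀ i, st.a .par (st'.r .t) < i → i < j → P i ≤ P (st'.r .t) := by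
        intro i hi hi'
        rcases lt_trichotomy i (st'.r .t) with h' | rfl | h'
        · exact hpt.2.1 i hi h'
        · exact le_rfl
        · exact (h2 ht0 i h' hi').le
      have hpt1 := hpt.1
      refine ⟨by omega, by omega, by omega, by omega, fun hg => ⟨by omega, by omega, by omega,
        by omega, next _ ?_ ?_ ?_ _ (by omega)⟩, fun hg => ⟨by omega, by omega, by omega,
        next _ h4 (fun _ => le_rfl) (by omega) _ (by omega)⟩⟩
      · intro v hv
        rw [Function.update_apply]
        split_ifs with h
        · exact Or.inr ⟨_, j, by omega, hjn, rfl, fun i hi hi' => h ▸ hbelow i hi hi'⟩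
        · exact h4 v hv
      · intro v
        rw [Function.update_apply]
        split_ifs with h
        · subst h; exact hg.le
        · exact le_rfl
      · simp
    · intro hexit
      refine ⟨⟨h1, h3, fun h => by omega⟩, h4, h5, fun t ht0 htj => ?_, by omega⟩
      rcases lt_trichotomy t (st'.r .t) with h' | rfl | h'
      · intro hmax hle
        have := hmax _ h' h1
        omega
      · intro _ hle
        omega
      · exact h6 t h' htj

theorem run_gaps (hE : Fits E n σ k) (hB : Base E n σ k st) {P : ℕ → ℕ} {ell : ℕ}
    (hP : ∀ i ≤ n, P i ≤ ell) (hle : ell ≤ n) (hprf : st.a .prf = P)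
    (hg : ∀ v ≤ ell, st.a .gap v = 0) {K : ℕ} (hc : 10 * n + 2 + K ≤ c) :
    Run E gaps st c fun st' c' => GapSound P n ell (st'.a .gap) ∧
      (∀ q, 1 ≤ q → q ≤ n → ∀ t, 0 < t → t < q → GapRec P (st'.a .gap) q t) ∧ K ≤ c' := by
  have hM := hE.hM
  have hD := hE.hD
  simp only [gaps, run_seq, run_assign, AExp.ok_one, AExp.val_one]
  refine ⟨by omega, by omega, ?_⟩
  apply Run.loop fun st' c' => 1 ≤ st'.r .j ∧ st'.r .j ≤ n + 1 ∧
    (∀ t, 0 < t → t < st'.r .j → IsPrevGreater P t (st'.a .par t)) ∧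
    GapSound P n ell (st'.a .gap) ∧
    (∀ q, 1 ≤ q → q < st'.r .j → ∀ t, 0 < t → t < q → GapRec P (st'.a .gap) q t) ∧
    ∃ dep : ℕ → ℕ, (∀ t, 0 < t → t < st'.r .j → dep t = dep (st'.a .par t) + 1) ∧
      10 * (n + 1 - st'.r .j) + 5 * dep (st'.r .j - 1) + 1 + K ≤ c'
  · simp
    refine ⟨fun t _ _ => by omega, fun v hv => Or.inl (hg v hv), fun q _ _ t _ _ => by omega,
      fun _ => 0, fun t _ _ => by omega, by dsimp only; omega⟩
  · rintro st' c' ⟨h1, h2, h3, h4, h5, dep, h6, h7⟩ hs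
    have hB' : Base E n σ k st' := Base.same (st := st.set .j 1)
      ⟨hB.n, hB.sigma, hB.k, hB.base⟩ hs
    have hprf' : st'.a .prf = P := (hs.2 .prf (by decide)).trans hprf
    simp only [BExp.ok_lt, BExp.val_lt, AExp.ok_var, AExp.val_var, AExp.ok_add, AExp.ok_one,
      AExp.val_add, AExp.val_one, hB'.n, true_and, run_seq, run_assign, AExp.ok_sub, AExp.val_sub]
    refine ⟨by omega, by omega, fun hj => ⟨by omega, by omega, ?_⟩, fun hj => ⟨h4, fun q hq hqn =>
      h5 q hq (by omega), by omega⟩⟩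
    refine (run_climb (st := st'.set .t (st'.r .j - 1)) (c := c' - 1 - 1) (j := st'.r .j)
      (dep := dep) (K := 10 * (n - st'.r .j) + 8 + K) hE
      ⟨hB'.n, hB'.sigma, hB'.k, hB'.base⟩ hP hle hprf' (by simp) (by omega) (by simp; omega) h3 h4
      h6 (by simp; omega)).mono ?_
    rintro s d ⟨g1, g2, g3, g4, g5⟩ hs2
    have hBs : Base E n σ k s := Base.same (st := st'.set .t (st'.r .j - 1))
      ⟨hB'.n, hB'.sigma, hB'.k, hB'.base⟩ hs2
    have hjs : s.r .j = st'.r .j := hs2.1 .j (by decide)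
    have hps : s.a .par = st'.a .par := hs2.2 .par (by decide)
    simp only [run_store, AExp.ok_var, AExp.val_var, AExp.ok_add, AExp.ok_one, AExp.val_add,
      AExp.val_one, hjs, hps, hBs.base, true_and, Store.put_r, Store.put_a, Store.set_r,
      Store.set_a, if_true, reduceCtorEq, if_false]
    refine ⟨by omega, by omega, by omega, by omega, by omega, by omega, ?_, g2, ?_,
      -- The depth of `j` exceeds that of its parent by one. Hence each step of a walk removes one
      -- level, each round adds at most one, and all walks together are linear.
      Function.update dep (st'.r .j) (dep (s.r .t) + 1), ?_, ?_⟩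
    · intro t ht ht'
      rw [Function.update_apply]
      split_ifs with h
      · rwa [h]
      · exact h3 t ht (by omega)
    · intro q hq hq' t ht htq
      rcases (Nat.lt_succ_iff.1 hq').lt_or_eq with h | rfl
      · exact (h5 q hq h t ht htq).mono g3
      · exact g4 t ht htq
    · intro t ht ht'
      have hlt := g1.1
      rcases (Nat.lt_succ_iff.1 ht').lt_or_eq with h | rfl
      · have := (h3 t ht h).1
        simp only [Function.update_apply, if_neg (show t ≠ st'.r .j by omega),
          if_neg (show st'.a .par t ≠ st'.r .j by omega)]
        exact h6 t ht h
      · simp [Function.update_apply, hlt.ne]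
    · simp
      omega

end
-- The shortest covering prefix of one candidate
/-- Search for the smallest length below `blen` for which the occurrences cover the text. -/
def search : Cmd :=
  .assign .m 1 ;; .assign .g (.arr .gap 0) ;;
  .loop (.and (.lt ♯.m ♯.blen) (.not (.and (.not (.lt ♯.m ♯.g)) (.not (.lt (.arr .prf 0) ♯.m)))))
    (.branch (.lt ♯.g (.arr .gap ♯.m)) (.assign .g (.arr .gap ♯.m)) .skip ;;
      .assign .m (♯.m + 1))

/-- If a shorter cover was found, make it the best one. -/
def update : Cmd :=
  .branch (.lt ♯.m ♯.blen)
    (.assign .i 0 ;;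
      .loop (.lt ♯.i ♯.m) (.store .best ♯.i (.arr .wrd ♯.i) ;; .assign .i (♯.i + 1)) ;;
      .assign .blen ♯.m)
    .skip

/-- Check the prefixes of the candidate. -/
def checkPrefixes : Cmd := initPrf ;; initGap ;; gaps ;; search ;; update

section
variable {E : Env} {n σ k : ℕ} {st : Store} {c : ℕ}

theorem run_search (hE : Fits E n σ k) (hB : Base E n σ k st) {P : ℕ → ℕ} {ell b : ℕ}
    (hP : ∀ i ≤ n, P i ≤ ell) (hn : P n = ell) (hprf : st.a .prf = P) (hb : st.r .blen = b)
    (hb1 : 1 ≤ b) (hbn : b ≤ n) (hs : GapSound P n ell (st.a .gap))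
    (hr : ∀ q, 1 ≤ q → q ≤ n → ∀ t, 0 < t → t < q → GapRec P (st.a .gap) q t)
    {K : ℕ} (hc : 4 * n + 3 + K ≤ c) :
    Run E search st c fun st' c' => 1 ≤ st'.r .m ∧ st'.r .m ≤ b ∧
      (∀ m, 1 ≤ m → m < st'.r .m → ¬ CoversBy P n m) ∧
      (st'.r .m < b → st'.r .m ≤ ell ∧ CoversBy P n (st'.r .m)) ∧ K ≤ c' := by
  have hM := hE.hM
  have hD := hE.hD
  have h2σ := hE.two_le
  have hle := hE.le_n
  have hP0 := hP 0 (Nat.zero_le _)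
  have hcov0 : ∀ m, CoversBy P n m → m ≤ P 0 := by
    intro m h
    obtain ⟨j, h1, h2, h3⟩ := h 0 (by omega)
    rwa [Nat.le_zero.1 h1] at h3
  simp only [search, run_seq, run_assign, AExp.ok_one, AExp.val_one, AExp.ok_arr, AExp.val_arr,
    AExp.ok_zero, AExp.val_zero, Store.set_r, Store.set_a, hB.base, reduceCtorEq, if_false]
  refine ⟨by omega, by omega, ⟨by omega, trivial, by omega⟩, by omega, ?_⟩
  apply Run.loop fun st' c' => 1 ≤ st'.r .m ∧ st'.r .m ≤ b ∧
    (∀ v < st'.r .m, st.a .gap v ≤ st'.r .g) ∧ (∃ v < st'.r .m, st.a .gap v = st'.r .g) ∧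
    (∀ m, 1 ≤ m → m < st'.r .m → ¬ CoversBy P n m) ∧ 4 * (b - st'.r .m) + 1 + K ≤ c'
  · simp
    exact ⟨hb1, fun m _ _ => by omega, by omega⟩
  · rintro st' c' ⟨h1, h2, h3, ⟨v, h4, h4'⟩, h5, h6⟩ hsame
    have hB' : Base E n σ k st' := Base.same
      (st := (st.set .m 1).set .g (st.a .gap 0)) ⟨hB.n, hB.sigma, hB.k, hB.base⟩ hsame
    have hprf' : st'.a .prf = P := (hsame.2 .prf (by decide)).trans hprf
    have hgap' : st'.a .gap = st.a .gap := hsame.2 .gap (by decide)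
    have hb' : st'.r .blen = b := (hsame.1 .blen (by decide)).trans hb
    -- The running maximum `g` of the gaps of values below `m` turns the criterion into a test of
    -- constant cost. The condition `m ≤ P 0` is necessary, as only an occurrence at `0` can cover
    -- the position `0`.
    have key : (¬ st'.r .m < st'.r .g ∧ ¬ P 0 < st'.r .m) ↔
        (st'.r .m ≤ ell ∧ CoversBy P n (st'.r .m)) := by
      constructor
      · rintro ⟨g1, g2⟩
        exact ⟨by omega, (coversBy_iff_gap hP hn hs hr h1 (by omega)).1 fun v hv =>
          (h3 v hv).trans (by omega)⟩
      · rintro ⟨g1, g2⟩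
        have g3 := hcov0 _ g2
        have := (coversBy_iff_gap hP hn hs hr h1 g3).2 g2 v h4
        omega
    simp only [BExp.ok_and, BExp.ok_lt, BExp.ok_not, BExp.val_and, BExp.val_lt, BExp.val_not,
      AExp.ok_zero, AExp.val_zero, AExp.ok_var, AExp.val_var, AExp.ok_arr, AExp.val_arr, hb',
      hprf', hgap', hB'.base, true_and, and_true, run_seq, run_assign, run_branch, run_skip,
      AExp.ok_add, AExp.val_add, AExp.ok_one, AExp.val_one, Store.set_r, Store.set_a, if_true,
      reduceCtorEq, if_false, key]
    refine ⟨by omega, by omega, ?_, ?_⟩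
    · rintro ⟨g1, g2⟩
      have next : ∀ m, 1 ≤ m → m < st'.r .m + 1 → ¬ CoversBy P n m := by
        intro m hm hm'
        rcases (Nat.lt_succ_iff.1 hm').lt_or_eq with h | rfl
        · exact h5 m hm h
        · exact fun h => g2 ⟨by have := hcov0 _ h; omega, h⟩
      refine ⟨by omega, by omega, fun g3 => ⟨by omega, by omega, by omega, by omega, by omega,
        by omega, fun v hv => ?_, ⟨st'.r .m, by omega, rfl⟩, next, by omega⟩,
        fun g3 => ⟨by omega, by omega, by omega, by omega, by omega, fun v hv => ?_,
          ⟨v, by omega, h4'⟩, next, by omega⟩⟩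
      · rcases (Nat.lt_succ_iff.1 hv).lt_or_eq with h | rfl
        · have := h3 v h; omega
        · exact le_rfl
      · rcases (Nat.lt_succ_iff.1 hv).lt_or_eq with h | rfl
        · exact h3 v h
        · omega
    · intro g1
      exact ⟨h1, h2, h5, fun h => by tauto, by omega⟩

theorem run_update (hE : Fits E n σ k) {W : ℕ → ℕ} {L b m : ℕ} (hw : HasWord E n σ k W L st)
    (hb : st.r .blen = b) (hm : st.r .m = m) (hmb : m ≤ b) (hbn : b ≤ n) {K : ℕ}
    (hc : 3 * n + 4 + K ≤ c) :
    Run E update st c fun st' c' => st'.r .blen = m ∧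
      (m < b → ∀ i < m, st'.a .best i = W i) ∧ (m = b → st'.a .best = st.a .best) ∧ K ≤ c' := by
  have hM := hE.hM
  have hD := hE.hD
  simp only [update, run_seq, run_branch, run_assign, run_skip, BExp.ok_lt, BExp.val_lt, AExp.ok_var,
    AExp.val_var, AExp.ok_zero, AExp.val_zero, hb, hm, true_and]
  refine ⟨by omega, fun h => ⟨by omega, by omega, ?_⟩, fun h => ⟨by omega, by omega, by omega,
    by simp, by omega⟩⟩
  apply Run.loop fun st' c' => st'.r .i ≤ m ∧ (∀ i < st'.r .i, st'.a .best i = W i) ∧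
    3 * (m - st'.r .i) + 2 + K ≤ c'
  · simp; omega
  · rintro st' c' ⟨h1, h2, h3⟩ hs
    have hw' : HasWord E n σ k W L st' := HasWord.same (st := st.set .i 0)
      ⟨⟨hw.base.n, hw.base.sigma, hw.base.k, hw.base.base⟩, hw.wrd, hw.len, hw.le, hw.code⟩ hs
    have hm' : st'.r .m = m := (hs.1 .m (by decide)).trans hm
    simp [hm', hw'.base.base, hw'.wrd]
    refine ⟨by omega, fun hi => ⟨by omega, by omega, by omega, by omega, by omega, fun i hi' => ?_,
      by omega⟩, fun hi => ⟨by omega, fun _ i hi' => h2 i (by omega), fun h' => by omega, by omega⟩⟩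
    rw [Function.update_apply]
    split_ifs with h
    · rw [h]
    · exact h2 i (by omega)

/-- The length of the longest occurrence at `j` of a prefix of the first `ell` symbols. -/
theorem le_prf_iff {f W : ℕ → ℕ} {L ell j m : ℕ}
    (hf : IsPref E n σ W L ell f) (hj : ell + j < L) (hm : 1 ≤ m) (hml : m ≤ ell) :
    m ≤ min ell (f (ell + j)) ↔ ell + j + m ≤ L ∧ ∀ i < m, Mt E n σ (W i) (W (ell + j + i)) := by
  have hs := hf.sound (ell + j) hj
  constructor
  · intro h
    -- A mismatch at `i < m` would be below the limit `ell`, so the recorded first mismatch would be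
    -- at most `i`.
    refine ⟨by omega, fun i hi => ?_⟩
    by_contra hno
    have := hf.first (ell + j) i (by omega) (by omega) (by omega) (by
      rwa [Nat.add_comm i])
    omega
  · rintro ⟨h1, h2⟩
    by_contra h
    rcases hs.2 with h3 | h3
    · omega
    · apply h3
      rw [Nat.add_comm (f (ell + j))]
      exact h2 _ (by omega)

/-- The first `m` symbols of `U` form a cover of the text `T` of length `n`. -/
def Covers (E : Env) (n σ : ℕ) (T U : ℕ → ℕ) (m : ℕ) : Prop :=
  (∀ i < m, U i < σ) ∧
    ∀ i < n, ∃ j ≤ i, i < j + m ∧ j + m ≤ n ∧ ∀ x < m, Has E n σ (T (j + x)) (U x)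

/-- The number of basic steps of `checkPrefixes`. -/
def checkCost (n : ℕ) : ℕ := 24 * n + 17

theorem run_checkPrefixes (hE : Fits E n σ k) {W T U : ℕ → ℕ} {ell b : ℕ}
    (hw : HasWord E n σ k W (ell + n) st) (hell : st.r .ell = ell) (hle : ell ≤ n)
    (hU : ∀ i < ell, W i = U i) (hUσ : ∀ i < ell, U i < σ) (hT : ∀ i < n, W (ell + i) = T i)
    (hpre : IsPref E n σ W (ell + n) ell (st.a .pre)) (hb : st.r .blen = b) (hb1 : 1 ≤ b)
    (hbn : b ≤ n) (hbest : Covers E n σ T (st.a .best) b) {K : ℕ} (hc : checkCost n + K ≤ c) :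
    Run E checkPrefixes st c fun st' c' => 1 ≤ st'.r .blen ∧ st'.r .blen ≤ b ∧
      Covers E n σ T (st'.a .best) (st'.r .blen) ∧
      (∀ m, 1 ≤ m → m ≤ ell → Covers E n σ T U m → st'.r .blen ≤ m) ∧ K ≤ c' := by
  have h2σ := hE.two_le
  have hσn := hE.le_n
  rw [checkCost] at hc
  simp only [checkPrefixes, run_seq]
  refine (run_initPrf hE hw.base hell hle (K := 20 * n + 14 + K) (by omega)).mono ?_
  rintro s1 c1 ⟨hprf, hprfn, hc1⟩ hs1
  have hw1 := hw.same hs1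
  have hell1 := (hs1.1 .ell (by decide)).trans hell
  refine (run_initGap hE hw1.base hell1 hle (K := 17 * n + 9 + K) (by omega)).mono ?_
  rintro s2 c2 ⟨hgap, hc2⟩ hs2
  have hw2 := hw1.same hs2
  have hprf2 := hs2.2 .prf (by decide)
  have hP : ∀ i ≤ n, s1.a .prf i ≤ ell := by
    intro i hi
    rcases hi.lt_or_eq with h | rfl
    · rw [hprf i h]; exact min_le_left _ _
    · exact hprfn.le
  have hcov : ∀ m, 1 ≤ m → m ≤ ell → (CoversBy (s1.a .prf) n m ↔ Covers E n σ T U m) := by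
    intro m hm hml
    have hiff : ∀ j < n, m ≤ s1.a .prf j ↔
        j + m ≤ n ∧ ∀ x < m, Has E n σ (T (j + x)) (U x) := by
      intro j hj
      rw [hprf j hj, le_prf_iff hpre (by omega) hm hml, add_assoc, Nat.add_le_add_iff_left]
      refine and_congr_right fun h => forall₂_congr fun x hx => ?_
      rw [hU x (by omega), add_assoc, hT _ (by omega), mt_solid (hUσ x (by omega))]
    constructor
    · refine fun h => ⟨fun i hi => hUσ i (by omega), fun i hi => ?_⟩
      obtain ⟨j, h1, h2, h3⟩ := h i hi
      exact ⟨j, h1, h2, (hiff j (by omega)).1 h3⟩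
    · refine fun h i hi => ?_
      obtain ⟨j, h1, h2, h3⟩ := h.2 i hi
      exact ⟨j, h1, h2, (hiff j (by omega)).2 h3⟩
  refine (run_gaps hE hw2.base hP hle hprf2 hgap (K := 7 * n + 7 + K) (by omega)).mono ?_
  rintro s3 c3 ⟨hsnd, hrec, hc3⟩ hs3
  have hw3 := hw2.same hs3
  have hb3 : s3.r .blen = b :=
    ((hs3.1 .blen (by decide)).trans (hs2.1 .blen (by decide))).trans
      ((hs1.1 .blen (by decide)).trans hb)
  refine (run_search hE hw3.base hP hprfn ((hs3.2 .prf (by decide)).trans hprf2) hb3 hb1 hbn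
    hsnd hrec (K := 3 * n + 4 + K) (by omega)).mono ?_
  rintro s4 c4 ⟨hm1, hmb, hno, hyes, hc4⟩ hs4
  have hw4 := hw3.same hs4
  have hb4 := (hs4.1 .blen (by decide)).trans hb3
  refine (run_update hE hw4 hb4 rfl hmb hbn (K := K) (by omega)).mono ?_
  rintro s5 c5 ⟨hbl, hnew, hold, hc5⟩ hs5
  have hbest4 : s4.a .best = st.a .best :=
    ((hs4.2 .best (by decide)).trans (hs3.2 .best (by decide))).trans
      ((hs2.2 .best (by decide)).trans (hs1.2 .best (by decide)))
  rw [hbl]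
  refine ⟨hm1, hmb, ?_, ?_, hc5⟩
  · rcases hmb.lt_or_eq with h | h
    · obtain ⟨h1, h2⟩ := hyes h
      obtain ⟨h3, h4⟩ := (hcov _ hm1 h1).1 h2
      have heq : ∀ i < s4.r .m, s5.a .best i = U i := fun i hi => by
        rw [hnew h i hi, hU i (by omega)]
      refine ⟨fun i hi => by rw [heq i hi]; exact h3 i hi, fun i hi => ?_⟩
      obtain ⟨j, g1, g2, g3, g4⟩ := h4 i hi
      exact ⟨j, g1, g2, g3, fun x hx => by rw [heq x hx]; exact g4 x hx⟩
    · rw [hold h, hbest4, h]; exact hbest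
  · intro m hm hml hcm
    by_contra hlt
    exact hno m hm (by omega) ((hcov m hm hml).2 hcm)

end
/-! ## Enumeration of the candidates -/

theorem nonSolid_succ (σ : ℕ) (T : ℕ → ℕ) (L : ℕ) :
    nonSolid σ T (L + 1) = nonSolid σ T L + if σ ≤ T L then 1 else 0 :=
  Finset.sum_range_succ _ _

theorem nonSolid_mono (σ : ℕ) (T : ℕ → ℕ) : Monotone (nonSolid σ T) :=
  monotone_nat_of_le_succ fun L => by rw [nonSolid_succ]; omega

/-- The letters of the candidate of number `c`: its letters at the non-solid positions are
the digits of `c`. -/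
def letters (σ : ℕ) (T : ℕ → ℕ) (c x : ℕ) : ℕ :=
  if T x < σ then T x else c / σ ^ nonSolid σ T x % σ

theorem letters_lt {σ : ℕ} (hσ : 0 < σ) (T : ℕ → ℕ) (c x : ℕ) : letters σ T c x < σ := by
  rw [letters]
  split_ifs with h
  · exact h
  · exact Nat.mod_lt _ hσ

/-- `nonSolid σ T x` is the index of the digit that belongs to position `x`, and the divisibility
says that all lower digits of `c` are `σ - 1`, so that the carry of `c + 1` arrives at `x`. A solid
position or a digit `σ - 1` passes it on. -/
theorem letters_carry {σ : ℕ} (hσ : 0 < σ) {T : ℕ → ℕ} {c x : ℕ}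
    (hd : σ ^ nonSolid σ T x ∣ c + 1) (hx : T x < σ ∨ letters σ T c x + 1 = σ) :
    σ ^ nonSolid σ T (x + 1) ∣ c + 1 ∧
      letters σ T (c + 1) x = if T x < σ then letters σ T c x else 0 := by
  rw [nonSolid_succ]
  by_cases h : T x < σ
  · rw [if_neg (by omega), if_pos h]
    exact ⟨hd, by simp [letters, h]⟩
  · rw [if_pos (by omega), if_neg h]
    have h1 : c / σ ^ nonSolid σ T x % σ + 1 = σ := by
      have := hx.resolve_left h
      rwa [letters, if_neg h] at this
    have h2 : (c + 1) / σ ^ nonSolid σ T x = c / σ ^ nonSolid σ T x + 1 := by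
      rw [Nat.succ_div, if_pos hd]
    have h3 : σ ∣ c / σ ^ nonSolid σ T x + 1 := by
      rw [Nat.dvd_iff_mod_eq_zero, Nat.add_mod]
      rcases Nat.lt_or_ge 1 σ with h4 | h4
      · rw [Nat.mod_eq_of_lt h4, h1, Nat.mod_self]
      · obtain rfl : σ = 1 := by omega
        exact Nat.mod_one _
    constructor
    · rw [pow_succ]
      obtain ⟨e, he⟩ := hd
      rw [he, Nat.mul_div_cancel_left _ (by positivity)] at h2
      rw [he]
      exact Nat.mul_dvd_mul_left _ (h2 ▸ h3)
    · rw [letters, if_neg h, h2]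
      exact Nat.mod_eq_zero_of_dvd h3

/-- A digit below `σ - 1` absorbs the carry; the failing divisibility says that it goes no further.
-/
theorem letters_stop {σ : ℕ} (hσ : 0 < σ) {T : ℕ → ℕ} {c x : ℕ}
    (hd : σ ^ nonSolid σ T x ∣ c + 1) (hx : ¬ (T x < σ ∨ letters σ T c x + 1 = σ)) :
    ¬ σ ^ nonSolid σ T (x + 1) ∣ c + 1 ∧ letters σ T (c + 1) x = letters σ T c x + 1 := by
  push Not at hx
  obtain ⟨h, hx⟩ := hx
  have hlt := letters_lt hσ T c x
  rw [letters, if_neg (by omega)] at hx hlt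
  have h2 : (c + 1) / σ ^ nonSolid σ T x = c / σ ^ nonSolid σ T x + 1 := by
    rw [Nat.succ_div, if_pos hd]
  have h3 : (c / σ ^ nonSolid σ T x + 1) % σ = c / σ ^ nonSolid σ T x % σ + 1 := by
    rw [Nat.add_mod, Nat.mod_eq_of_lt (show 1 < σ by omega)]
    exact Nat.mod_eq_of_lt (by omega)
  constructor
  · rw [nonSolid_succ, if_pos h, pow_succ]
    intro hdv
    have := Nat.dvd_div_of_mul_dvd hdv
    rw [h2, Nat.dvd_iff_mod_eq_zero, h3] at this
    omega
  · rw [letters, letters, if_neg (by omega), if_neg (by omega), h2, h3]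

theorem letters_of_not_dvd {σ : ℕ} {T : ℕ → ℕ} {c x y : ℕ}
    (hd : ¬ σ ^ nonSolid σ T x ∣ c + 1) (hxy : x ≤ y) :
    letters σ T (c + 1) y = letters σ T c y := by
  rw [letters, letters, Nat.succ_div, if_neg (c := σ ^ nonSolid σ T y ∣ c + 1), add_zero]
  exact fun h => hd ((pow_dvd_pow σ (nonSolid_mono σ T hxy)).trans h)

/-- Expansion in base `σ`, one digit for each non-solid position. The bound by the number of
non-solid symbols among the first `m` positions keeps the number of candidates down. -/
theorem exists_letters {σ : ℕ} (T f : ℕ → ℕ) :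
    ∀ m, (∀ x < m, f x < σ) → (∀ x < m, T x < σ → f x = T x) →
      ∃ c < σ ^ nonSolid σ T m, ∀ x < m, letters σ T c x = f x := by
  intro m
  induction m with
  | zero => exact fun _ _ => ⟨0, by simp [nonSolid], by simp⟩
  | succ m ih =>
    intro hf hT
    obtain ⟨c, hc, hl⟩ := ih (fun x hx => hf x (by omega)) fun x hx => hT x (by omega)
    have hfm := hf m (by omega)
    by_cases h : T m < σ
    · refine ⟨c, by rw [nonSolid_succ, if_neg (by omega)]; exact hc, fun x hx => ?_⟩
      rcases (Nat.lt_succ_iff.1 hx).lt_or_eq with h' | rfl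
      · exact hl x h'
      · rw [letters, if_pos h, hT x hx h]
    · have hpos : 0 < σ ^ nonSolid σ T m := Nat.pow_pos (by omega)
      refine ⟨c + f m * σ ^ nonSolid σ T m, ?_, fun x hx => ?_⟩
      · rw [nonSolid_succ, if_pos (by omega), pow_succ]
        have : (f m + 1) * σ ^ nonSolid σ T m ≤ σ * σ ^ nonSolid σ T m :=
          Nat.mul_le_mul_right _ hfm
        rw [mul_comm _ σ]
        rw [add_mul, one_mul] at this
        omega
      · rcases (Nat.lt_succ_iff.1 hx).lt_or_eq with h' | rfl
        · rw [← hl x h', letters, letters]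
          split_ifs with hx'
          · rfl
          · have hle : nonSolid σ T x + 1 ≤ nonSolid σ T m := by
              have := nonSolid_mono σ T (show x + 1 ≤ m by omega)
              rwa [nonSolid_succ, if_pos (by omega)] at this
            obtain ⟨e, he⟩ := pow_dvd_pow σ hle
            rw [he, pow_succ, show f m * (σ ^ nonSolid σ T x * σ * e) =
              σ ^ nonSolid σ T x * (σ * (f m * e)) by ring,
              Nat.add_mul_div_left _ _ (Nat.pow_pos (by omega)), Nat.add_mul_mod_self_left]
        · rw [letters, if_neg h, Nat.add_mul_div_right _ _ hpos, Nat.div_eq_of_lt hc, zero_add,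
            Nat.mod_eq_of_lt hfm]

/-- Set `ell` to the length of the longest prefix of the text with at most `k / 2`
non-solid symbols. -/
def findEll : Cmd :=
  .assign .i 0 ;; .assign .cnt 0 ;; .assign .ell 0 ;;
  .loop (.lt ♯.i ♯.n)
    (.branch (.lt (.arr .txt ♯.i) ♯.sigma) .skip (.assign .cnt (♯.cnt + 1)) ;;
      .assign .i (♯.i + 1) ;;
      .branch (.lt ♯.k (♯.cnt + ♯.cnt)) .skip (.assign .ell ♯.i))

/-- Write the first candidate. -/
def initCandidate : Cmd :=
  .assign .i 0 ;;
  .loop (.lt ♯.i ♯.ell)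
    (.branch (.lt (.arr .txt ♯.i) ♯.sigma) (.store .wrd ♯.i (.arr .txt ♯.i)) (.store .wrd ♯.i 0) ;;
      .assign .i (♯.i + 1))

/-- Append the text. -/
def appendText : Cmd :=
  .assign .i 0 ;;
  .loop (.lt ♯.i ♯.n) (.store .wrd (♯.ell + ♯.i) (.arr .txt ♯.i) ;; .assign .i (♯.i + 1)) ;;
  .assign .lim ♯.ell ;; .assign .len (♯.ell + ♯.n)

/-- Skip the solid positions and those of the largest letter, which is set back. -/
def carry : Cmd :=
  .assign .i 0 ;;
  .loop (.and (.lt ♯.i ♯.ell) (.not (.and (.not (.lt (.arr .txt ♯.i) ♯.sigma))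
      (.not (.eq (.arr .wrd ♯.i + 1) ♯.sigma)))))
    (.branch (.lt (.arr .txt ♯.i) ♯.sigma) .skip (.store .wrd ♯.i 0) ;; .assign .i (♯.i + 1))

/-- Go to the next candidate. -/
def nextCandidate : Cmd :=
  carry ;; .branch (.lt ♯.i ♯.ell) (.store .wrd ♯.i (.arr .wrd ♯.i + 1)) (.assign .go 0)

/-- Try all candidates of a length `ell`. -/
def shortPhase : Cmd :=
  findEll ;; initCandidate ;; appendText ;; .assign .go 1 ;;
  .loop (.eq ♯.go 1) (selfPref ;; checkPrefixes ;; nextCandidate)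

/-- The memory holds a candidate, followed by the text. -/
structure IsCandidate (σ : ℕ) (T : ℕ → ℕ) (n ell c : ℕ) (W : ℕ → ℕ) : Prop where
  letter : ∀ i < ell, W i = letters σ T c i
  text : ∀ i < n, W (ell + i) = T i

/-- The candidate consists of letters only, so putting it in front of the text does not increase the
number of non-solid symbols that governs the cost of the mismatch table. -/
theorem IsCandidate.nonSolid {σ : ℕ} (hσ : 0 < σ) {T W : ℕ → ℕ} {n ell c : ℕ}
    (h : IsCandidate σ T n ell c W) : nonSolid σ W (ell + n) = nonSolid σ T n := by
  rw [WordRAM.nonSolid, Finset.sum_range_add, Finset.sum_eq_zero, zero_add]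
  · exact Finset.sum_congr rfl fun i hi => by rw [h.text i (Finset.mem_range.1 hi)]
  · intro i hi
    rw [h.letter i (Finset.mem_range.1 hi), if_neg (by have := letters_lt hσ T c i; omega)]

/-- The memory holds the text `T`. -/
structure HasText (E : Env) (n σ k : ℕ) (T : ℕ → ℕ) (st : Store) : Prop where
  base : Base E n σ k st
  txt : st.a .txt = T
  code : ∀ i < n, T i < σ + k
  count : nonSolid σ T n = k

theorem HasText.same {E : Env} {n σ k : ℕ} {T : ℕ → ℕ} {p : Cmd} {st st' : Store}
    (h : HasText E n σ k T st) (hs : Same p st st')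
    (hx : ∀ x ∈ [Var.n, .sigma, .k, .base], x ∉ p.vars := by decide)
    (ht : Arr.txt ∉ p.arrs := by decide) : HasText E n σ k T st' :=
  ⟨h.base.same hs hx, (hs.2 _ ht).trans h.txt, h.code, h.count⟩

section
variable {E : Env} {n σ k : ℕ} {st : Store} {c : ℕ} {T : ℕ → ℕ}

theorem run_findEll (hE : Fits E n σ k) (ht : HasText E n σ k T st) {K : ℕ}
    (hc : 6 * n + 4 + K ≤ c) :
    Run E findEll st c fun st' c' => st'.r .ell ≤ n ∧ 2 * nonSolid σ T (st'.r .ell) ≤ k ∧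
      (∀ m ≤ n, 2 * nonSolid σ T m ≤ k → m ≤ st'.r .ell) ∧ K ≤ c' := by
  have hM := hE.hM
  have hD := hE.hD
  have hk := hE.k_le
  simp only [findEll, run_seq, run_assign, AExp.ok_zero, AExp.val_zero]
  refine ⟨by omega, by omega, by omega, by omega, by omega, by omega, ?_⟩
  apply Run.loop fun st' c' => st'.r .i ≤ n ∧ st'.r .cnt = nonSolid σ T (st'.r .i) ∧
    st'.r .ell ≤ st'.r .i ∧ 2 * nonSolid σ T (st'.r .ell) ≤ k ∧
    (∀ m ≤ st'.r .i, 2 * nonSolid σ T m ≤ k → m ≤ st'.r .ell) ∧ 6 * (n - st'.r .i) + 1 + K ≤ c'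
  · simp [nonSolid]; omega
  · rintro st' c' ⟨h1, h2, h3, h4, h5, h6⟩ hs
    have ht' : HasText E n σ k T st' := HasText.same
      (st := ((st.set .i 0).set .cnt 0).set .ell 0)
      ⟨⟨ht.base.n, ht.base.sigma, ht.base.k, ht.base.base⟩, ht.txt, ht.code, ht.count⟩ hs
    have hmono : nonSolid σ T (st'.r .i) ≤ k := ht.count ▸ nonSolid_mono σ T h1
    simp only [BExp.ok_lt, BExp.val_lt, AExp.ok_var, AExp.val_var, ht'.base.n, true_and, run_seq,
      run_branch, run_skip, run_assign, AExp.ok_arr, AExp.val_arr, ht'.txt, ht'.base.sigma,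
      ht'.base.base, AExp.ok_add, AExp.val_add, AExp.ok_one, AExp.val_one, and_true, Store.set_r,
      if_true, reduceCtorEq, if_false, ht'.base.k, Store.set_a, h2]
    have hns := nonSolid_succ σ T (st'.r .i)
    have stay : k < nonSolid σ T (st'.r .i + 1) + nonSolid σ T (st'.r .i + 1) →
        ∀ m ≤ st'.r .i + 1, 2 * nonSolid σ T m ≤ k → m ≤ st'.r .ell := by
      intro h m hm hm2
      rcases hm.lt_or_eq with h' | rfl
      · exact h5 m (by omega) hm2
      · omega
    have hmono' : st'.r .i < n → nonSolid σ T (st'.r .i + 1) ≤ k :=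
      fun h => ht.count ▸ nonSolid_mono σ T h
    refine ⟨by omega, fun hi => ⟨by omega, by omega, ?_, ?_⟩, fun hi => ⟨by omega, h4,
      fun m hm => h5 m (by omega), by omega⟩⟩
    · intro hsol
      rw [if_neg (by omega), add_zero] at hns
      rw [← hns]
      exact ⟨by omega, ⟨by omega, by omega⟩, by omega, by have := hmono' hi; omega, by omega,
        fun h => ⟨by omega, by omega, rfl, by omega, h4, stay h, by omega⟩,
        fun h => ⟨by omega, by omega, rfl, by omega, by omega, fun m hm _ => hm, by omega⟩⟩
    · intro hsol
      rw [if_pos (by omega)] at hns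
      rw [← hns]
      have := hmono' hi
      exact ⟨⟨by omega, by omega⟩, by omega, ⟨by omega, by omega⟩, by omega, by omega,
        by omega,
        fun h => ⟨by omega, by omega, rfl, by omega, h4, stay h, by omega⟩,
        fun h => ⟨by omega, by omega, rfl, by omega, by omega, fun m hm _ => hm, by omega⟩⟩

theorem run_initCandidate (hE : Fits E n σ k) (ht : HasText E n σ k T st) {ell : ℕ}
    (hell : st.r .ell = ell) (hle : ell ≤ n) {K : ℕ} (hc : 4 * n + 2 + K ≤ c) :
    Run E initCandidate st c fun st' c' =>
      (∀ i < ell, st'.a .wrd i = letters σ T 0 i) ∧ K ≤ c' := by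
  have hM := hE.hM
  have hD := hE.hD
  simp only [initCandidate, run_seq, run_assign, AExp.ok_zero, AExp.val_zero]
  refine ⟨by omega, by omega, ?_⟩
  apply Run.loop fun st' c' => st'.r .i ≤ ell ∧
    (∀ i < st'.r .i, st'.a .wrd i = letters σ T 0 i) ∧ 4 * (ell - st'.r .i) + 1 + K ≤ c'
  · simp; omega
  · rintro st' c' ⟨h1, h2, h3⟩ hs
    have ht' : HasText E n σ k T st' := HasText.same (st := st.set .i 0)
      ⟨⟨ht.base.n, ht.base.sigma, ht.base.k, ht.base.base⟩, ht.txt, ht.code, ht.count⟩ hs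
    have hell' : st'.r .ell = ell := (hs.1 .ell (by decide)).trans hell
    have key : ∀ x, x = letters σ T 0 (st'.r .i) → ∀ i < st'.r .i + 1,
        Function.update (st'.a .wrd) (st'.r .i) x i = letters σ T 0 i := by
      intro x hx i hi
      rw [Function.update_apply]
      split_ifs with h
      · rw [hx, h]
      · exact h2 i (by omega)
    simp only [BExp.ok_lt, BExp.val_lt, AExp.ok_var, AExp.val_var, hell', true_and, run_seq,
      run_branch, run_store, run_assign, AExp.ok_arr, AExp.val_arr, ht'.txt, ht'.base.sigma,
      ht'.base.base, AExp.ok_add, AExp.val_add, AExp.ok_one, AExp.val_one, and_true, Store.set_r,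
      if_true, reduceCtorEq, if_false, Store.set_a, Store.put_r, Store.put_a, AExp.ok_zero,
      AExp.val_zero]
    exact ⟨by omega, fun hi => ⟨by omega, by omega, fun hsol => ⟨by omega, by omega, by omega,
      by omega, by omega, key _ (by simp [letters, hsol]), by omega⟩, fun hsol => ⟨by omega,
      by omega, by omega, by omega, by omega, key _ (by simp [letters, hsol]), by omega⟩⟩,
      fun hi => ⟨fun i hi' => h2 i (by omega), by omega⟩⟩

theorem run_appendText (hE : Fits E n σ k) (ht : HasText E n σ k T st) {ell : ℕ}
    (hell : st.r .ell = ell) (hle : ell ≤ n)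
    (hw : ∀ i < ell, st.a .wrd i = letters σ T 0 i) {K : ℕ} (hc : 3 * n + 4 + K ≤ c) :
    Run E appendText st c fun st' c' => IsCandidate σ T n ell 0 (st'.a .wrd) ∧
      st'.r .lim = ell ∧ st'.r .len = ell + n ∧ K ≤ c' := by
  have hM := hE.hM
  have hD := hE.hD
  simp only [appendText, run_seq, run_assign, AExp.ok_zero, AExp.val_zero]
  refine ⟨by omega, by omega, ?_⟩
  apply Run.loop fun st' c' => st'.r .i ≤ n ∧
    (∀ i < ell, st'.a .wrd i = letters σ T 0 i) ∧
    (∀ i < st'.r .i, st'.a .wrd (ell + i) = T i) ∧ 3 * (n - st'.r .i) + 3 + K ≤ c'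
  · simp; exact ⟨hw, by omega⟩
  · rintro st' c' ⟨h1, h2, h3, h4⟩ hs
    have ht' : HasText E n σ k T st' := HasText.same (st := st.set .i 0)
      ⟨⟨ht.base.n, ht.base.sigma, ht.base.k, ht.base.base⟩, ht.txt, ht.code, ht.count⟩ hs
    have hell' : st'.r .ell = ell := (hs.1 .ell (by decide)).trans hell
    simp only [BExp.ok_lt, BExp.val_lt, AExp.ok_var, AExp.val_var, hell', true_and, run_seq,
      run_store, run_assign, AExp.ok_arr, AExp.val_arr, ht'.txt, ht'.base.n,
      ht'.base.base, AExp.ok_add, AExp.val_add, AExp.ok_one, AExp.val_one, and_true, Store.set_r,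
      if_true, reduceCtorEq, if_false, Store.set_a, Store.put_r, Store.put_a]
    refine ⟨by omega, fun hi => ⟨by omega, by omega, by omega, by omega, by omega, fun i hi' => ?_,
      fun i hi' => ?_, by omega⟩, fun hi => ⟨by omega, by omega, by omega,
        ⟨h2, fun i hi' => h3 i (by omega)⟩, by omega⟩⟩
    · rw [Function.update_apply, if_neg (by omega)]
      exact h2 i hi'
    · rw [Function.update_apply]
      split_ifs with h
      · rw [show i = st'.r .i by omega]
      · exact h3 i (by omega)

/-- Incrementing a number in base `σ`: the divisibility in the invariant says that the carry is
still alive at the current position. A plain linear bound for each increment is enough, since every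
candidate costs at least linear time anyway. -/
theorem run_carry (hE : Fits E n σ k) (ht : HasText E n σ k T st) {ell x : ℕ}
    (hell : st.r .ell = ell) (hle : ell ≤ n) (hw : IsCandidate σ T n ell x (st.a .wrd)) {K : ℕ}
    (hc : 4 * n + 2 + K ≤ c) :
    Run E carry st c fun st' c' => st'.r .i ≤ ell ∧
      σ ^ nonSolid σ T (st'.r .i) ∣ x + 1 ∧
      (st'.r .i < ell → ¬ (T (st'.r .i) < σ ∨ letters σ T x (st'.r .i) + 1 = σ)) ∧
      (∀ y < st'.r .i, st'.a .wrd y = letters σ T (x + 1) y) ∧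
      (∀ y, st'.r .i ≤ y → st'.a .wrd y = st.a .wrd y) ∧ K ≤ c' := by
  have hM := hE.hM
  have hD := hE.hD
  have h2σ := hE.two_le
  have hσn := hE.le_n
  have hσ : 0 < σ := by omega
  simp only [carry, run_seq, run_assign, AExp.ok_zero, AExp.val_zero]
  refine ⟨by omega, by omega, ?_⟩
  apply Run.loop fun st' c' => st'.r .i ≤ ell ∧
      σ ^ nonSolid σ T (st'.r .i) ∣ x + 1 ∧
      (∀ y < st'.r .i, st'.a .wrd y = letters σ T (x + 1) y) ∧
      (∀ y, st'.r .i ≤ y → st'.a .wrd y = st.a .wrd y) ∧ 4 * (ell - st'.r .i) + 1 + K ≤ c'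
  · simp [nonSolid]; omega
  · rintro st' c' ⟨h1, h2, h3, h4, h5⟩ hs
    have ht' : HasText E n σ k T st' := HasText.same (st := st.set .i 0)
      ⟨⟨ht.base.n, ht.base.sigma, ht.base.k, ht.base.base⟩, ht.txt, ht.code, ht.count⟩ hs
    have hell' : st'.r .ell = ell := (hs.1 .ell (by decide)).trans hell
    have hcur := h4 (st'.r .i) le_rfl
    -- A conjunction evaluates both its parts, so the cell at `i = ell` is read as well. It holds
    -- the first symbol of the text, which bounds it and excludes an overflow.
    have hwi : st.a .wrd (st'.r .i) < σ + k ∨ n = 0 := by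
      rcases Nat.lt_or_ge (st'.r .i) ell with h | h
      · left; rw [hw.letter _ h]; have := letters_lt hσ T x (st'.r .i); omega
      · rcases Nat.eq_zero_or_pos n with h0 | h0
        · exact Or.inr h0
        · left
          have := hw.text 0 h0
          rw [add_zero] at this
          rw [show st'.r .i = ell by omega, this]
          exact ht.code 0 h0
    have hk := hE.k_le
    simp only [BExp.ok_lt, BExp.val_lt, BExp.ok_and, BExp.val_and, BExp.ok_not, BExp.val_not,
      BExp.ok_eq, BExp.val_eq, AExp.ok_var, AExp.val_var, hell', true_and, run_seq,
      run_branch, run_skip, run_store, run_assign, AExp.ok_arr, AExp.val_arr, ht'.txt,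
      ht'.base.sigma, ht'.base.base, AExp.ok_add, AExp.val_add, AExp.ok_one, AExp.val_one, and_true,
      Store.set_r, if_true, reduceCtorEq, if_false, Store.set_a, Store.put_r, Store.put_a,
      AExp.ok_zero, AExp.val_zero, hcur]
    refine ⟨by omega, by omega, ?_, ?_⟩
    · rintro ⟨hi, hcond⟩
      rw [hw.letter _ hi] at hcond
      obtain ⟨g1, g2⟩ := letters_carry hσ (x := st'.r .i) h2 (by tauto)
      refine ⟨by omega, by omega, fun hsol => ⟨by omega, by omega, by omega, by omega, g1,
        fun y hy => ?_, fun y hy => h4 y (by omega), by omega⟩, fun hsol => ⟨by omega, by omega,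
        by omega, by omega, by omega, g1, fun y hy => ?_, fun y hy => ?_, by omega⟩⟩
      · rcases (Nat.lt_succ_iff.1 hy).lt_or_eq with h | rfl
        · exact h3 y h
        · rw [hcur, hw.letter _ hi, g2, if_pos hsol]
      · rw [Function.update_apply]
        split_ifs with h
        · rw [h, g2, if_neg hsol]
        · exact h3 y (by omega)
      · rw [Function.update_apply, if_neg (by omega)]
        exact h4 y (by omega)
    · intro hexit
      refine ⟨h1, h2, fun hi => ?_, h3, h4, by omega⟩
      rw [hw.letter _ hi] at hexit
      tauto

theorem run_nextCandidate (hE : Fits E n σ k) (ht : HasText E n σ k T st) {ell x : ℕ}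
    (hell : st.r .ell = ell) (hle : ell ≤ n) (hw : IsCandidate σ T n ell x (st.a .wrd))
    (hx : x < σ ^ nonSolid σ T ell) (hgo : st.r .go = 1) {K : ℕ} (hc : 4 * n + 4 + K ≤ c) :
    Run E nextCandidate st c fun st' c' =>
      (st'.r .go = 1 ∧ x + 1 < σ ^ nonSolid σ T ell ∧
          IsCandidate σ T n ell (x + 1) (st'.a .wrd) ∨
        st'.r .go = 0 ∧ x + 1 = σ ^ nonSolid σ T ell) ∧ K ≤ c' := by
  have hM := hE.hM
  have hD := hE.hD
  have h2σ := hE.two_le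
  have hσ : 0 < σ := by omega
  have hσn := hE.le_n
  simp only [nextCandidate, run_seq]
  refine (run_carry hE ht hell hle hw (K := 2 + K) (by omega)).mono ?_
  rintro s d ⟨h1, h2, h3, h4, h5, h6⟩ hs
  have hts := ht.same hs
  have hells := (hs.1 .ell (by decide)).trans hell
  have hgos := (hs.1 .go (by decide)).trans hgo
  simp only [run_branch, run_store, run_assign, BExp.ok_lt, BExp.val_lt, AExp.ok_var, AExp.val_var,
    AExp.ok_arr, AExp.val_arr, AExp.ok_add, AExp.val_add, AExp.ok_one, AExp.val_one, hells,
    hts.base.base, Store.put_r, Store.put_a, Store.set_r, Store.set_a, if_true, true_and,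
    AExp.ok_zero, AExp.val_zero, hgos, h5 _ le_rfl]
  refine ⟨by omega, fun hi => ?_, fun hi => ⟨by omega, by omega, Or.inr ?_, by omega⟩⟩
  · have hlt := letters_lt hσ T x (s.r .i)
    obtain ⟨g1, g2⟩ := letters_stop hσ h2 (h3 hi)
    rw [hw.letter _ hi]
    refine ⟨by omega, by omega, Or.inl ⟨?_, ⟨fun y hy => ?_, fun y hy => ?_⟩⟩, by omega⟩
    · rcases (Nat.succ_le_of_lt hx).lt_or_eq with h | h
      · exact h
      · exfalso
        apply g1
        rw [show x + 1 = σ ^ nonSolid σ T ell from h]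
        exact pow_dvd_pow σ (nonSolid_mono σ T hi)
    · rw [Function.update_apply]
      split_ifs with h
      · rw [h, g2]
      · rcases lt_or_gt_of_ne h with h' | h'
        · exact h4 y h'
        · rw [h5 y h'.le, hw.letter y hy]
          exact (letters_of_not_dvd g1 h').symm
    · rw [Function.update_apply, if_neg (by omega), h5 _ (by omega)]
      exact hw.text y hy
  · rw [show s.r .i = ell by omega] at h2
    -- The carry has left the last digit, so `x` was the last candidate.
    have := Nat.le_of_dvd (by omega) h2
    omega

/-- The number of basic steps for one candidate. -/
def candidateCost (n k : ℕ) : ℕ := selfPrefCost (2 * n) k 0 + checkCost n + (4 * n + 4) + 1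

/-- The number of basic steps of `shortPhase`. -/
def shortCost (n σ k h : ℕ) : ℕ := 13 * n + 12 + σ ^ h * candidateCost n k

theorem selfPrefCost_mono {L L' N Z : ℕ} (h : L ≤ L') :
    selfPrefCost L N Z ≤ selfPrefCost L' N Z := by
  unfold selfPrefCost
  gcongr

/-- A cover of a length `m` with few non-solid symbols in the prefix has `m ≤ ell` by maximality of
`ell`. It occurs at the start of the text, hence agrees with it at the solid positions and is a
prefix of some candidate; all prefixes of all candidates are checked. -/
theorem run_shortPhase (hE : Fits E n σ k) (ht : HasText E n σ k T st) {b : ℕ}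
    (hb : st.r .blen = b) (hb1 : 1 ≤ b) (hbn : b ≤ n) (hbest : Covers E n σ T (st.a .best) b)
    {h : ℕ} (hh : h = k / 2) {K : ℕ} (hc : shortCost n σ k h + K ≤ c) :
    Run E shortPhase st c fun st' c' => 1 ≤ st'.r .blen ∧ st'.r .blen ≤ b ∧
      Covers E n σ T (st'.a .best) (st'.r .blen) ∧
      (∀ m f, m ≤ n → 2 * nonSolid σ T m ≤ k → Covers E n σ T f m → st'.r .blen ≤ m) ∧
      K ≤ c' := by
  have hM := hE.hM
  have hD := hE.hD
  have h2σ := hE.two_le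
  have hσ : 0 < σ := by omega
  have hσn := hE.le_n
  rw [shortCost] at hc
  simp only [shortPhase, run_seq]
  refine (run_findEll hE ht (K := 7 * n + 8 + σ ^ h * candidateCost n k + K) (by omega)).mono ?_
  rintro s1 c1 ⟨hle, hns, hmax, hc1⟩ hs1
  have ht1 := ht.same hs1
  refine (run_initCandidate hE ht1 rfl hle (K := 3 * n + 6 + σ ^ h * candidateCost n k + K)
    (by omega)).mono ?_
  rintro s2 c2 ⟨hw2, hc2⟩ hs2
  have ht2 := ht1.same hs2
  have hell2 : s2.r .ell = s1.r .ell := hs2.1 .ell (by decide)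
  refine (run_appendText hE ht2 hell2 hle hw2 (K := 2 + σ ^ h * candidateCost n k + K)
    (by omega)).mono ?_
  rintro s3 c3 ⟨hw3, hlim3, hlen3, hc3⟩ hs3
  have ht3 := ht2.same hs3
  have hell3 : s3.r .ell = s1.r .ell := (hs3.1 .ell (by decide)).trans hell2
  have hb3 : s3.r .blen = b := (hs3.1 .blen (by decide)).trans
    ((hs2.1 .blen (by decide)).trans ((hs1.1 .blen (by decide)).trans hb))
  have hbest3 : s3.a .best = st.a .best := (hs3.2 .best (by decide)).trans
    ((hs2.2 .best (by decide)).trans (hs1.2 .best (by decide)))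
  generalize s1.r .ell = ell at *
  simp only [run_assign, AExp.ok_one, AExp.val_one]
  refine ⟨by omega, by omega, ?_⟩
  have hX : selfPrefCost (ell + n) k 0 ≤ selfPrefCost (2 * n) k 0 := selfPrefCost_mono (by omega)
  have hpow : σ ^ nonSolid σ T ell ≤ σ ^ h := Nat.pow_le_pow_right hσ (by omega)
  apply Run.loop fun st' c' => 1 ≤ st'.r .blen ∧ st'.r .blen ≤ b ∧
    Covers E n σ T (st'.a .best) (st'.r .blen) ∧ ∃ x ≤ σ ^ nonSolid σ T ell,
      (∀ y < x, ∀ m, 1 ≤ m → m ≤ ell → Covers E n σ T (letters σ T y) m → st'.r .blen ≤ m) ∧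
      (st'.r .go = 1 ∧ x < σ ^ nonSolid σ T ell ∧ IsCandidate σ T n ell x (st'.a .wrd) ∧
          st'.r .lim = ell ∧ st'.r .len = ell + n ∨
        st'.r .go = 0 ∧ x = σ ^ nonSolid σ T ell) ∧
      (σ ^ h - x) * candidateCost n k + 1 + K ≤ c'
  · simp only [Store.set_r, Store.set_a, reduceCtorEq, if_false, if_true, hb3, hbest3]
    refine ⟨hb1, le_rfl, hbest, 0, Nat.zero_le _, fun y hy => by omega, Or.inl ⟨trivial,
      Nat.pow_pos hσ, hw3, hlim3, hlen3⟩, ?_⟩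
    simp only [Nat.sub_zero]
    omega
  · rintro st' c' ⟨h1, h2, h3, x, h4, h5, h6, h7⟩ hs
    have ht' : HasText E n σ k T st' := HasText.same (st := s3.set .go 1)
      ⟨⟨ht3.base.n, ht3.base.sigma, ht3.base.k, ht3.base.base⟩, ht3.txt, ht3.code, ht3.count⟩ hs
    have hell' : st'.r .ell = ell := (hs.1 .ell (by decide)).trans hell3
    simp only [BExp.ok_eq, BExp.val_eq, AExp.ok_var, AExp.val_var, AExp.ok_one, AExp.val_one,
      run_seq, true_and]
    refine ⟨by omega, by omega, fun hgo => ?_, fun hgo => ?_⟩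
    · obtain ⟨-, hx, hcand, hlim', hlen'⟩ := h6.resolve_right (by omega)
      have hcred : (σ ^ h - x) * candidateCost n k =
          (σ ^ h - (x + 1)) * candidateCost n k + candidateCost n k := by
        rw [← Nat.succ_mul]
        congr 1
        omega
      rw [hcred] at h7
      have hcc : candidateCost n k =
        selfPrefCost (2 * n) k 0 + checkCost n + (4 * n + 4) + 1 := rfl
      have hw' : HasWord E n σ k (st'.a .wrd) (ell + n) st' := by
        refine ⟨ht'.base, rfl, hlen', by omega, fun i hi => ?_⟩
        rcases Nat.lt_or_ge i ell with h' | h'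
        · rw [hcand.letter i h']
          have := letters_lt hσ T x i
          omega
        · obtain ⟨j, rfl⟩ := Nat.exists_eq_add_of_le h'
          rw [hcand.text j (by omega)]
          exact ht.code j (by omega)
      refine (run_selfPref (Z := 0) (c := c' - 1) (K := (σ ^ h - (x + 1)) * candidateCost n k +
        checkCost n + (4 * n + 4) + 1 + K) hE hw' hlim' ?_ ?_).mono ?_
      · intro q _ y _ _ hmin hq hy
        exfalso
        rcases min_lt_iff.1 hmin with h' | h'
        · rw [hcand.letter q h'] at hq
          have := letters_lt hσ T x q
          omega
        · rw [hcand.letter y h'] at hy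
          have := letters_lt hσ T x y
          omega
      · rw [hcand.nonSolid hσ, ht.count]
        omega
      rintro s4 c4 ⟨hpre, hc4⟩ hs4
      have hw4 := hw'.same hs4
      have hell4 := (hs4.1 .ell (by decide)).trans hell'
      have hb4 : s4.r .blen = st'.r .blen := hs4.1 .blen (by decide)
      have hbest4 : s4.a .best = st'.a .best := hs4.2 .best (by decide)
      refine (run_checkPrefixes (K := (σ ^ h - (x + 1)) * candidateCost n k + (4 * n + 4) + 1 + K)
        hE hw4 hell4 hle hcand.letter (fun i _ => letters_lt hσ T x i) hcand.text hpre hb4 h1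
        (h2.trans hbn) (hbest4 ▸ h3) (by omega)).mono ?_
      rintro s5 c5 ⟨hb5, hb5', hcov5, hmin5, hc5⟩ hs5
      have ht5 := (ht'.same hs4).same hs5
      have hwrd5 : s5.a .wrd = st'.a .wrd := (hs5.2 .wrd (by decide)).trans (hs4.2 .wrd (by decide))
      have hlim5 : s5.r .lim = ell :=
        (hs5.1 .lim (by decide)).trans ((hs4.1 .lim (by decide)).trans hlim')
      have hlen5 : s5.r .len = ell + n :=
        (hs5.1 .len (by decide)).trans ((hs4.1 .len (by decide)).trans hlen')
      have hgo5 : s5.r .go = 1 :=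
        (hs5.1 .go (by decide)).trans ((hs4.1 .go (by decide)).trans hgo)
      refine (run_nextCandidate (x := x) (K := (σ ^ h - (x + 1)) * candidateCost n k + 1 + K) hE ht5
        ((hs5.1 .ell (by decide)).trans hell4) hle (hwrd5 ▸ hcand) hx hgo5 (by omega)).mono ?_
      rintro s6 c6 ⟨hnext, hc6⟩ hs6
      have hb6 : s6.r .blen = s5.r .blen := hs6.1 .blen (by decide)
      have hbest6 : s6.a .best = s5.a .best := hs6.2 .best (by decide)
      have hlim6 := (hs6.1 .lim (by decide)).trans hlim5
      have hlen6 := (hs6.1 .len (by decide)).trans hlen5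
      rw [hb6, hbest6]
      refine ⟨hb5, hb5'.trans h2, hcov5, x + 1, hx, fun y hy m hm hml hcm => ?_, ?_, hc6⟩
      · rcases (Nat.lt_succ_iff.1 hy).lt_or_eq with h' | rfl
        · exact hb5'.trans (h5 y h' m hm hml hcm)
        · exact hmin5 m hm hml hcm
      · rcases hnext with ⟨g1, g2, g3⟩ | ⟨g1, g2⟩
        · exact Or.inl ⟨g1, g2, g3, hlim6, hlen6⟩
        · exact Or.inr ⟨g1, g2⟩
    · obtain ⟨-, hx⟩ := h6.resolve_left fun h' => hgo h'.1
      refine ⟨h1, h2, h3, fun m f hmn hm2 hcov => ?_, by omega⟩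
      have hml := hmax m hmn hm2
      obtain ⟨j0, hj0, hj0m, -, hocc⟩ := hcov.2 0 (by omega)
      obtain rfl : j0 = 0 := by omega
      have hfT : ∀ x < m, T x < σ → f x = T x := by
        intro x hx hsol
        have := hocc x hx
        rw [Nat.zero_add, has_solid hsol] at this
        exact this.symm
      obtain ⟨y, hy, hyf⟩ := exists_letters T f m hcov.1 hfT
      -- The number `y` uses only digits for positions below `m`, so it is also the number of a
      -- candidate of the full length `ell`.
      refine h5 y ?_ m (by omega) hml ⟨fun i _ => letters_lt hσ T y i, fun i hi => ?_⟩
      · rw [hx]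
        exact hy.trans_le (Nat.pow_le_pow_right hσ (nonSolid_mono σ T hml))
      · obtain ⟨j, g1, g2, g3, g4⟩ := hcov.2 i hi
        exact ⟨j, g1, g2, g3, fun z hz => by rw [hyf z hz]; exact g4 z hz⟩

end
/-! ## Long covers -/

/-- Take the text as the word. -/
def copyText : Cmd :=
  .assign .i 0 ;;
  .loop (.lt ♯.i ♯.n) (.store .wrd ♯.i (.arr .txt ♯.i) ;; .assign .i (♯.i + 1)) ;;
  .assign .lim ♯.n ;; .assign .len ♯.n

/-- Find the largest shift up to `n / 2` for which the text matches itself. -/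
def findShift : Cmd :=
  .assign .shift 0 ;; .assign .p 0 ;;
  .loop (.not (.lt ♯.n (♯.p + ♯.p)))
    (.branch (.eq (.arr .pre ♯.p + ♯.p) ♯.n) (.assign .shift ♯.p) .skip ;; .assign .p (♯.p + 1))

/-- Write the cover of length `n - shift`. -/
def writeCover : Cmd :=
  .assign .blen (♯.n - ♯.shift) ;; .assign .i 0 ;;
  .loop (.lt ♯.i ♯.blen)
    (.assign .u (.arr .txt ♯.i) ;; .assign .v (.arr .txt (♯.i + ♯.shift)) ;; common ;;
      .store .best ♯.i ♯.c ;; .assign .i (♯.i + 1))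

/-- Compute the shortest cover of length at least `n / 2`. -/
def longPhase : Cmd := copyText ;; selfPref ;; findShift ;; writeCover

/-- The number of basic steps of `longPhase`. -/
def longCost (n σ k : ℕ) : ℕ := selfPrefCost n k (2 * σ) + 17 * n + k * (2 * σ) + 14

section
variable {E : Env} {n σ k : ℕ} {st : Store} {c : ℕ} {T : ℕ → ℕ}

theorem run_copyText (hE : Fits E n σ k) (ht : HasText E n σ k T st) {K : ℕ}
    (hc : 3 * n + 4 + K ≤ c) :
    Run E copyText st c fun st' c' => (∀ i < n, st'.a .wrd i = T i) ∧
      st'.r .lim = n ∧ st'.r .len = n ∧ K ≤ c' := by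
  have hM := hE.hM
  have hD := hE.hD
  simp only [copyText, run_seq, run_assign, AExp.ok_zero, AExp.val_zero]
  refine ⟨by omega, by omega, ?_⟩
  apply Run.loop fun st' c' => st'.r .i ≤ n ∧
    (∀ i < st'.r .i, st'.a .wrd i = T i) ∧ 3 * (n - st'.r .i) + 3 + K ≤ c'
  · simp; omega
  · rintro st' c' ⟨h1, h3, h4⟩ hs
    have ht' : HasText E n σ k T st' := HasText.same (st := st.set .i 0)
      ⟨⟨ht.base.n, ht.base.sigma, ht.base.k, ht.base.base⟩, ht.txt, ht.code, ht.count⟩ hs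
    simp only [BExp.ok_lt, BExp.val_lt, AExp.ok_var, AExp.val_var, true_and, run_seq,
      run_store, run_assign, AExp.ok_arr, AExp.val_arr, ht'.txt, ht'.base.n,
      ht'.base.base, AExp.ok_add, AExp.val_add, AExp.ok_one, AExp.val_one, and_true, Store.set_r,
      if_true, reduceCtorEq, if_false, Store.set_a, Store.put_r, Store.put_a]
    refine ⟨by omega, fun hi => ⟨by omega, by omega, by omega, by omega, by omega, fun i hi' => ?_,
      by omega⟩, fun hi => ⟨by omega, by omega, fun i hi' => h3 i (by omega), by omega⟩⟩
    rw [Function.update_apply]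
    split_ifs with h
    · rw [h]
    · exact h3 i (by omega)

theorem run_findShift (hE : Fits E n σ k) (hB : Base E n σ k st)
    (hne : ∀ i < n, ∃ x, Has E n σ (T i) x) {W : ℕ → ℕ} (hW : ∀ i < n, W i = T i)
    (hpre : IsPref E n σ W n n (st.a .pre)) {K : ℕ} (hc : 4 * n + 7 + K ≤ c) :
    Run E findShift st c fun st' c' => 2 * st'.r .shift ≤ n ∧
      (∀ i, i + st'.r .shift < n → Mt E n σ (T i) (T (i + st'.r .shift))) ∧
      (∀ p, 2 * p ≤ n → (∀ i, i + p < n → Mt E n σ (T i) (T (i + p))) → p ≤ st'.r .shift) ∧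
      K ≤ c' := by
  have hM := hE.hM
  have hD := hE.hD
  have h2σ := hE.two_le
  have hσn := hE.le_n
  have hself : ∀ i < n, Mt E n σ (T i) (T i) := fun i hi =>
    let ⟨x, hx⟩ := hne i hi
    ⟨x, hx, hx⟩
  -- The shift `0` is not covered by `IsPref.first`; there the text matches itself because its
  -- symbols are nonempty. So the search always has the shift `0`, that is, a cover of length `n`,
  -- to fall back on.
  have key : ∀ p < n, st.a .pre p + p = n ↔ ∀ i, i + p < n → Mt E n σ (T i) (T (i + p)) := by
    intro p hp
    obtain ⟨h1, h2⟩ := hpre.sound p hp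
    constructor
    · intro h i hi
      rcases Nat.eq_zero_or_pos p with rfl | hp0
      · exact hself i hi
      · by_contra hno
        have := hpre.first p i hp0 hi (by omega) (by rwa [hW _ (by omega), hW _ hi])
        omega
    · intro h
      by_contra hlt
      refine h2.resolve_left hlt ?_
      rw [hW _ (by omega), hW _ (by omega)]
      exact h _ (by omega)
  simp only [findShift, run_seq, run_assign, AExp.ok_zero, AExp.val_zero]
  refine ⟨by omega, by omega, by omega, by omega, ?_⟩
  apply Run.loop fun st' c' => st'.r .p ≤ n + 1 ∧ 2 * st'.r .shift ≤ n ∧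
      (∀ i, i + st'.r .shift < n → Mt E n σ (T i) (T (i + st'.r .shift))) ∧
      (∀ p < st'.r .p, 2 * p ≤ n → (∀ i, i + p < n → Mt E n σ (T i) (T (i + p))) →
        p ≤ st'.r .shift) ∧ 4 * (n + 1 - st'.r .p) + 1 + K ≤ c'
  · simp; exact ⟨hself, by omega⟩
  · rintro st' c' ⟨h1, h2, h3, h4, h5⟩ hs
    have hB' : Base E n σ k st' := Base.same (st := (st.set .shift 0).set .p 0)
      ⟨hB.n, hB.sigma, hB.k, hB.base⟩ hs
    have hp' : st'.a .pre = st.a .pre := hs.2 .pre (by decide)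
    simp only [BExp.ok_lt, BExp.val_lt, BExp.ok_not, BExp.val_not, BExp.ok_eq, BExp.val_eq,
      AExp.ok_var, AExp.val_var, true_and, run_seq, run_branch, run_skip, run_assign, AExp.ok_arr,
      AExp.val_arr, hp', hB'.n, hB'.base, AExp.ok_add, AExp.val_add, AExp.ok_one, AExp.val_one,
      and_true, Store.set_r, if_true, reduceCtorEq, if_false, Store.set_a]
    refine ⟨by omega, by omega, fun hi => ?_, fun hi => ⟨h2, h3, fun p hp => ?_, by omega⟩⟩
    · have hpn : st'.r .p < n := by omega
      have := (hpre.sound _ hpn).1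
      rw [key _ hpn]
      refine ⟨by omega, by omega, fun hm => ⟨by omega, by omega, by omega, by omega, by omega, hm,
        fun p hp _ _ => by omega, by omega⟩, fun hm => ⟨by omega, by omega, by omega, by omega, h2,
        h3, fun p hp hp2 hpm => ?_, by omega⟩⟩
      rcases (Nat.lt_succ_iff.1 hp).lt_or_eq with h | rfl
      · exact h4 p h hp2 hpm
      · exact absurd hpm hm
    · exact h4 p (by omega) hp

theorem run_writeCover (hE : Fits E n σ k) (ht : HasText E n σ k T st) {s : ℕ}
    (hs0 : st.r .shift = s) (hsn : s ≤ n)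
    (hmt : ∀ i, i + s < n → Mt E n σ (T i) (T (i + s))) {K : ℕ}
    (hc : 10 * n + k * (2 * σ) + 3 + K ≤ c) :
    Run E writeCover st c fun st' c' => st'.r .blen = n - s ∧
      (∀ i, i + s < n → st'.a .best i < σ ∧ Has E n σ (T i) (st'.a .best i) ∧
        Has E n σ (T (i + s)) (st'.a .best i)) ∧ K ≤ c' := by
  have hM := hE.hM
  have hD := hE.hD
  simp only [writeCover, run_seq, run_assign, AExp.ok_zero, AExp.val_zero, AExp.ok_sub,
    AExp.val_sub, AExp.ok_var, AExp.val_var, true_and, ht.base.n, hs0]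
  refine ⟨by omega, by omega, by omega, ?_⟩
  have hk : nonSolid σ T (n - s) ≤ k := ht.count ▸ nonSolid_mono σ T (Nat.sub_le n s)
  apply Run.loop fun st' c' => st'.r .i ≤ n - s ∧
    (∀ i < st'.r .i, st'.a .best i < σ ∧ Has E n σ (T i) (st'.a .best i) ∧
        Has E n σ (T (i + s)) (st'.a .best i)) ∧
    ∑ i ∈ Finset.Ico (st'.r .i) (n - s), (10 + if σ ≤ T i then 2 * σ else 0) + 1 + K ≤ c'
  · have : ((st.set .blen (n - s)).set .i 0).r .i = 0 := by simp
    rw [this, sum_weights]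
    have := Nat.mul_le_mul_right (2 * σ) hk
    refine ⟨Nat.zero_le _, fun i hi => by omega, by omega⟩
  · rintro st' c' ⟨h1, h2, h3⟩ hs
    have ht' : HasText E n σ k T st' := HasText.same (st := (st.set .blen (n - s)).set .i 0)
      ⟨⟨ht.base.n, ht.base.sigma, ht.base.k, ht.base.base⟩, ht.txt, ht.code, ht.count⟩ hs
    have hbl : st'.r .blen = n - s := (hs.1 .blen (by decide)).trans (by simp)
    have hsh : st'.r .shift = s := (hs.1 .shift (by decide)).trans (by simpa using hs0)
    simp only [BExp.ok_lt, BExp.val_lt, AExp.ok_var, AExp.val_var, true_and, run_seq,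
      run_assign, AExp.ok_arr, AExp.val_arr, hbl, hsh, ht'.txt, ht'.base.base, AExp.ok_add,
      AExp.val_add, Store.set_r, if_true, reduceCtorEq, if_false, Store.set_a]
    refine ⟨by omega, fun hi => ?_, fun hi => ⟨fun i hi' => h2 i (by omega), by omega⟩⟩
    rw [Finset.sum_eq_sum_Ico_succ_bot hi] at h3
    refine ⟨by omega, by omega, by omega, by omega, ?_⟩
    refine (run_common (u := T (st'.r .i)) (v := T (st'.r .i + s)) hE
      (st := (st'.set .u (T (st'.r .i))).set .v (T (st'.r .i + s)))
      ⟨ht'.base.n, ht'.base.sigma, ht'.base.k, ht'.base.base⟩ (by simp) (by simp)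
      (ht.code _ (by omega)) (ht.code _ (by omega)) (c := c' - 1 - 1 - 1)
      (K := c' - (8 + if σ ≤ T (st'.r .i) then 2 * σ else 0)) ?_).mono ?_
    · by_cases h : σ ≤ T (st'.r .i)
      · simp only [h, true_and, if_true] at h3 ⊢
        split_ifs <;> omega
      · simp only [h, false_and, if_false] at h3 ⊢
        omega
    · rintro s2 d2 ⟨q1, q2⟩ hs2
      have hB2 : Base E n σ k s2 := Base.same
        (st := (st'.set .u (T (st'.r .i))).set .v (T (st'.r .i + s)))
        ⟨ht'.base.n, ht'.base.sigma, ht'.base.k, ht'.base.base⟩ hs2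
      have hi2 : s2.r .i = st'.r .i := hs2.1 .i (by decide)
      have hb2 : s2.a .best = st'.a .best := hs2.2 .best (by decide)
      have hc2 : s2.r .c < σ ∧ Has E n σ (T (st'.r .i)) (s2.r .c) ∧
          Has E n σ (T (st'.r .i + s)) (s2.r .c) :=
        q1.resolve_right fun h => h.2 (hmt _ (by omega))
      simp only [run_store, AExp.ok_var, AExp.val_var, hi2, hb2, hB2.base, AExp.ok_one, AExp.val_one,
        true_and, Store.put_r, Store.put_a, Store.set_r, Store.set_a, if_true]
      refine ⟨by omega, by omega, by omega, by omega, by omega, fun i hi' => ?_, by omega⟩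
      rw [Function.update_apply]
      split_ifs with h
      · rw [h]; exact hc2
      · exact h2 i (by omega)

/-- For a shift `s ≤ n / 2`, occurrences at `0` and at `s` of a string of length `n - s` cover
everything, and letters common to `T i` and `T (i + s)` make both occur. Conversely, every cover has
occurrences at both ends, whence the text matches its shift by `n - m`. The largest shift gives the
shortest length. -/
theorem run_longPhase (hE : Fits E n σ k) (ht : HasText E n σ k T st)
    (hne : ∀ i < n, ∃ x, Has E n σ (T i) x) {K : ℕ} (hc : longCost n σ k + K ≤ c) :
    Run E longPhase st c fun st' c' => 1 ≤ st'.r .blen ∧ st'.r .blen ≤ n ∧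
      Covers E n σ T (st'.a .best) (st'.r .blen) ∧
      (∀ m f, m ≤ n → n ≤ 2 * m → Covers E n σ T f m → st'.r .blen ≤ m) ∧ K ≤ c' := by
  have h2σ := hE.two_le
  have hσn := hE.le_n
  rw [longCost] at hc
  simp only [longPhase, run_seq]
  refine (run_copyText hE ht
    (K := selfPrefCost n k (2 * σ) + 14 * n + k * (2 * σ) + 10 + K) (by omega)).mono ?_
  rintro s1 c1 ⟨hw, hlim, hlen, hc1⟩ hs1
  have ht1 := ht.same hs1
  have hns : nonSolid σ (s1.a .wrd) n = k := by
    rw [← ht.count]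
    exact Finset.sum_congr rfl fun i hi => by rw [hw i (Finset.mem_range.1 hi)]
  refine (run_selfPref (Z := 2 * σ) (K := 14 * n + k * (2 * σ) + 10 + K) hE
    ⟨ht1.base, rfl, hlen, by omega, fun i hi => by rw [hw i hi]; exact ht.code i hi⟩ hlim
    (fun _ _ _ _ _ _ _ _ => le_rfl) (by rw [hns]; omega)).mono ?_
  rintro s2 c2 ⟨hpre, hc2⟩ hs2
  have ht2 := ht1.same hs2
  refine (run_findShift hE ht2.base hne hw hpre (K := 10 * n + k * (2 * σ) + 3 + K)
    (by omega)).mono ?_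
  rintro s3 c3 ⟨h1, h2, h3, hc3⟩ hs3
  have ht3 := ht2.same hs3
  refine (run_writeCover hE ht3 rfl (by omega) h2 (K := K) (by omega)).mono ?_
  rintro s4 c4 ⟨hb, hbest, hc4⟩ _
  rw [hb]
  refine ⟨by omega, by omega, ⟨fun i hi => (hbest i (by omega)).1, fun i hi => ?_⟩,
    fun m f hmn hnm hcov => ?_, hc4⟩
  · rcases Nat.lt_or_ge i (n - s3.r .shift) with h | h
    · exact ⟨0, by omega, by omega, by omega, fun x hx => by
        rw [Nat.zero_add]; exact (hbest x (by omega)).2.1⟩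
    · exact ⟨s3.r .shift, by omega, by omega, by omega, fun x hx => by
        rw [Nat.add_comm]; exact (hbest x (by omega)).2.2⟩
  -- Covering the positions `0` and `n - 1` forces occurrences at `0` and at `n - m`; the letter `f
  -- i` is then common to the two symbols.
  · have := h3 (n - m) (by omega) fun i hi => by
      obtain ⟨j, g1, g2, g3, g4⟩ := hcov.2 0 (by omega)
      obtain ⟨j', g1', g2', g3', g4'⟩ := hcov.2 (n - 1) (by omega)
      obtain rfl : j = 0 := by omega
      obtain rfl : j' = n - m := by omega
      have e1 := g4 i (by omega)
      have e2 := g4' i (by omega)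
      rw [Nat.zero_add] at e1
      rw [Nat.add_comm] at e2
      exact ⟨f i, e1, e2⟩
    omega

/-! ## Reversal -/

/-- Copy the first `x` entries of the array `A` to `rev`, in reverse order. -/
def toRev (A : Arr) (x : Var) : Cmd :=
  .assign .i 0 ;;
  .loop (.lt ♯.i ♯x) (.store .rev ♯.i (.arr A (♯x - 1 - ♯.i)) ;; .assign .i (♯.i + 1))

/-- Copy the first `x` entries of `rev` to the array `A`. -/
def ofRev (A : Arr) (x : Var) : Cmd :=
  .assign .i 0 ;;
  .loop (.lt ♯.i ♯x) (.store A ♯.i (.arr .rev ♯.i) ;; .assign .i (♯.i + 1))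

/-- Reverse the first `x` entries of the array `A`. -/
def reverse (A : Arr) (x : Var) : Cmd := toRev A x ;; ofRev A x

theorem run_toRev (hE : Fits E n σ k) (hB : Base E n σ k st) {A : Arr} {x : Var} {l : ℕ}
    (hA : A ≠ .rev) (hx : x ≠ .i) (hl : st.r x = l) (hln : l ≤ n) {K : ℕ}
    (hc : 3 * n + 2 + K ≤ c) :
    Run E (toRev A x) st c fun st' c' =>
      (∀ i < l, st'.a .rev i = st.a A (l - 1 - i)) ∧ K ≤ c' := by
  have hM := hE.hM
  have hD := hE.hD
  simp only [toRev, run_seq, run_assign, AExp.ok_zero, AExp.val_zero]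
  refine ⟨by omega, by omega, ?_⟩
  apply Run.loop fun st' c' => st'.r .i ≤ l ∧
    (∀ i < st'.r .i, st'.a .rev i = st.a A (l - 1 - i)) ∧ 3 * (l - st'.r .i) + 1 + K ≤ c'
  · simp; omega
  · rintro st' c' ⟨h1, h3, h4⟩ hs
    have hb : st'.r .base = E.D := (hs.1 .base (by simp [Cmd.vars])).trans hB.base
    have hx' : st'.r x = l := (hs.1 x (by simp [Cmd.vars, hx])).trans (by simp [hx, hl])
    have hA' : st'.a A = st.a A := hs.2 A (by simp [Cmd.arrs, hA])
    simp only [BExp.ok_lt, BExp.val_lt, AExp.ok_var, AExp.val_var, true_and, run_seq,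
      run_store, run_assign, AExp.ok_arr, AExp.val_arr, hx', hA', hb, AExp.ok_sub, AExp.val_sub,
      AExp.ok_add, AExp.val_add, AExp.ok_one, AExp.val_one, and_true, Store.set_r,
      if_true, Store.set_a, Store.put_r, Store.put_a]
    refine ⟨by omega, fun hi => ⟨by omega, by omega, by omega, by omega, by omega, fun i hi' => ?_,
      by omega⟩, fun hi => ⟨fun i hi' => h3 i (by omega), by omega⟩⟩
    rw [Function.update_apply]
    split_ifs with h
    · rw [h]
    · exact h3 i (by omega)

theorem run_ofRev (hE : Fits E n σ k) (hB : Base E n σ k st) {A : Arr} {x : Var} {l : ℕ}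
    (hA : A ≠ .rev) (hx : x ≠ .i) (hl : st.r x = l) (hln : l ≤ n) {K : ℕ}
    (hc : 3 * n + 2 + K ≤ c) :
    Run E (ofRev A x) st c fun st' c' => (∀ i < l, st'.a A i = st.a .rev i) ∧ K ≤ c' := by
  have hM := hE.hM
  have hD := hE.hD
  simp only [ofRev, run_seq, run_assign, AExp.ok_zero, AExp.val_zero]
  refine ⟨by omega, by omega, ?_⟩
  apply Run.loop fun st' c' => st'.r .i ≤ l ∧
    (∀ i < st'.r .i, st'.a A i = st.a .rev i) ∧ 3 * (l - st'.r .i) + 1 + K ≤ c'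
  · simp; omega
  · rintro st' c' ⟨h1, h3, h4⟩ hs
    have hb : st'.r .base = E.D := (hs.1 .base (by simp [Cmd.vars])).trans hB.base
    have hx' : st'.r x = l := (hs.1 x (by simp [Cmd.vars, hx])).trans (by simp [hx, hl])
    have hA' : st'.a .rev = st.a .rev := hs.2 .rev (by simp [Cmd.arrs, hA.symm])
    simp only [BExp.ok_lt, BExp.val_lt, AExp.ok_var, AExp.val_var, true_and, run_seq,
      run_store, run_assign, AExp.ok_arr, AExp.val_arr, hx', hA', hb,
      AExp.ok_add, AExp.val_add, AExp.ok_one, AExp.val_one, and_true, Store.set_r,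
      if_true, Store.set_a, Store.put_r, Store.put_a]
    refine ⟨by omega, fun hi => ⟨by omega, by omega, by omega, by omega, by omega, fun i hi' => ?_,
      by omega⟩, fun hi => ⟨fun i hi' => h3 i (by omega), by omega⟩⟩
    rw [Function.update_apply]
    split_ifs with h
    · rw [h]
    · exact h3 i (by omega)

theorem run_reverse (hE : Fits E n σ k) (hB : Base E n σ k st) {A : Arr} {x : Var} {l : ℕ}
    (hA : A ≠ .rev) (hx : x ≠ .i) (hl : st.r x = l) (hln : l ≤ n) {K : ℕ}
    (hc : 6 * n + 4 + K ≤ c) :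
    Run E (reverse A x) st c fun st' c' =>
      (∀ i < l, st'.a A i = st.a A (l - 1 - i)) ∧ K ≤ c' := by
  rw [reverse, run_seq]
  refine (run_toRev hE hB hA hx hl hln (K := 3 * n + 2 + K) (by omega)).mono ?_
  rintro s d ⟨h1, h2⟩ hs
  refine (run_ofRev hE (hB.same hs (by simp [toRev, Cmd.vars])) hA hx
    ((hs.1 x (by simp [toRev, Cmd.vars, hx])).trans hl) hln h2).mono ?_
  rintro s' d' ⟨h3, h4⟩ _
  exact ⟨fun i hi => (h3 i hi).trans (h1 i hi), h4⟩

/-- An occurrence at `j` becomes one at `n - (j + m)`. -/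
theorem Covers.reverse {T T' U U' : ℕ → ℕ} {m : ℕ} (h : Covers E n σ T U m)
    (hT : ∀ i < n, T' i = T (n - 1 - i)) (hU : ∀ i < m, U' i = U (m - 1 - i)) :
    Covers E n σ T' U' m := by
  refine ⟨fun i hi => by rw [hU i hi]; exact h.1 _ (by omega), fun i hi => ?_⟩
  obtain ⟨j, h1, h2, h3, h4⟩ := h.2 (n - 1 - i) (by omega)
  refine ⟨n - (j + m), by omega, by omega, by omega, fun x hx => ?_⟩
  have := h4 (m - 1 - x) (by omega)
  rwa [hU x hx, hT _ (by omega), show n - 1 - (n - (j + m) + x) = j + (m - 1 - x) by omega]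

theorem Covers.congr {T T' U U' : ℕ → ℕ} {m : ℕ} (h : Covers E n σ T U m)
    (hT : ∀ i < n, T' i = T i) (hU : ∀ i < m, U' i = U i) : Covers E n σ T' U' m := by
  refine ⟨fun i hi => by rw [hU i hi]; exact h.1 _ hi, fun i hi => ?_⟩
  obtain ⟨j, h1, h2, h3, h4⟩ := h.2 i hi
  exact ⟨j, h1, h2, h3, fun x hx => by rw [hU x hx, hT _ (by omega)]; exact h4 x hx⟩

/-- The prefix of length `m` of the reversed text is the suffix of `T` that complements its prefix
of length `n - m`. With `m ≤ n - m` this is what makes one of the two ends carry at most half of the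
non-solid symbols. -/
theorem nonSolid_reverse {T T' : ℕ → ℕ} (hT : ∀ i < n, T' i = T (n - 1 - i)) {m : ℕ}
    (hm : m ≤ n) : nonSolid σ T' m + nonSolid σ T (n - m) = nonSolid σ T n := by
  have h1 : nonSolid σ T n = nonSolid σ T (n - m) +
      ∑ i ∈ Finset.range m, if σ ≤ T (n - m + i) then 1 else 0 := by
    rw [nonSolid, nonSolid, ← Finset.sum_range_add, Nat.sub_add_cancel hm]
  rw [h1, add_comm, ← Finset.sum_range_reflect (fun i => if σ ≤ T (n - m + i) then 1 else 0)]
  refine congrArg _ (Finset.sum_congr rfl fun i hi => ?_)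
  have := Finset.mem_range.1 hi
  rw [hT _ (by omega), show n - m + (m - 1 - i) = n - 1 - i by omega]

end
/-! ## The whole program -/

/-- Count the non-solid symbols of the input. -/
def countNonSolid : Cmd :=
  .assign .i 0 ;; .assign .k 0 ;;
  .loop (.lt ♯.i ♯.n)
    (.branch (.lt (.inp ♯.i) ♯.sigma) .skip (.assign .k (♯.k + 1)) ;; .assign .i (♯.i + 1))

/-- Copy the codes of the symbols from the input. -/
def readText : Cmd :=
  .assign .i 0 ;;
  .loop (.lt ♯.i ♯.n) (.store .txt ♯.i (.inp ♯.i) ;; .assign .i (♯.i + 1))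

/-- Prepare the variables and the text. -/
def setup : Cmd := countNonSolid ;; .assign .base (♯.n + ♯.sigma * ♯.k + 1) ;; readText

/-- Compute a shortest cover. -/
def coverCmd : Cmd :=
  setup ;; longPhase ;; shortPhase ;; reverse .txt .n ;; reverse .best .blen ;; shortPhase ;;
  reverse .best .blen ;; .assign .n ♯.blen ;; .assign .sigma (.lit 29 * ♯.base)

/-- The number of basic steps of `coverCmd`. -/
def coverCost (n σ k : ℕ) : ℕ := longCost n σ k + 2 * shortCost n σ k (k / 2) + 25 * n + 20

section
variable {E : Env} {n σ k : ℕ} {st : Store} {c : ℕ}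

theorem run_setup (hE : Fits E n σ k) (hn : st.r .n = n) (hs : st.r .sigma = σ)
    (hcode : ∀ i < n, E.inp i < σ + k) (hcount : nonSolid σ E.inp n = k) {K : ℕ}
    (hc : 7 * n + 6 + K ≤ c) :
    Run E setup st c fun st' c' => HasText E n σ k (st'.a .txt) st' ∧
      (∀ i < n, st'.a .txt i = E.inp i) ∧ K ≤ c' := by
  have hM := hE.hM
  have hD := hE.hD
  have hk := hE.k_le
  simp only [setup, run_seq]
  have h1 : Run E countNonSolid st c fun st' c' => st'.r .k = k ∧ 3 * n + 3 + K ≤ c' := by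
    simp only [countNonSolid, run_seq, run_assign, AExp.ok_zero, AExp.val_zero]
    refine ⟨by omega, by omega, by omega, by omega, ?_⟩
    apply Run.loop fun st' c' => st'.r .i ≤ n ∧ st'.r .k = nonSolid σ E.inp (st'.r .i) ∧
      4 * (n - st'.r .i) + 3 * n + 4 + K ≤ c'
    · simp [nonSolid]; omega
    · rintro st' c' ⟨h1, h2, h3⟩ hs'
      have hn' : st'.r .n = n := (hs'.1 .n (by decide)).trans hn
      have hσ' : st'.r .sigma = σ := (hs'.1 .sigma (by decide)).trans hs
      have hns := nonSolid_succ σ E.inp (st'.r .i)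
      have hle : nonSolid σ E.inp (st'.r .i) ≤ k := hcount ▸ nonSolid_mono σ _ h1
      simp only [BExp.ok_lt, BExp.val_lt, AExp.ok_var, AExp.val_var, true_and, run_seq, run_branch,
        run_skip, run_assign, AExp.ok_inp, AExp.val_inp, hn', hσ', AExp.ok_add, AExp.val_add,
        AExp.ok_one, AExp.val_one, and_true, Store.set_r, if_true, reduceCtorEq, if_false, h2]
      refine ⟨by omega, fun hi => ⟨by omega, by omega, fun hsol => ?_, fun hsol => ?_⟩,
        fun hi => ⟨?_, by omega⟩⟩
      · rw [if_neg (by omega), add_zero] at hns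
        rw [hns]
        exact ⟨by omega, by omega, by omega, by omega, rfl, by omega⟩
      · rw [if_pos (by omega)] at hns
        rw [hns]
        exact ⟨by omega, by omega, by omega, by omega, by omega, rfl, by omega⟩
      · rw [← hcount, show st'.r .i = n by omega]
  refine h1.mono ?_
  rintro s d ⟨hks, hd⟩ hs1
  have hn1 := (hs1.1 .n (by decide)).trans hn
  have hσ1 := (hs1.1 .sigma (by decide)).trans hs
  simp only [readText, run_seq, run_assign, AExp.ok_add, AExp.ok_mul, AExp.ok_var, AExp.ok_one,
    AExp.val_add, AExp.val_mul, AExp.val_var, AExp.val_one, hn1, hσ1, hks, AExp.ok_zero,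
    AExp.val_zero, true_and]
  refine ⟨⟨⟨by omega, by omega⟩, by omega, by omega⟩, by omega, by omega, by omega, ?_⟩
  apply Run.loop fun st' c' => st'.r .i ≤ n ∧ (∀ i < st'.r .i, st'.a .txt i = E.inp i) ∧
      3 * (n - st'.r .i) + 1 + K ≤ c'
  · simp; omega
  · rintro st' c' ⟨h1, h2, h3⟩ hs'
    have hB' : Base E n σ k st' := Base.same
      (st := (s.set .base (n + σ * k + 1)).set .i 0) ⟨hn1, hσ1, hks, by simp [hD]⟩ hs'
    simp only [BExp.ok_lt, BExp.val_lt, AExp.ok_var, AExp.val_var, true_and, run_seq,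
      run_store, run_assign, AExp.ok_inp, AExp.val_inp, hB'.n, hB'.base, AExp.ok_add, AExp.val_add,
      AExp.ok_one, AExp.val_one, and_true, Store.set_r, if_true, Store.set_a, Store.put_r,
      Store.put_a]
    refine ⟨by omega, fun hi => ⟨by omega, by omega, by omega, by omega, by omega, fun i hi' => ?_,
      by omega⟩, fun hi => ?_⟩
    · rw [Function.update_apply]
      split_ifs with h
      · rw [h]
      · exact h2 i (by omega)
    · have htxt : ∀ i < n, st'.a .txt i = E.inp i := fun i hi' => h2 i (by omega)
      refine ⟨⟨hB', rfl, fun i hi' => by rw [htxt i hi']; exact hcode i hi', ?_⟩, htxt, by omega⟩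
      rw [← hcount]
      exact Finset.sum_congr rfl fun i hi' => by rw [htxt i (Finset.mem_range.1 hi')]

/-- Each run of the short phase starts from the best cover so far, which is reversed together with
the text and reversed back at the end. Every cover is long, or short with few non-solid symbols in
the prefix, or short with few in the suffix; each of the three phases handles one kind. -/
theorem run_coverCmd (hE : Fits E n σ k) (hn : st.r .n = n) (hs : st.r .sigma = σ)
    (hcode : ∀ i < n, E.inp i < σ + k) (hcount : nonSolid σ E.inp n = k)
    (hne : ∀ i < n, ∃ x, Has E n σ (E.inp i) x) (hc : coverCost n σ k ≤ c) :
    Run E coverCmd st c fun st' _ => Covers E n σ E.inp (st'.a .best) (st'.r .n) ∧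
      (∀ m f, Covers E n σ E.inp f m → st'.r .n ≤ m) ∧ st'.r .n ≤ n ∧
      st'.r .sigma = 29 * E.D := by
  have hM := hE.hM
  have h2σ := hE.two_le
  have hσn := hE.le_n
  rw [coverCost] at hc
  simp only [coverCmd, run_seq]
  refine (run_setup hE hn hs hcode hcount
    (K := longCost n σ k + 2 * shortCost n σ k (k / 2) + 18 * n + 14) (by omega)).mono ?_
  rintro s1 c1 ⟨ht1, htxt1, hc1⟩ -
  generalize hT : s1.a .txt = T at *
  have hne1 : ∀ i < n, ∃ x, Has E n σ (T i) x := fun i hi => by rw [htxt1 i hi]; exact hne i hi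
  refine (run_longPhase hE ht1 hne1
    (K := 2 * shortCost n σ k (k / 2) + 18 * n + 14) (by omega)).mono ?_
  rintro s2 c2 ⟨hb2, hbn2, hcov2, hmin2, hc2⟩ hs2
  have ht2 := ht1.same hs2
  refine (run_shortPhase hE ht2 rfl hb2 hbn2 hcov2 rfl
    (K := shortCost n σ k (k / 2) + 18 * n + 14) (by omega)).mono ?_
  rintro s3 c3 ⟨hb3, hb32, hcov3, hmin3, hc3⟩ hs3
  have ht3 := ht2.same hs3
  refine (run_reverse hE ht3.base (A := .txt) (x := .n) (by decide) (by decide) ht3.base.n le_rfl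
    (K := shortCost n σ k (k / 2) + 12 * n + 10) (by omega)).mono ?_
  rintro s4 c4 ⟨hrev4, hc4⟩ hs4
  have hB4 := ht3.base.same hs4
  have hb4 : s4.r .blen = s3.r .blen := hs4.1 .blen (by decide)
  have hbest4 : s4.a .best = s3.a .best := hs4.2 .best (by decide)
  rw [ht3.txt] at hrev4
  refine (run_reverse hE hB4 (A := .best) (x := .blen) (by decide) (by decide) hb4
    (hb32.trans hbn2) (K := shortCost n σ k (k / 2) + 6 * n + 6) (by omega)).mono ?_
  rintro s5 c5 ⟨hrev5, hc5⟩ hs5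
  have hB5 := hB4.same hs5
  have hb5 : s5.r .blen = s3.r .blen := (hs5.1 .blen (by decide)).trans hb4
  have htxt5 : s5.a .txt = s4.a .txt := hs5.2 .txt (by decide)
  have ht5 : HasText E n σ k (s4.a .txt) s5 := by
    refine ⟨hB5, htxt5, fun i hi => ?_, ?_⟩
    · rw [hrev4 i hi]
      exact ht1.code _ (by omega)
    · have := nonSolid_reverse (σ := σ) hrev4 le_rfl
      rw [Nat.sub_self, ht1.count] at this
      simpa [nonSolid] using this
  rw [hbest4] at hrev5
  refine (run_shortPhase hE ht5 hb5 hb3 (hb32.trans hbn2) (hcov3.reverse hrev4 hrev5) rfl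
    (K := 6 * n + 6) (by omega)).mono ?_
  rintro s6 c6 ⟨hb6, hb63, hcov6, hmin6, hc6⟩ hs6
  have ht6 := ht5.same hs6
  refine (run_reverse hE ht6.base (A := .best) (x := .blen) (by decide) (by decide) rfl
    ((hb63.trans hb32).trans hbn2) (K := 2) (by omega)).mono ?_
  rintro s7 c7 ⟨hrev7, hc7⟩ hs7
  have hB7 := ht6.base.same hs7
  have hb7 : s7.r .blen = s6.r .blen := hs7.1 .blen (by decide)
  -- The final value of `sigma` is the address of the output: `29 = 4 * 7 + 1`, where `7` is the
  -- number of the block of `best`.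
  have hlit : ∀ s : Store, (AExp.lit 29).val E s = 29 := fun _ => rfl
  have hlitok : ∀ s : Store, (AExp.lit 29).ok E s ↔ 29 < E.M := fun _ => Iff.rfl
  simp only [run_assign, AExp.ok_var, AExp.val_var, AExp.ok_mul, AExp.val_mul, hlit, hlitok,
    Store.set_r, Store.set_a, reduceCtorEq, if_false, if_true, hB7.base, hb7, true_and, and_true]
  have hcovers : Covers E n σ E.inp (s7.a .best) (s6.r .blen) := by
    refine (hcov6.reverse (T' := T) (U' := s7.a .best) (fun i hi => ?_) hrev7).congr
      (fun i hi => (htxt1 i hi).symm) fun _ _ => rfl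
    rw [hrev4 _ (by omega), show n - 1 - (n - 1 - i) = i by omega]
  have hD := hE.hD
  refine ⟨by omega, by omega, by omega, hcovers, fun m f hcov => ?_,
    (hb63.trans hb32).trans hbn2⟩
  have hcovT : Covers E n σ T f m := hcov.congr htxt1 fun _ _ => rfl
  have hmn : m ≤ n := by
    obtain ⟨j, _, _, h, _⟩ := hcov.2 0 (by omega)
    omega
  rcases Nat.lt_or_ge (2 * m) n with h | h
  · by_cases hpre : 2 * nonSolid σ T m ≤ k
    · exact hb63.trans (hmin3 m f hmn hpre hcovT)
    -- The prefix has more than `k / 2` non-solid symbols and is disjoint from the suffix, so the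
    -- suffix has fewer than `k / 2`, and the second run finds the reversed cover.
    · have hsum := nonSolid_reverse (σ := σ) hrev4 hmn
      have hmono := nonSolid_mono σ T (show m ≤ n - m by omega)
      rw [ht1.count] at hsum
      exact hmin6 m (fun i => f (m - 1 - i)) hmn (by omega)
        (hcovT.reverse hrev4 fun _ _ => rfl)
  · exact (hb63.trans hb32).trans (hmin2 m f hmn h hcovT)

end

/-! ### The time bound -/

theorem selfPrefCost_le {n k N : ℕ} (hn : 1 ≤ n) (hN : 1 ≤ N) (hk : k ≤ N) :
    selfPrefCost (2 * n) k 0 ≤ 185 * (n * N) := by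
  have h1 : n ≤ n * N := Nat.le_mul_of_pos_right _ hN
  have h2 : k * (86 * n + 16) ≤ N * (86 * n + 16 * n) := Nat.mul_le_mul hk (by omega)
  have h3 : N * (86 * n + 16 * n) = 102 * (n * N) := by ring
  have h4 : selfPrefCost (2 * n) k 0 = 66 * n + 17 + k * (86 * n + 16) := by
    unfold selfPrefCost; ring
  omega

/-- Apart from the enumeration, the only critical term is `k * (k * σ)`, for comparing pairs of
non-solid symbols in the long phase. For `k ≥ 2` the factor `σ` is at most `σ ^ (k / 2)` and one
factor `k` is at most `n`; for `k ≤ 1` it is enough that `σ ≤ n`. -/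
theorem coverCost_le {n σ k : ℕ} (h2 : 2 ≤ σ) (hσ : σ ≤ n) (hk : k ≤ n) :
    coverCost n σ k ≤ 800 * (n * σ ^ (k / 2) * max k 1) := by
  obtain ⟨N, hN⟩ : ∃ N, N = max k 1 := ⟨_, rfl⟩
  obtain ⟨P, hP⟩ : ∃ P, P = σ ^ (k / 2) := ⟨_, rfl⟩
  have hP1 : 1 ≤ P := hP ▸ Nat.one_le_pow _ _ (by omega)
  have hkN : k ≤ N := by omega
  have h1 : n ≤ n * N := Nat.le_mul_of_pos_right _ (by omega)
  have h3 : n * N ≤ n * P * N := Nat.mul_le_mul_right _ (Nat.le_mul_of_pos_right _ hP1)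
  have hkk : k * (k * σ) ≤ n * P * N := by
    rcases Nat.lt_or_ge k 2 with h | h
    · have : k * (k * σ) ≤ 1 * (1 * σ) :=
        Nat.mul_le_mul (by omega) (Nat.mul_le_mul_right _ (by omega))
      omega
    · have hσP : σ ≤ P := by
        rw [hP]
        exact Nat.le_self_pow (by omega) _
      calc k * (k * σ) = k * σ * k := by ring
        _ ≤ n * P * N := Nat.mul_le_mul (Nat.mul_le_mul hk hσP) hkN
  have hk1 : k * σ ≤ k * (k * σ) := by
    rcases Nat.eq_zero_or_pos k with rfl | h
    · simp
    · exact Nat.le_mul_of_pos_left _ h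
  have hcand : candidateCost n k ≤ 235 * (n * N) := by
    have := selfPrefCost_le (n := n) (k := k) (N := N) (by omega) (by omega) hkN
    unfold candidateCost checkCost
    omega
  have hshort : shortCost n σ k (k / 2) ≤ 260 * (n * P * N) := by
    have : P * candidateCost n k ≤ 235 * (n * P * N) :=
      (Nat.mul_le_mul_left P hcand).trans (by rw [show P * (235 * (n * N)) =
        235 * (n * P * N) by ring])
    rw [shortCost, ← hP]
    omega
  have hlong : longCost n σ k ≤ 150 * (n * P * N) := by
    have e1 : k * (43 * n + k * (2 * σ) + 16) = 43 * (k * n) + 2 * (k * (k * σ)) + 16 * k := by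
      ring
    have e2 : k * (2 * σ) = 2 * (k * σ) := by ring
    have e3 : k * n ≤ n * N := by rw [mul_comm]; exact Nat.mul_le_mul_left _ hkN
    unfold longCost selfPrefCost
    omega
  rw [← hN, ← hP, coverCost]
  omega

end WordRAM

/-! ## The representation of the input -/

namespace IString

variable {σ n : ℕ} (T : IString (Fin σ) n)

theorem mem_nonSolidPositions (i : Fin n) : i ∈ T.nonSolidPositions ↔ ¬ T.SolidAt i := by
  simp [nonSolidPositions]

theorem nonSolidPositions_sorted : T.nonSolidPositions.Pairwise (· < ·) :=
  (List.pairwise_lt_finRange n).filter _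

theorem numNonSolid_le : T.numNonSolid ≤ n := by
  have := List.length_filter_le (fun i => decide (¬ T.SolidAt i)) (List.finRange n)
  rwa [List.length_finRange] at this

/-- The list of the non-solid positions, split at one of them. -/
theorem exists_split {i : Fin n} (hi : ¬ T.SolidAt i) :
    ∃ l₁ l₂, T.nonSolidPositions = l₁ ++ i :: l₂ ∧
      (T.nonSolidPositions.filter fun j => j < i) = l₁ := by
  obtain ⟨l₁, l₂, h⟩ := List.append_of_mem ((T.mem_nonSolidPositions i).2 hi)
  refine ⟨l₁, l₂, h, ?_⟩
  have hs := T.nonSolidPositions_sorted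
  rw [h, List.pairwise_append] at hs
  obtain ⟨-, h2, h3⟩ := hs
  rw [h, List.filter_append, List.filter_eq_self.2, List.filter_eq_nil_iff.2, List.append_nil]
  · intro j hj
    rcases List.mem_cons.1 hj with rfl | hj
    · simp
    · have := (List.pairwise_cons.1 h2).1 j hj
      simpa using this.le
  · intro j hj
    simpa using h3 j hj i List.mem_cons_self

theorem length_flatMap_bitVector (l : List (Fin n)) :
    (l.flatMap T.bitVector).length = σ * l.length := by
  induction l with
  | nil => simp
  | cons a l ih =>
    rw [List.flatMap_cons, List.length_append, ih, List.length_cons, bitVector, List.length_ofFn]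
    ring

theorem symCode_lt_iff (i : Fin n) : T.symCode i < σ ↔ T.SolidAt i := by
  rw [symCode]
  split_ifs with h
  · simp [h]
  · simp [h]

theorem symCode_lt (i : Fin n) : T.symCode i < σ + T.numNonSolid := by
  by_cases h : T.SolidAt i
  · have := (T.symCode_lt_iff i).2 h
    omega
  · obtain ⟨l₁, l₂, h1, h2⟩ := T.exists_split h
    rw [symCode, if_neg h, h2, numNonSolid, h1]
    simp

theorem encode_getD_of_lt (i : Fin n) : T.encode.getD i 0 = T.symCode i := by
  rw [encode, List.getD_append _ _ _ _ (by simp)]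
  simp

/-- If `r` non-solid positions precede `i`, their bit vectors take `σ * r` cells after the `n`
codes, and `r` is the excess of the code of `i` over `σ`. -/
theorem encode_getD_bit {i : Fin n} (hi : ¬ T.SolidAt i) (c : Fin σ) :
    T.encode.getD (n + σ * (T.symCode i - σ) + c) 0 = if c ∈ T.sym i then 1 else 0 := by
  obtain ⟨l₁, l₂, h1, h2⟩ := T.exists_split hi
  rw [symCode, if_neg hi, h2, Nat.add_sub_cancel_left, encode, h1, add_assoc,
    List.getD_append_right _ _ _ _ (by simp), List.length_ofFn, Nat.add_sub_cancel_left,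
    List.flatMap_append, List.getD_append_right _ _ _ _ (by rw [length_flatMap_bitVector]; omega),
    length_flatMap_bitVector, Nat.add_sub_cancel_left, List.flatMap_cons,
    List.getD_append _ _ _ _ (by simp [bitVector])]
  simp [bitVector]

end IString

/-! ### Covers of indeterminate strings in terms of codes -/

namespace WordRAM

open IString

variable {σ n : ℕ} {T : IString (Fin σ) n} {E : Env}

theorem has_code_iff (hE : E.inp = fun a => T.encode.getD a 0) (i : Fin n) (c : ℕ) :
    Has E n σ (E.inp i) c ↔ ∃ h : c < σ, ⟨c, h⟩ ∈ T.sym i := by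
  have hinp : E.inp i = T.symCode i := by rw [hE]; exact T.encode_getD_of_lt i
  rw [Has, hinp]
  by_cases h : T.SolidAt i
  · rw [if_pos ((T.symCode_lt_iff i).2 h), symCode, if_pos h]
    obtain ⟨a, ha⟩ := Finset.card_eq_one.1 h
    simp only [ha, Finset.min'_singleton, Finset.mem_singleton]
    constructor
    · rintro ⟨h1, h2⟩
      exact ⟨h1, Fin.ext h2.symm⟩
    · rintro ⟨h1, h2⟩
      exact ⟨h1, by rw [← h2]⟩
  · rw [if_neg (mt (T.symCode_lt_iff i).1 h), hE]
    constructor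
    · rintro ⟨h1, h2⟩
      refine ⟨h1, ?_⟩
      have := T.encode_getD_bit h ⟨c, h1⟩
      by_contra hno
      rw [if_neg hno] at this
      simp only at this h2
      omega
    · rintro ⟨h1, h2⟩
      have := T.encode_getD_bit h ⟨c, h1⟩
      rw [if_pos h2] at this
      exact ⟨h1, this⟩

theorem nonSolid_encode (hE : E.inp = fun a => T.encode.getD a 0) :
    nonSolid σ E.inp n = T.numNonSolid := by
  rw [nonSolid, ← Fin.sum_univ_eq_sum_range (fun y => if σ ≤ E.inp y then 1 else 0),
    ← Finset.sum_filter, Finset.sum_const, smul_eq_mul, mul_one]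
  have : (Finset.univ.filter fun i : Fin n => σ ≤ E.inp i) =
      Finset.univ.filter fun i => ¬ T.SolidAt i := by
    refine Finset.filter_congr fun i _ => ?_
    rw [hE, ← T.symCode_lt_iff, not_lt]
    simp only [T.encode_getD_of_lt]
  rw [this]
  rfl

theorem exists_cover_of_covers (hE : E.inp = fun a => T.encode.getD a 0) {U : ℕ → ℕ} {m : ℕ}
    (h : Covers E n σ E.inp U m) :
    ∃ S : IString (Fin σ) m, S.IsCover T ∧
      ∀ i : Fin m, ∃ c : Fin σ, S.sym i = {c} ∧ U i = c := by
  refine ⟨⟨fun i => {⟨U i, h.1 i i.2⟩}, fun i => Finset.singleton_nonempty _⟩,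
    ⟨fun i => Finset.card_singleton _, fun i hi => ?_⟩, fun i => ⟨_, rfl, rfl⟩⟩
  obtain ⟨j, h1, h2, h3, h4⟩ := h.2 i hi
  refine ⟨j, ⟨h3, fun x => ⟨_, Finset.mem_singleton_self _, ?_⟩⟩, h1, h2⟩
  obtain ⟨_, h6⟩ := (has_code_iff hE ⟨j + x, by omega⟩ _).1 (h4 x x.2)
  exact h6

theorem covers_of_isCover (hE : E.inp = fun a => T.encode.getD a 0) {m : ℕ}
    {S : IString (Fin σ) m} (h : S.IsCover T) : ∃ f, Covers E n σ E.inp f m := by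
  have hex : ∀ i : Fin m, ∃ c, S.sym i = {c} := fun i => Finset.card_eq_one.1 (h.1 i)
  choose g hg using hex
  refine ⟨fun i => if hi : i < m then g ⟨i, hi⟩ else 0, fun i hi => by simp [hi], fun i hi => ?_⟩
  obtain ⟨j, ⟨h1, h2⟩, h3, h4⟩ := h.2 i hi
  refine ⟨j, h3, h4, h1, fun x hx => ?_⟩
  obtain ⟨c, hc1, hc2⟩ := h2 ⟨x, hx⟩
  rw [hg, Finset.mem_singleton] at hc1
  simp only [hx, dif_pos]
  rw [← hc1]
  exact (has_code_iff hE ⟨j + x, by omega⟩ _).2 ⟨c.2, hc2⟩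

end WordRAM

/-! ### The main theorem -/

theorem mainTheorem7 :
    ∃ (p : WordRAM.Program) (d : ℕ) (C : ℝ),
      ∀ (σ n : ℕ), 2 ≤ σ → σ ≤ n →
      ∀ (T : IString (Fin σ) n) (w : ℕ), (n + σ * T.numNonSolid) ^ d ≤ 2 ^ w →
        ∃ (s : WordRAM.State) (t : ℕ),
          WordRAM.Exec w p (WordRAM.initState T) s t ∧
          (∃ (m : ℕ) (S : IString (Fin σ) m), S.IsShortestCover T ∧ WordRAM.Outputs s S) ∧
          (t : ℝ) ≤ C * ((n : ℝ) * (σ : ℝ) ^ ((T.numNonSolid : ℝ) / 2) *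
            max (T.numNonSolid : ℝ) 1) := by
  open WordRAM in
  refine ⟨coverCmd.compile, 10, coverCmd.weight * 800, fun σ n h2 hσn T w hw => ?_⟩
  obtain ⟨k, hk⟩ : ∃ k, k = T.numNonSolid := ⟨_, rfl⟩
  rw [← hk] at hw ⊢
  let E : Env := ⟨n + σ * k + 1, 2 ^ w, fun a => T.encode.getD a 0⟩
  have hkn : k ≤ n := hk ▸ T.numNonSolid_le
  have hM : 200 * E.D ≤ E.M := by
    have h3 : 2 ≤ n + σ * k := by omega
    -- This is where the exponent `10` comes from: with `n + σ * k ≥ 2`, nine factors give `512`,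
    -- and `512 * x ≥ 200 * (x + 1)` for `x ≥ 1`.
    have h4 : 2 ^ 9 * (n + σ * k) ≤ (n + σ * k) ^ 10 := by
      rw [pow_succ _ 9]
      exact Nat.mul_le_mul_right _ (Nat.pow_le_pow_left h3 9)
    change 200 * (n + σ * k + 1) ≤ 2 ^ w
    omega
  have hE : Fits E n σ k := ⟨rfl, hM, h2, hσn, hkn⟩
  -- The arrays initially hold whatever is in their memory blocks, so the representation is
  -- immediate.
  let st : Store := ⟨fun x => (initState T).reg x.idx,
    fun A i => (initState T).mem ((4 * A.idx + 1) * E.D + i)⟩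
  have hrep : Rep E (initState T) st := ⟨fun _ => rfl, fun _ _ _ => rfl, fun _ _ => rfl⟩
  have hne : ∀ i < n, ∃ x, Has E n σ (E.inp i) x := fun i hi => by
    obtain ⟨a, ha⟩ := T.sym_nonempty ⟨i, hi⟩
    exact ⟨a, (has_code_iff rfl ⟨i, hi⟩ a).2 ⟨a.2, ha⟩⟩
  obtain ⟨st', t, hexec, ht, hcov, hmin, hle, hptr⟩ := run_coverCmd hE (st := st) rfl rfl
    (fun i hi => by
      rw [hk]
      exact (T.encode_getD_of_lt ⟨i, hi⟩).trans_lt (T.symCode_lt ⟨i, hi⟩))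
    ((nonSolid_encode rfl).trans hk.symm) hne le_rfl
  obtain ⟨s, t', hs, hrep', ht'⟩ := hexec.exec_compile rfl hM hrep
  obtain ⟨S, hS, hSU⟩ := exists_cover_of_covers (T := T) rfl hcov
  refine ⟨s, t', hs, ⟨_, S, ⟨hS, fun m' S' hS' => ?_⟩, hrep'.reg .n, fun i => ?_⟩, ?_⟩
  · obtain ⟨f, hf⟩ := covers_of_isCover (E := E) rfl hS'
    exact hmin m' f hf
  · obtain ⟨c, hc1, hc2⟩ := hSU i
    refine ⟨c, hc1, ?_⟩
    have h1 := hrep'.reg .sigma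
    have h3 := hrep'.mem .best i (by have := i.2; have : E.D = n + σ * k + 1 := rfl; omega)
    rw [show s.reg 1 = 29 * E.D from h1.trans hptr, ← hc2]
    exact h3
  · have hcost := ht'.trans (Nat.mul_le_mul_left _ (ht.trans (coverCost_le h2 hσn hkn)))
    have hσ1 : (1 : ℝ) ≤ σ := by exact_mod_cast (show 1 ≤ σ by omega)
    -- The program is bounded with the rounded-down exponent, which is at most the real number `k /
    -- 2` of the statement.
    have hpow : ((σ ^ (k / 2) : ℕ) : ℝ) ≤ (σ : ℝ) ^ ((k : ℝ) / 2) := by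
      rw [Nat.cast_pow, ← Real.rpow_natCast]
      exact Real.rpow_le_rpow_of_exponent_le hσ1 (by simpa using Nat.cast_div_le (α := ℝ) (m := k) (n := 2))
    calc (t' : ℝ) ≤ ((coverCmd.weight * (800 * (n * σ ^ (k / 2) * max k 1)) : ℕ) : ℝ) := by
          exact_mod_cast hcost
      _ = coverCmd.weight * 800 * (n * ((σ ^ (k / 2) : ℕ) : ℝ) * max (k : ℝ) 1) := by
          push_cast
          ring
      _ ≤ _ := by gcongr
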